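/- Let $\Gamma=\mathrm{PSL}_2(\mathbb Z)$, let $n\ge 1$, and let $\Sigma=\Sigma_n$ be the set of integral $2\times2$ matrices of determinant $n$, modulo $\pm1$. Let $\mathbb Q[\Sigma]$ be the vector space of finite formal combinations of elements of $\Sigma$, with its left and right $\mathbb Q[\Gamma]$-module structures. For $A=\sum c_MM\in\mathbb Q[\Sigma]$ and $X\subset\Sigma$ put $\deg_XA=\sum_{M\in X}c_M$, and let $A\mapsto A^\vee$ be the linear extension of the adjoint $M\mapsto M^\vee=(\det M)M^{-1}$. Let $g_1,g_2$ be generators of $\Gamma$ of orders $m_1=2$, $m_2=3$. Fix representatives $\bar\tau\in\Sigma$ of the cosets $\tau\in\Gamma\backslash\Sigma$, let $\gamma_{\tau g_i^{-1},g_i}\in\Gamma$ be defined by $\overline{\tau g_i^{-1}}\,g_i=\gamma_{\tau g_i^{-1},g_i}\,\bar\tau$, and choose Fox derivatives of these elements, i.e. elements $\frac{\partial \gamma}{\partial g_j}\in\mathbb Z[\Gamma]$ with $1-\gamma=\sum_{j}(1-g_j)\frac{\partial \gamma}{\partial g_j}$. Put $T_\Sigma=\sum_\tau\bar\tau$, $\;\frac{\partial_\Sigma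 g_i}{\partial g_j}=\sum_\tau\frac{\partial\gamma_{\tau g_i^{-1},g_i}}{\partial g_j}\bar\tau$, $\;\pi_i=\frac{1+g_i+\dots+g_i^{m_i-1}}{m_i}$, $\;X_1=\frac12$, $\;X_2=\frac{2+g_2}{3}$, and $$\widetilde T_\Sigma=T_\Sigma-\sum_{i=1}^2\frac{\partial_\Sigma g_i}{\partial g_i}+\sum_{i=1}^2\pi_i\frac{\partial_\Sigma g_i}{\partial g_i},\qquad \widetilde T'_\Sigma=T_\Sigma-\sum_{i=1}^2(1-g_i)\frac{\partial_\Sigma g_i}{\partial g_i}X_i .$$ Let $S=\pm\begin{pmatrix}0&-1\\1&0\end{pmatrix}$, $T=\pm\begin{pmatrix}1&1\\0&1\end{pmatrix}$, $U=TS$, and $T_n^\infty=\sum_{ad=n,\;d>0,\;0\le b<d}\begin{pmatrix}a&b\\0&d\end{pmatrix}$. A Popa–Zagier operator $\widetilde T_n$ is an element of $\mathbb Q[\Sigma]$ such that $(1-S)\widetilde T_n-T_n^\infty(1-S)\in(1-T)\mathbb Q[\Sigma]$, $\;\widetilde T_n(1+S)\in(1+U+U^2)\mathbb Q[\Sigma]$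 and $\widetilde T_n(1+U+U^2)\in(1+S)\mathbb Q[\Sigma]$. For $M\in\Sigma$ let $\Gamma_M$ be its centralizer in $\Gamma$, and $n(M)$ the number of its fixed points in the union of the upper half-plane $\mathcal H$ and the set of cusps of $\Gamma$. Let $w_\Gamma(M)=-\frac{|\Gamma\backslash\mathcal H|}{2\pi}$ if $M$ is scalar, where $|\Gamma\backslash\mathcal H|$ is the hyperbolic area, and $w_\Gamma(M)=\frac{(-1)^{n(M)+1}}{|\Gamma_M|}$ if $M$ is not scalar, with $w_\Gamma(M)=0$ if moreover $\Gamma_M$ is infinite. Then, for all choices above: 1. $\deg_X\widetilde T'_\Sigma=\deg_X\widetilde T_\Sigma$ for every $\Gamma$-conjugacy class $X\subset\Sigma$; 2. $\deg_\tau\widetilde T'_\Sigma=1$ for every coset $\tau\in\Gamma\backslash\Sigma$; 3. $\pi_i\widetilde T'_\Sigma=\pi_iT_\Sigma\pi_j$ for $\{i,j\}=\{1,2\}$; 4. there is $h\in\Gamma$ with $g_1=hSh^{-1}$ and $g_2=hU^{\pm1}h^{-1}$ for which $h^{-1}\bigl(-\widetilde T'_\Sigma\bigr)^{\vee}h$ is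 a Popa–Zagier operator $\widetilde T_n$; in particular, $(-\widetilde T'_\Sigma)^\vee$ is one if $g_1=S$ and $g_2=U^{\pm1}$; 5. $\varepsilon_\Gamma(X):=\deg_X\widetilde T_\Sigma=w_\Gamma(M)$ for every $\Gamma$-conjugacy class $X\subset\Sigma$ and every $M\in X$. -/

import Mathlib

open scoped MatrixGroups UpperHalfPlane

namespace ModularHecke

/-! ### Integral `2 × 2` matrices modulo `±1`, and `Γ = PSL₂(ℤ)` inside them -/

/-- The congruence `A ∼ ± A` on integral `2 × 2` matrices. -/
def signCon : Con (Matrix (Fin 2) (Fin 2) ℤ) where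
  r A B := A = B ∨ A = -B
  iseqv :=
    { refl := fun _ => Or.inl rfl
      symm := by
        rintro A B (h | h)
        · exact Or.inl h.symm
        · exact Or.inr (by rw [h, neg_neg])
      trans := by
        rintro A B C (rfl | rfl) (rfl | rfl)
        · exact Or.inl rfl
        · exact Or.inr rfl
        · exact Or.inr rfl
        · exact Or.inl (neg_neg _) }
  mul' := by
    rintro A B C D (rfl | rfl) (rfl | rfl) <;> simp

/-- The multiplicative monoid of integral `2 × 2` matrices modulo `±1`. -/
abbrev PMat : Type := signCon.Quotient

/-- The class of a matrix modulo `±1`. -/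
def cls : Matrix (Fin 2) (Fin 2) ℤ →* PMat := signCon.mk'

/-- The determinant; it does not change under `A ↦ -A`. -/
def det : PMat →* ℤ :=
  signCon.lift (Matrix.detMonoidHom : Matrix (Fin 2) (Fin 2) ℤ →* ℤ) (by
    rintro A B (rfl | rfl)
    · rfl
    · simp [Con.ker_rel, Matrix.det_neg])

/-- The adjoint `M ↦ M^∨ = (det M) M⁻¹`, i.e. `(a b; c d) ↦ (d -b; -c a)`. -/
def adj : PMat → PMat :=
  Quotient.map' (fun A => A.adjugate) (by
    rintro A B (rfl | rfl)
    · exact Or.inl rfl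
    · refine Or.inr ?_
      simp only [Matrix.adjugate_fin_two]
      ext i j
      fin_cases i <;> fin_cases j <;> simp)

/-- The modular group `PSL₂(ℤ)`. -/
abbrev Γ : Type := PSL(2, ℤ)

/-- The embedding of `PSL₂(ℤ)` in integral matrices modulo `±1`. -/
def ofPSL : Γ →* PMat :=
  QuotientGroup.lift (Subgroup.center SL(2, ℤ))
    { toFun := fun A => cls A.1
      map_one' := rfl
      map_mul' := fun _ _ => rfl }
    (by
      intro A hA
      obtain ⟨r, hr, hA⟩ := Matrix.SpecialLinearGroup.mem_center_iff.1 hA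
      have hr' : r = 1 ∨ r = -1 := by
        rw [Fintype.card_fin] at hr
        exact mul_self_eq_one_iff.1 (by rw [← sq]; exact hr)
      refine (Con.eq signCon).2 ?_
      rcases hr' with rfl | rfl
      · exact Or.inl (by rw [← hA]; simp)
      · exact Or.inr (by rw [← hA]; simp))

/-- `S = ±(0 -1; 1 0)`. -/
def S : Γ := QuotientGroup.mk ModularGroup.S

/-- `T = ±(1 1; 0 1)`. -/
def T : Γ := QuotientGroup.mk ModularGroup.T

/-- `U = T S = ±(1 -1; 1 0)`. -/
def U : Γ := T * S

/-! ### The rational vector spaces `ℚ[Σ_n]` -/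

/-- Finite formal rational combinations of integral matrices modulo `±1`, with the product
extended linearly from matrix multiplication. It contains `ℚ[Γ]` and all the `ℚ[Σ_n]`, where
`Σ_n` is the set of `M : PMat` with `det M = n`; the left and right actions of `ℚ[Γ]` on `ℚ[Σ_n]`
are given by the product. -/
abbrev R : Type := MonoidAlgebra ℚ PMat

/-- A matrix as a basis element of `R`. -/
noncomputable def el (M : PMat) : R := MonoidAlgebra.of ℚ PMat M

/-- An element of `Γ` as a basis element of `R`. -/
noncomputable def elΓ (γ : Γ) : R := el (ofPSL γ)

/-- The linear extension `ℤ[Γ] → R` of the embedding of `Γ`. -/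
noncomputable def ofZΓ : MonoidAlgebra ℤ Γ →ₐ[ℤ] R :=
  MonoidAlgebra.lift ℤ R Γ ((MonoidAlgebra.of ℚ PMat : PMat →* R).comp ofPSL)

/-- `a` lies in `ℚ[Σ_n]`. -/
def SupportedOn (n : ℕ) (a : R) : Prop := ∀ M, a.coeff M ≠ 0 → det M = n

/-- The linear extension to `R` of the adjoint `M ↦ M^∨`. -/
noncomputable def adjR (a : R) : R := MonoidAlgebra.mapDomain adj a

open Classical in
/-- `deg_X a`, the sum of the coefficients in `a` of the elements of `X`. -/
noncomputable def deg (X : Set PMat) (a : R) : ℚ :=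
  ∑ M ∈ a.coeff.support with M ∈ X, a.coeff M

/-- The `Γ`-conjugacy class of `M`. -/
def conjClass (M : PMat) : Set PMat := {N | ∃ γ : Γ, N = ofPSL γ * M * ofPSL γ⁻¹}

/-- The coset `Γ M`. -/
def coset (M : PMat) : Set PMat := {N | ∃ γ : Γ, N = ofPSL γ * M}

/-! ### The elements `T_Σ`, `∂_Σ g_i / ∂ g_j`, `T̃_Σ` and `T̃'_Σ` -/

/-- The choices that enter into `T̃_Σ` for `Σ = Σ_n` and generators `g 0`, `g 1` of `Γ`.
Writing `τ̄` for the chosen representative of a coset `τ ∈ Γ \ Σ_n`, the element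
`γ = γ_{τ g_i⁻¹, g_i}` of `Γ` is defined by `(τ g_i⁻¹)‾ g_i = γ τ̄`; in other words, it is the only
`γ` such that `γ τ̄ g_i⁻¹` is one of the chosen representatives. -/
structure Choices (g : Fin 2 → Γ) (n : ℕ) where
  /-- The representatives of the cosets in `Γ \ Σ_n`. -/
  reps : Finset PMat
  det_reps : ∀ r ∈ reps, det r = n
  existsUnique_rep : ∀ M : PMat, det M = n → ∃! r, r ∈ reps ∧ M ∈ coset r
  /-- `fox r i j` is a choice of the Fox derivative `∂γ_{τ g_i⁻¹, g_i} / ∂g_j` for `τ = Γ r`. -/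
  fox : PMat → Fin 2 → Fin 2 → MonoidAlgebra ℤ Γ
  fox_spec : ∀ r ∈ reps, ∀ i, ∀ γ : Γ, ofPSL γ * r * ofPSL (g i)⁻¹ ∈ reps →
    1 - MonoidAlgebra.of ℤ Γ γ = ∑ j, (1 - MonoidAlgebra.of ℤ Γ (g j)) * fox r i j

variable {g : Fin 2 → Γ} {n : ℕ}

/-- `T_Σ`, the sum of the representatives. -/
noncomputable def Choices.heckeSum (c : Choices g n) : R := ∑ r ∈ c.reps, el r

/-- `∂_Σ g_i / ∂ g_j = ∑_τ (∂γ_{τ g_i⁻¹, g_i} / ∂g_j) τ̄`. -/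
noncomputable def Choices.pd (c : Choices g n) (i j : Fin 2) : R :=
  ∑ r ∈ c.reps, ofZΓ (c.fox r i j) * el r

/-- `π_i = (1 + g_i + ⋯ + g_i ^ (m_i - 1)) / m_i`, where `m_i` is the order of `g_i`. -/
noncomputable def idem (γ : Γ) : R := (1 / (orderOf γ : ℚ)) • ∑ k ∈ Finset.range (orderOf γ), elΓ γ ^ k

/-- `T̃_Σ = T_Σ - ∑_i ∂_Σ g_i / ∂ g_i + ∑_i π_i · ∂_Σ g_i / ∂ g_i`. -/
noncomputable def Choices.Ttilde (c : Choices g n) : R :=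
  c.heckeSum - ∑ i, c.pd i i + ∑ i, idem (g i) * c.pd i i

/-- `X_1 = 1 / 2` and `X_2 = (2 + g_2) / 3`. -/
noncomputable def Xaux (g : Fin 2 → Γ) : Fin 2 → R :=
  ![(1 / 2 : ℚ) • 1, (1 / 3 : ℚ) • (2 + elΓ (g 1))]

/-- `T̃'_Σ = T_Σ - ∑_i (1 - g_i) (∂_Σ g_i / ∂ g_i) X_i`. -/
noncomputable def Choices.Ttilde' (c : Choices g n) : R :=
  c.heckeSum - ∑ i, (1 - elΓ (g i)) * c.pd i i * Xaux g i

/-! ### The operators of Popa and Zagier on period polynomials -/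

/-- `T_n^∞`, the sum of the matrices `(a b; 0 d)` with `a d = n` and `0 ≤ b < d`. -/
noncomputable def Tinfty (n : ℕ) : R :=
  ∑ d ∈ n.divisors, ∑ b ∈ Finset.range d, el (cls !![((n / d : ℕ) : ℤ), (b : ℤ); 0, (d : ℤ)])

/-- `a ∈ ℚ[Σ_n]` is one of the operators `T̃_n` of Popa and Zagier. -/
structure IsPopaZagier (n : ℕ) (a : R) : Prop where
  supported : SupportedOn n a
  /-- `(1 - S) T̃_n - T_n^∞ (1 - S) ∈ (1 - T) ℚ[Σ_n]`: `T̃_n` acts as the Hecke operator on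
  period polynomials. -/
  hecke : ∃ Y, SupportedOn n Y ∧ (1 - elΓ S) * a - Tinfty n * (1 - elΓ S) = (1 - elΓ T) * Y
  /-- `T̃_n (1 + S) ∈ (1 + U + U²) ℚ[Σ_n]`. -/
  mul_one_add_S : ∃ Y, SupportedOn n Y ∧ a * (1 + elΓ S) = (1 + elΓ U + elΓ U ^ 2) * Y
  /-- `T̃_n (1 + U + U²) ∈ (1 + S) ℚ[Σ_n]`. -/
  mul_one_add_U : ∃ Y, SupportedOn n Y ∧ a * (1 + elΓ U + elΓ U ^ 2) = (1 + elΓ S) * Y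

/-! ### The conjugacy class invariant `w_Γ` -/

/-- `M` is the class of a scalar matrix. -/
def IsScalar (M : PMat) : Prop := ∃ k : ℤ, M = cls (Matrix.scalar (Fin 2) k)

/-- The centralizer `Γ_M` of `M` in `Γ`. -/
def centralizer (M : PMat) : Subgroup Γ where
  carrier := {γ | ofPSL γ * M = M * ofPSL γ}
  one_mem' := by simp
  mul_mem' := by
    intro a b ha hb
    simp only [Set.mem_ofPred_eq, map_mul] at *
    rw [mul_assoc, hb, ← mul_assoc, ha, mul_assoc]
  inv_mem' := by
    intro a ha
    simp only [Set.mem_ofPred_eq] at *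
    have h1 : ofPSL a⁻¹ * ofPSL a = 1 := by rw [← map_mul, inv_mul_cancel, map_one]
    have h2 : ofPSL a * ofPSL a⁻¹ = 1 := by rw [← map_mul, mul_inv_cancel, map_one]
    calc ofPSL a⁻¹ * M = ofPSL a⁻¹ * M * (ofPSL a * ofPSL a⁻¹) := by rw [h2, mul_one]
      _ = ofPSL a⁻¹ * (M * ofPSL a) * ofPSL a⁻¹ := by simp only [mul_assoc]
      _ = ofPSL a⁻¹ * (ofPSL a * M) * ofPSL a⁻¹ := by rw [ha]
      _ = ofPSL a⁻¹ * ofPSL a * M * ofPSL a⁻¹ := by simp only [mul_assoc]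
      _ = M * ofPSL a⁻¹ := by rw [h1, one_mul]

/-- `A` is an element of `GL₂(ℝ)` in the class `M`. -/
def IsRealLift (M : PMat) (A : GL (Fin 2) ℝ) : Prop :=
  ∃ B : Matrix (Fin 2) (Fin 2) ℤ, cls B = M ∧ A.val = B.map (fun x : ℤ => (x : ℝ))

/-- The fixed points of `M` in the upper half-plane. -/
def fixedH (M : PMat) : Set ℍ := {z | ∃ A, IsRealLift M A ∧ A • z = z}

/-- The cusps of the modular group that are fixed by `M`. -/
def fixedCusps (M : PMat) : Set (OnePoint ℝ) :=
  {x | IsCusp x (Matrix.SpecialLinearGroup.mapGL ℝ : SL(2, ℤ) →* GL (Fin 2) ℝ).range ∧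
    ∃ A, IsRealLift M A ∧ A • x = x}

/-- `n(M)`, the number of fixed points of `M` in the union of `ℍ` and the set of cusps. -/
noncomputable def numFixed (M : PMat) : ℕ := (fixedH M).ncard + (fixedCusps M).ncard

/-- `|Γ \ ℍ|`, the hyperbolic area (for `dx dy / y²`) of the standard fundamental domain
`{|z| ≥ 1, |Re z| ≤ 1 / 2}`. -/
noncomputable def area : ℝ := (MeasureTheory.volume ModularGroup.fd).toReal

open Classical in
/-- `w_Γ(M)`: it is `-|Γ \ ℍ| / 2π` for scalar `M`; for other `M` it is `(-1)^(n(M) + 1) / |Γ_M|`,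
which is read as `0` when `Γ_M` is infinite. -/
noncomputable def w (M : PMat) : ℝ :=
  if IsScalar M then -area / (2 * Real.pi)
  else if Finite (centralizer M) then (-1) ^ (numFixed M + 1) / (Nat.card (centralizer M) : ℝ)
  else 0

end ModularHecke

namespace ModularHecke

/-! ### Integral matrices modulo sign -/

/-! The formal properties of `T̃'_Σ` come from two identities: the Fox relation `T_Σ (1 - g_i) = ∑_j
(1 - g_j) ∂_Σ g_i / ∂ g_j` (`Choices.heckeSum_mul_one_sub`) and `X_i (1 - g_i) = 1 - π_i`
(`Xaux_mul_one_sub`). The degree on a conjugacy class is a trace, a left factor `1 - g_i` has degree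
zero on every coset `Γ M`, and `π_i (1 - g_i) = 0`; this gives the first three assertions.

By `exists_conj_generators`, `g 0` and `g 1` are simultaneously conjugate to `S` and `U ^ (± 1)`. A
conjugate of `T̃'_Σ` therefore satisfies `IsLift`: it has degree one on cosets, and two vanishing
relations link the norms of `S` and `U` on one side with `1 - U` and `1 - S` on the other. The
structural fact about lifts is that in positive determinant the right ideals generated by `1 - S`
and `1 - U` meet only in zero (`eq_zero_of_annihilated`, a descent on the scalar product of the
rows). Two consequences follow. Any two lifts have the same degree on each conjugacy class
(`IsLift.deg_conjClass_eq`). The negated adjoint of any lift is a Popa–Zagier operator, because the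
`(1 - S)`-components of two expressions for `a (1 - T)` must agree (`IsLift.exists_mul_one_sub_S`).

The last assertion is thus a computation with a single lift. `liftElt` is built from the signs of
the off-diagonal entry of `M Q Mᵗ` for two forms: the identity, fixed by `S`, and `(2 1; 1 2)`,
fixed by `U`. That it is a lift rests on the weighted count of the reduced translates of a definite
form being always three (`finsum_chi`). On a class of non-scalar matrices the Heaviside values may
be replaced by those of `classKey`, which has the same sign outside a finite set; the errors have
finite support and cancel by symmetry, so that the degree is a third of the sum of `triVal`
(`deg_conjClass_liftElt`).

For negative discriminant `triVal` is the reduction count of the fixed-point form, and the degree is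
`1 / |Γ_M|`. For nonnegative discriminant the sum collapses to minus the number of class members in
`edgeSet`, which is one if the discriminant is a nonzero square and zero otherwise. A scalar class
has degree `-1/6 = -(π/3) / (2π)`. Centralizers, fixed points and the area are computed separately
and compared with these values. -/

theorem cls_eq_iff {A B : Matrix (Fin 2) (Fin 2) ℤ} : cls A = cls B ↔ A = B ∨ A = -B :=
  Con.eq signCon

theorem exists_cls (M : PMat) : ∃ A, M = cls A := by
  induction M using Con.induction_on with
  | H A => exact ⟨A, rfl⟩

theorem exists_entries (M : PMat) : ∃ a b c d, M = cls !![a, b; c, d] := by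
  obtain ⟨A, rfl⟩ := exists_cls M
  exact ⟨A 0 0, A 0 1, A 1 0, A 1 1, congrArg cls (Matrix.eta_fin_two A)⟩

theorem cls_entries_eq_iff {a b c d a' b' c' d' : ℤ} :
    cls !![a, b; c, d] = cls !![a', b'; c', d'] ↔
      (a = a' ∧ b = b' ∧ c = c' ∧ d = d') ∨ (a = -a' ∧ b = -b' ∧ c = -c' ∧ d = -d') := by
  rw [cls_eq_iff]
  simp [and_assoc]

theorem cls_mul_cls (a b c d a' b' c' d' : ℤ) :
    cls !![a, b; c, d] * cls !![a', b'; c', d'] =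
      cls !![a * a' + b * c', a * b' + b * d'; c * a' + d * c', c * b' + d * d'] := by
  rw [← map_mul, Matrix.mul_fin_two]

theorem cls_neg (a b c d : ℤ) : cls !![-a, -b; -c, -d] = cls !![a, b; c, d] :=
  cls_entries_eq_iff.2 (Or.inr ⟨rfl, rfl, rfl, rfl⟩)

@[simp] theorem det_cls (a b c d : ℤ) : det (cls !![a, b; c, d]) = a * d - b * c :=
  Matrix.det_fin_two_of a b c d

@[simp] theorem adj_cls (a b c d : ℤ) : adj (cls !![a, b; c, d]) = cls !![d, -b; -c, a] := by
  show cls (Matrix.adjugate !![a, b; c, d]) = _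
  rw [Matrix.adjugate_fin_two_of]

theorem exists_ofPSL_eq (γ : Γ) : ∃ a b c d, a * d - b * c = 1 ∧ ofPSL γ = cls !![a, b; c, d] := by
  obtain ⟨A, rfl⟩ := QuotientGroup.mk_surjective γ
  refine ⟨A.1 0 0, A.1 0 1, A.1 1 0, A.1 1 1, ?_, congrArg cls (Matrix.eta_fin_two A.1)⟩
  rw [← Matrix.det_fin_two]
  exact A.2

theorem exists_ofPSL {a b c d : ℤ} (h : a * d - b * c = 1) :
    ∃ γ : Γ, ofPSL γ = cls !![a, b; c, d] :=
  ⟨QuotientGroup.mk ⟨!![a, b; c, d], by rw [Matrix.det_fin_two_of, h]⟩, rfl⟩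

@[simp] theorem det_ofPSL (γ : Γ) : det (ofPSL γ) = 1 := by
  obtain ⟨a, b, c, d, h, hγ⟩ := exists_ofPSL_eq γ
  rw [hγ, det_cls, h]

theorem ofPSL_injective : Function.Injective ofPSL := by
  rw [injective_iff_map_eq_one]
  intro γ hγ
  obtain ⟨A, rfl⟩ := QuotientGroup.mk_surjective γ
  have h1 : cls A.1 = cls 1 := hγ
  rw [QuotientGroup.eq_one_iff, Matrix.SpecialLinearGroup.mem_center_iff]
  rcases cls_eq_iff.1 h1 with h | h
  · exact ⟨1, by simp, by rw [h]; simp⟩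
  · exact ⟨-1, by simp, by rw [h]; simp⟩

theorem ofPSL_S : ofPSL S = cls !![0, -1; 1, 0] := rfl

theorem ofPSL_T : ofPSL T = cls !![1, 1; 0, 1] := rfl

theorem ofPSL_U : ofPSL U = cls !![1, -1; 1, 0] := by
  rw [U, map_mul, ofPSL_S, ofPSL_T, cls_mul_cls]
  norm_num

theorem ofPSL_one : ofPSL 1 = cls !![1, 0; 0, 1] := by
  rw [map_one, ← Matrix.one_fin_two]; rfl

theorem ofPSL_inv {γ : Γ} {a b c d : ℤ} (h : ofPSL γ = cls !![a, b; c, d]) :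
    ofPSL γ⁻¹ = cls !![d, -b; -c, a] := by
  have hd : a * d - b * c = 1 := by rw [← det_cls, ← h, det_ofPSL]
  obtain ⟨δ, hδ⟩ := exists_ofPSL (a := d) (b := -b) (c := -c) (d := a) (by linarith)
  rw [← hδ]
  congr 1
  refine inv_eq_of_mul_eq_one_left (ofPSL_injective ?_)
  rw [map_mul, hδ, h, cls_mul_cls, ofPSL_one, cls_entries_eq_iff]
  left
  refine ⟨?_, ?_, ?_, ?_⟩ <;> linarith

theorem ofPSL_U_inv : ofPSL U⁻¹ = cls !![0, 1; -1, 1] := by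
  rw [ofPSL_inv ofPSL_U]; norm_num

theorem ofPSL_inv_mul_cancel_left (γ : Γ) (M : PMat) : ofPSL γ⁻¹ * (ofPSL γ * M) = M := by
  rw [← mul_assoc, ← map_mul, inv_mul_cancel, map_one, one_mul]

theorem ofPSL_mul_inv_cancel_left (γ : Γ) (M : PMat) : ofPSL γ * (ofPSL γ⁻¹ * M) = M := by
  rw [← mul_assoc, ← map_mul, mul_inv_cancel, map_one, one_mul]

theorem ofPSL_mul_inv_cancel_right (γ : Γ) (M : PMat) : M * ofPSL γ * ofPSL γ⁻¹ = M := by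
  rw [mul_assoc, ← map_mul, mul_inv_cancel, map_one, mul_one]

theorem ofPSL_inv_mul_cancel_right (γ : Γ) (M : PMat) : M * ofPSL γ⁻¹ * ofPSL γ = M := by
  rw [mul_assoc, ← map_mul, inv_mul_cancel, map_one, mul_one]

theorem S_mul_S : S * S = 1 := by
  apply ofPSL_injective
  rw [map_mul, ofPSL_S, cls_mul_cls, ofPSL_one, cls_entries_eq_iff]
  norm_num

theorem S_inv : S⁻¹ = S := inv_eq_of_mul_eq_one_left S_mul_S

theorem U_pow_three : U ^ 3 = 1 := by
  apply ofPSL_injective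
  rw [pow_succ, pow_two, map_mul, map_mul, ofPSL_U, cls_mul_cls, cls_mul_cls, ofPSL_one,
    cls_entries_eq_iff]
  norm_num

theorem U_sq : U ^ 2 = U⁻¹ := by
  rw [eq_inv_iff_mul_eq_one, ← pow_succ, U_pow_three]

theorem U_inv_sq : U⁻¹ ^ 2 = U := by rw [inv_pow, U_sq, inv_inv]

theorem U_mul_S : U * S = T := by rw [U, mul_assoc, S_mul_S, mul_one]

/-- The conjugation of matrices by an element of `Γ`. -/
def conjEquiv (γ : Γ) : PMat ≃ PMat where
  toFun M := ofPSL γ * M * ofPSL γ⁻¹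
  invFun M := ofPSL γ⁻¹ * M * ofPSL γ
  left_inv M := by
    simp only [mul_assoc, ofPSL_inv_mul_cancel_left]
    rw [← map_mul, inv_mul_cancel, map_one, mul_one]
  right_inv M := by
    simp only [mul_assoc, ofPSL_mul_inv_cancel_left]
    rw [← map_mul, mul_inv_cancel, map_one, mul_one]

theorem conjEquiv_apply (γ : Γ) (M : PMat) : conjEquiv γ M = ofPSL γ * M * ofPSL γ⁻¹ := rfl

theorem conjEquiv_mul (γ δ : Γ) (M : PMat) : conjEquiv (γ * δ) M = conjEquiv γ (conjEquiv δ M) := by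
  simp only [conjEquiv_apply, map_mul, mul_inv_rev, mul_assoc]

theorem conjEquiv_one (M : PMat) : conjEquiv 1 M = M := by
  simp [conjEquiv_apply]

theorem mem_conjClass {M N : PMat} : N ∈ conjClass M ↔ ∃ γ, N = conjEquiv γ M := Iff.rfl

theorem mem_conjClass_self (M : PMat) : M ∈ conjClass M := ⟨1, (conjEquiv_one M).symm⟩

theorem conjEquiv_mem_conjClass {M N : PMat} (γ : Γ) :
    conjEquiv γ N ∈ conjClass M ↔ N ∈ conjClass M := by
  constructor
  · rintro ⟨δ, hδ⟩
    refine ⟨γ⁻¹ * δ, ?_⟩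
    rw [← conjEquiv_apply] at hδ ⊢
    rw [conjEquiv_mul, ← hδ, ← conjEquiv_mul, inv_mul_cancel, conjEquiv_one]
  · rintro ⟨δ, rfl⟩
    exact ⟨γ * δ, (conjEquiv_mul γ δ M).symm⟩

theorem mem_coset_self (M : PMat) : M ∈ coset M := ⟨1, by simp⟩

theorem mul_mem_coset {M N : PMat} (γ : Γ) : ofPSL γ * N ∈ coset M ↔ N ∈ coset M := by
  constructor
  · rintro ⟨δ, hδ⟩
    exact ⟨γ⁻¹ * δ, by rw [map_mul, mul_assoc, ← hδ, ofPSL_inv_mul_cancel_left]⟩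
  · rintro ⟨δ, rfl⟩
    exact ⟨γ * δ, by rw [map_mul, mul_assoc]⟩

theorem mem_coset_comm {M N : PMat} : N ∈ coset M ↔ M ∈ coset N := by
  constructor <;>
  · rintro ⟨δ, rfl⟩
    exact ⟨δ⁻¹, (ofPSL_inv_mul_cancel_left δ _).symm⟩

theorem coset_eq_of_mem {M N : PMat} (h : N ∈ coset M) : coset N = coset M := by
  obtain ⟨δ, rfl⟩ := h
  ext P
  rw [mem_coset_comm, mul_mem_coset, mem_coset_comm]

theorem det_ofPSL_mul (γ : Γ) (M : PMat) : det (ofPSL γ * M) = det M := by simp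

theorem det_mul_ofPSL (γ : Γ) (M : PMat) : det (M * ofPSL γ) = det M := by simp

theorem det_conjEquiv (γ : Γ) (M : PMat) : det (conjEquiv γ M) = det M := by
  simp [conjEquiv_apply]

/-- Matrices of nonzero determinant can be cancelled on the right. -/
theorem mul_right_cancel_of_det {M N P : PMat} (hP : det P ≠ 0) (h : M * P = N * P) : M = N := by
  obtain ⟨A, rfl⟩ := exists_cls M
  obtain ⟨B, rfl⟩ := exists_cls N
  obtain ⟨C, rfl⟩ := exists_cls P
  have hC : C.det ≠ 0 := hP
  have key : ∀ D : Matrix (Fin 2) (Fin 2) ℤ, A * C = D * C → A = D := by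
    intro D hD
    have := congrArg (· * C.adjugate) hD
    simp only [mul_assoc, Matrix.mul_adjugate, Matrix.mul_smul, mul_one] at this
    exact smul_right_injective _ hC this
  rw [← map_mul, ← map_mul, cls_eq_iff] at h
  rw [cls_eq_iff]
  rcases h with h | h
  · exact Or.inl (key _ h)
  · exact Or.inr (key _ (by rw [h, neg_mul]))

/-! ### The algebra of matrices -/

theorem el_mul_el (M N : PMat) : el M * el N = el (M * N) := (map_mul _ M N).symm

theorem elΓ_mul_elΓ (γ δ : Γ) : elΓ γ * elΓ δ = elΓ (γ * δ) := by
  rw [elΓ, elΓ, el_mul_el, ← map_mul]; rfl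

theorem elΓ_one : elΓ 1 = 1 := by rw [elΓ, map_one]; exact map_one _

theorem elΓ_pow (γ : Γ) (k : ℕ) : elΓ γ ^ k = elΓ (γ ^ k) := by
  rw [elΓ, elΓ, el, ← map_pow, ← map_pow]; rfl

theorem elΓ_mul_inv (γ : Γ) : elΓ γ * elΓ γ⁻¹ = 1 := by
  rw [elΓ_mul_elΓ, mul_inv_cancel, elΓ_one]

theorem elΓ_inv_mul (γ : Γ) : elΓ γ⁻¹ * elΓ γ = 1 := by
  rw [elΓ_mul_elΓ, inv_mul_cancel, elΓ_one]

theorem coeff_elΓ_mul (γ : Γ) (a : R) (M : PMat) :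
    (elΓ γ * a).coeff M = a.coeff (ofPSL γ⁻¹ * M) := by
  rw [elΓ, el, MonoidAlgebra.of_apply,
    MonoidAlgebra.coeff_single_mul_eq_mul_coeff (ofPSL γ⁻¹ * M), one_mul]
  intro N _
  constructor
  · rintro rfl; rw [ofPSL_inv_mul_cancel_left]
  · rintro rfl; rw [ofPSL_mul_inv_cancel_left]

theorem coeff_mul_elΓ (γ : Γ) (a : R) (M : PMat) :
    (a * elΓ γ).coeff M = a.coeff (M * ofPSL γ⁻¹) := by
  rw [elΓ, el, MonoidAlgebra.of_apply,
    MonoidAlgebra.coeff_mul_single_eq_coeff_mul (M * ofPSL γ⁻¹), mul_one]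
  intro N _
  constructor
  · rintro rfl; rw [ofPSL_mul_inv_cancel_right]
  · rintro rfl; rw [ofPSL_inv_mul_cancel_right]

theorem coeff_el (M N : PMat) [Decidable (M = N)] : (el M).coeff N = if M = N then 1 else 0 := by
  rw [el, MonoidAlgebra.of_apply, MonoidAlgebra.coeff_single, Finsupp.single_apply]

theorem induction_el {p : R → Prop} (a : R) (hel : ∀ M, p (el M))
    (hadd : ∀ a b, p a → p b → p (a + b)) (hsmul : ∀ (r : ℚ) a, p a → p (r • a)) : p a :=
  MonoidAlgebra.induction_on a hel hadd hsmul

/-! ### Elements supported on matrices of given determinant -/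

namespace SupportedOn

variable {n : ℕ} {a b : R}

theorem zero : SupportedOn n 0 := fun _ h => (h rfl).elim

theorem add (ha : SupportedOn n a) (hb : SupportedOn n b) : SupportedOn n (a + b) := by
  intro M hM
  by_cases h : a.coeff M = 0
  · refine hb M fun h' => hM ?_
    rw [MonoidAlgebra.coeff_add, Finsupp.add_apply, h, h', add_zero]
  · exact ha M h

theorem smul (r : ℚ) (ha : SupportedOn n a) : SupportedOn n (r • a) := by
  intro M hM
  refine ha M fun h' => hM ?_
  rw [MonoidAlgebra.coeff_smul_apply, h', smul_zero]

theorem neg (ha : SupportedOn n a) : SupportedOn n (-a) := by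
  simpa using ha.smul (-1)

theorem sub (ha : SupportedOn n a) (hb : SupportedOn n b) : SupportedOn n (a - b) := by
  rw [sub_eq_add_neg]
  exact ha.add hb.neg

theorem sum {ι : Type*} {s : Finset ι} {f : ι → R} (h : ∀ i ∈ s, SupportedOn n (f i)) :
    SupportedOn n (∑ i ∈ s, f i) :=
  Finset.sum_induction f (SupportedOn n) (fun _ _ => add) zero h

theorem el {M : PMat} (hM : det M = n) : SupportedOn n (el M) := by
  classical
  intro N hN
  rw [coeff_el] at hN
  obtain rfl : M = N := by_contra fun h => hN (if_neg h)
  exact hM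

theorem elΓ_mul (γ : Γ) (ha : SupportedOn n a) : SupportedOn n (elΓ γ * a) := by
  intro M hM
  rw [coeff_elΓ_mul] at hM
  rw [← ha _ hM, det_ofPSL_mul]

theorem mul_elΓ (γ : Γ) (ha : SupportedOn n a) : SupportedOn n (a * elΓ γ) := by
  intro M hM
  rw [coeff_mul_elΓ] at hM
  rw [← ha _ hM, det_mul_ofPSL]

theorem one_sub_mul (γ : Γ) (ha : SupportedOn n a) : SupportedOn n ((1 - elΓ γ) * a) := by
  rw [sub_mul, one_mul]
  exact ha.sub (ha.elΓ_mul γ)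

theorem mul_one_sub (γ : Γ) (ha : SupportedOn n a) : SupportedOn n (a * (1 - elΓ γ)) := by
  rw [mul_sub, mul_one]
  exact ha.sub (ha.mul_elΓ γ)

end SupportedOn

/-! ### Degrees -/

theorem deg_eq_finsuppSum (X : Set PMat) (a : R) :
    deg X a = a.coeff.sum fun M r => X.indicator (fun _ => r) M := by
  classical
  rw [deg, Finset.sum_filter, Finsupp.sum]
  simp only [Set.indicator_apply]

theorem deg_add (X : Set PMat) (a b : R) : deg X (a + b) = deg X a + deg X b := by
  simp only [deg_eq_finsuppSum, MonoidAlgebra.coeff_add]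
  refine Finsupp.sum_add_index' (fun M => ?_) fun M r s => ?_ <;>
  · by_cases h : M ∈ X <;> simp [h]

theorem deg_smul (X : Set PMat) (r : ℚ) (a : R) : deg X (r • a) = r * deg X a := by
  simp only [deg_eq_finsuppSum, MonoidAlgebra.coeff_smul]
  rw [Finsupp.sum_smul_index' (fun M => by simp), Finsupp.mul_sum]
  refine Finsupp.sum_congr fun M _ => ?_
  by_cases h : M ∈ X <;> simp [h]

theorem deg_zero (X : Set PMat) : deg X 0 = 0 := by simp [deg_eq_finsuppSum]

theorem deg_neg (X : Set PMat) (a : R) : deg X (-a) = -deg X a := by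
  simpa using deg_smul X (-1) a

theorem deg_sub (X : Set PMat) (a b : R) : deg X (a - b) = deg X a - deg X b := by
  rw [sub_eq_add_neg, deg_add, deg_neg, sub_eq_add_neg]

theorem deg_sum (X : Set PMat) {ι : Type*} (s : Finset ι) (f : ι → R) :
    deg X (∑ i ∈ s, f i) = ∑ i ∈ s, deg X (f i) := by
  classical
  induction s using Finset.induction_on with
  | empty => simp [deg_zero]
  | insert i s hi ih => rw [Finset.sum_insert hi, Finset.sum_insert hi, deg_add, ih]

theorem deg_el (X : Set PMat) (M : PMat) [Decidable (M ∈ X)] :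
    deg X (el M) = if M ∈ X then 1 else 0 := by
  rw [deg_eq_finsuppSum, el, MonoidAlgebra.of_apply, MonoidAlgebra.coeff_single,
    Finsupp.sum_single_index (by simp), Set.indicator_apply]

theorem deg_eq_finsum (X : Set PMat) (a : R) : deg X a = ∑ᶠ M, X.indicator a.coeff M := by
  classical
  rw [deg_eq_finsuppSum, Finsupp.sum, finsum_eq_sum_of_support_subset]
  · rfl
  · intro M hM
    have h := (Set.indicator_apply_ne_zero.1 hM).2
    simpa using h

/-- The degree on a coset of `Γ` is invariant under left translation. -/
theorem deg_coset_elΓ_mul (M : PMat) (γ : Γ) (a : R) :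
    deg (coset M) (elΓ γ * a) = deg (coset M) a := by
  classical
  induction a using induction_el with
  | hel N => rw [elΓ, el_mul_el, deg_el, deg_el]; simp only [mul_mem_coset]
  | hadd a b ha hb => rw [mul_add, deg_add, deg_add, ha, hb]
  | hsmul r a ha => rw [mul_smul_comm, deg_smul, deg_smul, ha]

theorem deg_coset_one_sub_mul (M : PMat) (γ : Γ) (a : R) :
    deg (coset M) ((1 - elΓ γ) * a) = 0 := by
  rw [sub_mul, one_mul, deg_sub, deg_coset_elΓ_mul, sub_self]

/-- The degree on a conjugacy class is a trace. -/
theorem deg_conjClass_elΓ_mul (M : PMat) (γ : Γ) (a : R) :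
    deg (conjClass M) (elΓ γ * a) = deg (conjClass M) (a * elΓ γ) := by
  classical
  induction a using induction_el with
  | hel N =>
    rw [elΓ, el_mul_el, el_mul_el, deg_el, deg_el]
    have : ofPSL γ * N = conjEquiv γ (N * ofPSL γ) := by
      rw [conjEquiv_apply, ← mul_assoc, ofPSL_mul_inv_cancel_right]
    rw [this]
    simp only [conjEquiv_mem_conjClass]
  | hadd a b ha hb => rw [mul_add, add_mul, deg_add, deg_add, ha, hb]
  | hsmul r a ha => rw [mul_smul_comm, smul_mul_assoc, deg_smul, deg_smul, ha]

/-! ### Quadratic forms attached to matrices -/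

/-- The off-diagonal entry of `M Q Mᵗ`, where `Q` is the symmetric matrix `(x y; y w)`. -/
def offDiag (x y w : ℤ) : PMat → ℤ :=
  Quotient.lift (s := signCon.toSetoid)
    (fun A : Matrix (Fin 2) (Fin 2) ℤ =>
      x * A 0 0 * A 1 0 + y * (A 0 0 * A 1 1 + A 0 1 * A 1 0) + w * A 0 1 * A 1 1) (by
    rintro A B (rfl | rfl)
    · rfl
    · simp)

theorem offDiag_cls (x y w a b c d : ℤ) :
    offDiag x y w (cls !![a, b; c, d]) = x * a * c + y * (a * d + b * c) + w * b * d := rfl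

/-- `S` interchanges the rows and negates one of them. This sign change makes every later difference
of Heaviside values odd under `S`, hence of total sum zero. -/
theorem offDiag_S_mul (x y w : ℤ) (M : PMat) :
    offDiag x y w (ofPSL S * M) = -offDiag x y w M := by
  obtain ⟨a, b, c, d, rfl⟩ := exists_entries M
  rw [ofPSL_S, cls_mul_cls, offDiag_cls, offDiag_cls]
  ring

/-! ### Annihilators of `1 + S` and `1 + U + U²` -/

/-- An element supported on matrices of positive determinant which is annihilated by `1 + S` and
by `1 + U + U²` vanishes. -/
theorem eq_zero_of_annihilated {n : ℕ} (hn : 1 ≤ n) {y : R} (hy : SupportedOn n y)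
    (hS : (1 + elΓ S) * y = 0) (hU : (1 + elΓ U + elΓ U ^ 2) * y = 0) : y = 0 := by
  by_contra hne
  have hS' : ∀ M, y.coeff (ofPSL S * M) = -y.coeff M := by
    intro M
    have h := congrArg (fun z : R => z.coeff M) hS
    simp only [add_mul, one_mul, MonoidAlgebra.coeff_add, Finsupp.add_apply, coeff_elΓ_mul,
      S_inv, MonoidAlgebra.coeff_zero, Finsupp.zero_apply] at h
    linarith
  have hU' : ∀ M, y.coeff M + y.coeff (ofPSL U * M) + y.coeff (ofPSL U⁻¹ * M) = 0 := by
    intro M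
    have h := congrArg (fun z : R => z.coeff M) hU
    simp only [add_mul, one_mul, MonoidAlgebra.coeff_add, Finsupp.add_apply, coeff_elΓ_mul,
      elΓ_pow, U_sq, inv_inv, MonoidAlgebra.coeff_zero, Finsupp.zero_apply] at h
    linarith
  have hne' : y.coeff.support.Nonempty := by
    rw [Finset.nonempty_iff_ne_empty, Ne, Finsupp.support_eq_empty]
    simpa using hne
  -- Descent on the scalar product `p` of the two rows. By the relation for `U`, one of `U M`, `U⁻¹
  -- M` is again in the support. Its rows have scalar product `|r|² - p` for a row `r` of `M`, and
  -- applying `S` gives `p - |r|² < p`, against minimality.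
  obtain ⟨M, hM, hmin⟩ := y.coeff.support.exists_min_image (offDiag 1 0 1) hne'
  simp only [Finsupp.mem_support_iff] at hM hmin
  have hle : offDiag 1 0 1 M ≤ 0 := by
    have h := hmin (ofPSL S * M) (by rw [hS']; exact neg_ne_zero.2 hM)
    rw [offDiag_S_mul] at h
    linarith
  have hdet := hy M hM
  have key : ∀ V : Γ, y.coeff (ofPSL V * M) ≠ 0 →
      offDiag 1 0 1 M ≤ offDiag 1 0 1 (ofPSL S * (ofPSL V * M)) := fun V hV =>
    hmin _ (by rw [hS']; exact neg_ne_zero.2 hV)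
  obtain ⟨a, b, c, d, rfl⟩ := exists_entries M
  rw [det_cls] at hdet
  have hn' : (1 : ℤ) ≤ n := by exact_mod_cast hn
  have h1 : 0 < a ^ 2 + b ^ 2 := by
    rcases eq_or_ne a 0 with rfl | ha
    · rcases eq_or_ne b 0 with rfl | hb
      · simp at hdet; omega
      · positivity
    · positivity
  have h2 : 0 < c ^ 2 + d ^ 2 := by
    rcases eq_or_ne c 0 with rfl | hc
    · rcases eq_or_ne d 0 with rfl | hd
      · simp at hdet; omega
      · positivity
    · positivity
  have hor : y.coeff (ofPSL U * cls !![a, b; c, d]) ≠ 0 ∨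
      y.coeff (ofPSL U⁻¹ * cls !![a, b; c, d]) ≠ 0 := by
    by_contra hcon
    push Not at hcon
    have := hU' (cls !![a, b; c, d])
    rw [hcon.1, hcon.2] at this
    exact hM (by linarith)
  rw [offDiag_cls] at hle
  rcases hor with h | h
  · have := key U h
    rw [ofPSL_U, ofPSL_S, cls_mul_cls, cls_mul_cls, offDiag_cls, offDiag_cls] at this
    nlinarith
  · have := key U⁻¹ h
    rw [ofPSL_U_inv, ofPSL_S, cls_mul_cls, cls_mul_cls, offDiag_cls, offDiag_cls] at this
    nlinarith

/-! ### Relations in `ℚ[Γ]` -/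

theorem elS_mul_elS : elΓ S * elΓ S = 1 := by rw [elΓ_mul_elΓ, S_mul_S, elΓ_one]

theorem elU_pow_three : elΓ U * elΓ U * elΓ U = 1 := by
  rw [elΓ_mul_elΓ, elΓ_mul_elΓ, ← pow_two, ← pow_succ, U_pow_three, elΓ_one]

theorem one_add_S_mul_one_sub_S : (1 + elΓ S) * (1 - elΓ S) = 0 := by
  rw [show (1 + elΓ S) * (1 - elΓ S) = 1 - elΓ S * elΓ S by noncomm_ring, elS_mul_elS, sub_self]

theorem norm_U_mul_one_sub_U : (1 + elΓ U + elΓ U ^ 2) * (1 - elΓ U) = 0 := by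
  rw [show (1 + elΓ U + elΓ U ^ 2) * (1 - elΓ U) = 1 - elΓ U * elΓ U * elΓ U by noncomm_ring,
    elU_pow_three, sub_self]

/-- The sum of the right ideals generated by `1 - S` and `1 - U` is direct. -/
theorem one_sub_S_mul_eq_zero_of_add {n : ℕ} (hn : 1 ≤ n) {a b : R} (ha : SupportedOn n a)
    (h : (1 - elΓ S) * a + (1 - elΓ U) * b = 0) :
    (1 - elΓ S) * a = 0 ∧ (1 - elΓ U) * b = 0 := by
  -- This element also equals `-(1 - U) b`, so it is annihilated by both norms.
  have h1 : (1 - elΓ S) * a = 0 := by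
    refine eq_zero_of_annihilated hn (ha.one_sub_mul S) ?_ ?_
    · rw [← mul_assoc, one_add_S_mul_one_sub_S, zero_mul]
    · rw [eq_neg_of_add_eq_zero_left h, mul_neg, ← mul_assoc, norm_U_mul_one_sub_U, zero_mul,
        neg_zero]
  exact ⟨h1, by rwa [h1, zero_add] at h⟩

/-! ### Decomposition of elements of degree zero on cosets -/

theorem closure_S_U : Subgroup.closure {S, U} = (⊤ : Subgroup Γ) := by
  rw [eq_top_iff]
  have hS : S ∈ Subgroup.closure {S, U} := Subgroup.subset_closure (by simp)
  have hU : U ∈ Subgroup.closure {S, U} := Subgroup.subset_closure (by simp)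
  have hT : T ∈ Subgroup.closure {S, U} := by
    rw [← U_mul_S]
    exact mul_mem hU hS
  rintro γ -
  obtain ⟨A, rfl⟩ := QuotientGroup.mk_surjective γ
  have hA : A ∈ Subgroup.closure {ModularGroup.S, ModularGroup.T} := by
    rw [SpecialLinearGroup.SL2Z_generators]; trivial
  have hle : Subgroup.closure {ModularGroup.S, ModularGroup.T} ≤
      (Subgroup.closure {S, U}).comap (QuotientGroup.mk' (Subgroup.center SL(2, ℤ))) := by
    rw [Subgroup.closure_le]
    rintro B (rfl | rfl)
    · exact hS
    · exact hT
  exact hle hA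

/-- Membership in `(1 - S) ℚ[Σ_n] + (1 - U) ℚ[Σ_n]`. -/
def IsSplit (n : ℕ) (a : R) : Prop :=
  ∃ x y, SupportedOn n x ∧ SupportedOn n y ∧ a = (1 - elΓ S) * x + (1 - elΓ U) * y

namespace IsSplit

variable {n : ℕ} {a b : R}

theorem zero : IsSplit n 0 := ⟨0, 0, .zero, .zero, by simp⟩

theorem add (ha : IsSplit n a) (hb : IsSplit n b) : IsSplit n (a + b) := by
  obtain ⟨x, y, hx, hy, rfl⟩ := ha
  obtain ⟨x', y', hx', hy', rfl⟩ := hb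
  exact ⟨x + x', y + y', hx.add hx', hy.add hy', by noncomm_ring⟩

theorem smul (r : ℚ) (ha : IsSplit n a) : IsSplit n (r • a) := by
  obtain ⟨x, y, hx, hy, rfl⟩ := ha
  exact ⟨r • x, r • y, hx.smul r, hy.smul r, by rw [mul_smul_comm, mul_smul_comm, smul_add]⟩

theorem sum {ι : Type*} {s : Finset ι} {f : ι → R} (h : ∀ i ∈ s, IsSplit n (f i)) :
    IsSplit n (∑ i ∈ s, f i) :=
  Finset.sum_induction f (IsSplit n) (fun _ _ => add) zero h

/-- The identity `1 - γδ = (1 - γ) δ + (1 - δ)` reduces every `1 - γ` to generators: the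
augmentation ideal is generated, as a right ideal, by `1 - S` and `1 - U`. -/
theorem one_sub_mul (γ : Γ) : ∀ x, SupportedOn n x → IsSplit n ((1 - elΓ γ) * x) := by
  have hγ : γ ∈ Subgroup.closure {S, U} := by rw [closure_S_U]; trivial
  induction hγ using Subgroup.closure_induction with
  | mem γ h =>
    intro x hx
    rcases h with rfl | rfl
    · exact ⟨x, 0, hx, .zero, by simp⟩
    · exact ⟨0, x, .zero, hx, by simp⟩
  | one => intro x _; rw [elΓ_one, sub_self, zero_mul]; exact zero
  | mul γ δ _ _ ihγ ihδ =>
    intro x hx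
    have : (1 - elΓ (γ * δ)) * x = (1 - elΓ γ) * (elΓ δ * x) + (1 - elΓ δ) * x := by
      rw [← elΓ_mul_elΓ]; noncomm_ring
    rw [this]
    exact (ihγ _ (hx.elΓ_mul δ)).add (ihδ _ hx)
  | inv γ _ ih =>
    intro x hx
    have : (1 - elΓ γ⁻¹) * x = (-1 : ℚ) • ((1 - elΓ γ) * (elΓ γ⁻¹ * x)) := by
      rw [neg_one_smul, ← mul_assoc, sub_mul 1 (elΓ γ) (elΓ γ⁻¹), elΓ_mul_inv]; noncomm_ring
    rw [this]
    exact (ih _ (hx.elΓ_mul _)).smul _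

theorem el_sub_el {M N : PMat} (hM : det M = n) (h : N ∈ coset M) : IsSplit n (el M - el N) := by
  obtain ⟨γ, rfl⟩ := h
  have := one_sub_mul γ (el M) (.el hM)
  rwa [sub_mul, one_mul, elΓ, el_mul_el] at this

end IsSplit

theorem eq_sum_smul_el (a : R) : a = ∑ M ∈ a.coeff.support, a.coeff M • el M := by
  classical
  ext N
  rw [MonoidAlgebra.coeff_sum, Finset.sum_apply']
  simp only [MonoidAlgebra.coeff_smul, Finsupp.smul_apply, coeff_el, smul_eq_mul, mul_ite, mul_one,
    mul_zero, Finset.sum_ite_eq', Finsupp.mem_support_iff]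
  split_ifs with h
  · rfl
  · exact (not_not.1 h)

/-- An element of degree zero on all cosets lies in `(1 - S) ℚ[Σ_n] + (1 - U) ℚ[Σ_n]`. -/
theorem isSplit_of_deg_coset {n : ℕ} {a : R} (ha : SupportedOn n a)
    (hdeg : ∀ M, det M = n → deg (coset M) a = 0) : IsSplit n a := by
  classical
  -- `r` selects one matrix in each coset. Moving every term of `a` to the selected matrix of its
  -- coset gives zero, because the coset degrees vanish, so `a` is a combination of differences of
  -- matrices in a common coset.
  let r : PMat → PMat := fun M => Quotient.out (s := Setoid.ker coset) (Quotient.mk _ M)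
  have hr : ∀ M, coset (r M) = coset M := fun M => Quotient.mk_out (s := Setoid.ker coset) M
  have hr' : ∀ M N, coset M = coset N → r M = r N := by
    intro M N h
    have : Quotient.mk (Setoid.ker coset) M = Quotient.mk (Setoid.ker coset) N := Quotient.sound h
    simp only [r, this]
  have hmem : ∀ M, r M ∈ coset M := fun M => by rw [← hr]; exact mem_coset_self _
  have hsum : ∑ M ∈ a.coeff.support, a.coeff M • el (r M) = 0 := by
    rw [← Finset.sum_fiberwise_of_maps_to (s := a.coeff.support) (t := a.coeff.support.image r)
      (g := r) (fun M hM => Finset.mem_image_of_mem r hM)]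
    refine Finset.sum_eq_zero fun N hN => ?_
    obtain ⟨M, hM, rfl⟩ := Finset.mem_image.1 hN
    rw [Finset.sum_congr rfl (g := fun P => a.coeff P • el (r M)) (fun P hP => by
      rw [(Finset.mem_filter.1 hP).2]), ← Finset.sum_smul]
    have h0 := hdeg M (ha M (Finsupp.mem_support_iff.1 hM))
    have : ∑ P ∈ a.coeff.support with r P = r M, a.coeff P = deg (coset M) a := by
      rw [deg]
      refine Finset.sum_congr (Finset.filter_congr fun P _ => ?_) fun _ _ => rfl
      constructor
      · intro h
        have : coset P = coset M := by rw [← hr P, h, hr]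
        rw [← this]; exact mem_coset_self P
      · exact fun h => hr' _ _ (coset_eq_of_mem h)
    rw [this, h0, zero_smul]
  rw [eq_sum_smul_el a, ← sub_zero (∑ M ∈ _, _), ← hsum, ← Finset.sum_sub_distrib]
  refine IsSplit.sum fun M hM => ?_
  rw [← smul_sub]
  exact (IsSplit.el_sub_el (ha M (Finsupp.mem_support_iff.1 hM)) (hmem M)).smul _

/-! ### Lifts of Hecke operators -/

/-- The defining properties of `T̃'_Σ` for the generators `S` and `U ^ (± 1)`. -/
structure IsLift (n : ℕ) (a : R) : Prop where
  supported : SupportedOn n a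
  deg_coset : ∀ M, det M = n → deg (coset M) a = 1
  mul_one_sub_U : (1 + elΓ S) * a * (1 - elΓ U) = 0
  mul_one_sub_S : (1 + elΓ U + elΓ U ^ 2) * a * (1 - elΓ S) = 0

/-- The degrees of a lift on conjugacy classes are determined. -/
theorem IsLift.deg_conjClass_eq {n : ℕ} (hn : 1 ≤ n) {a b : R} (ha : IsLift n a)
    (hb : IsLift n b) (M : PMat) : deg (conjClass M) a = deg (conjClass M) b := by
  obtain ⟨x, y, hx, hy, hxy⟩ := isSplit_of_deg_coset (ha.supported.sub hb.supported)
    (fun M hM => by rw [deg_sub, ha.deg_coset M hM, hb.deg_coset M hM, sub_self])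
  -- The relation of `a - b` with `1 - U` says that `1 + S` annihilates this element, the `(1 -
  -- S)`-part dropping out. The norm of `U` annihilates it trivially.
  have hy0 : (1 - elΓ U) * y * (1 - elΓ U) = 0 := by
    refine eq_zero_of_annihilated hn ((hy.one_sub_mul U).mul_one_sub U) ?_ ?_
    · have h : (1 + elΓ S) * (a - b) * (1 - elΓ U) = 0 := by
        rw [mul_sub (1 + elΓ S) a b, sub_mul _ _ (1 - elΓ U), ha.mul_one_sub_U, hb.mul_one_sub_U,
          sub_self]
      rw [hxy, mul_add, ← mul_assoc, one_add_S_mul_one_sub_S, zero_mul, zero_add] at h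
      rw [← mul_assoc, h]
    · rw [← mul_assoc, ← mul_assoc, norm_U_mul_one_sub_U, zero_mul, zero_mul]
  have hx0 : (1 - elΓ S) * x * (1 - elΓ S) = 0 := by
    refine eq_zero_of_annihilated hn ((hx.one_sub_mul S).mul_one_sub S) ?_ ?_
    · rw [← mul_assoc, ← mul_assoc, one_add_S_mul_one_sub_S, zero_mul, zero_mul]
    · have h : (1 + elΓ U + elΓ U ^ 2) * (a - b) * (1 - elΓ S) = 0 := by
        rw [mul_sub _ a b, sub_mul _ _ (1 - elΓ S), ha.mul_one_sub_S, hb.mul_one_sub_S, sub_self]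
      rw [hxy, mul_add, ← mul_assoc _ _ y, norm_U_mul_one_sub_U, zero_mul, add_zero] at h
      rw [← mul_assoc, h]
  have hc : ∀ γ : Γ, ∀ z : R, deg (conjClass M) (elΓ γ * z) = deg (conjClass M) (z * elΓ γ) :=
    fun γ z => deg_conjClass_elΓ_mul M γ z
  -- Since the degree is a trace and `S² = 1`, the degree of `(1 - S) x (1 - S) = 0` is twice that
  -- of `(1 - S) x`.
  have dx : deg (conjClass M) ((1 - elΓ S) * x) = 0 := by
    rw [sub_mul, one_mul, deg_sub, hc, sub_eq_zero]
    have e : x - elΓ S * x - x * elΓ S + elΓ S * x * elΓ S = 0 := by rw [← hx0]; noncomm_ring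
    have e' := congrArg (deg (conjClass M)) e
    rw [deg_add, deg_sub, deg_sub, hc, deg_zero, mul_assoc, hc, mul_assoc, elS_mul_elS,
      mul_one] at e'
    linarith
  -- In order three one equation is not enough. With `d_k` the degree of `y U^k`, the relation and
  -- its right multiple by `U` give `d_0 - 2 d_1 + d_2 = 0` and `d_0 + d_1 - 2 d_2 = 0`, hence `d_0
  -- = d_1`.
  have dy : deg (conjClass M) ((1 - elΓ U) * y) = 0 := by
    rw [sub_mul, one_mul, deg_sub, hc, sub_eq_zero]
    have e : y - elΓ U * y - y * elΓ U + elΓ U * y * elΓ U = 0 := by rw [← hy0]; noncomm_ring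
    have e1 := congrArg (deg (conjClass M)) e
    have e2 := congrArg (fun z => deg (conjClass M) (z * elΓ U)) e
    simp only [add_mul, sub_mul, zero_mul] at e2
    rw [deg_add, deg_sub, deg_sub, hc, deg_zero, mul_assoc, hc, mul_assoc] at e1
    rw [deg_add, deg_sub, deg_sub, deg_zero, mul_assoc (elΓ U), hc, mul_assoc (elΓ U) (y * elΓ U), hc,
      mul_assoc (y * elΓ U) (elΓ U) (elΓ U),
      mul_assoc y (elΓ U) (elΓ U * elΓ U), ← mul_assoc (elΓ U) (elΓ U) (elΓ U), elU_pow_three,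
      mul_one, mul_assoc y] at e2
    linarith
  have h := congrArg (deg (conjClass M)) hxy
  rw [deg_sub, deg_add, dx, dy] at h
  linarith

/-! ### The elements `T_Σ` and `T̃'_Σ` -/

theorem ofZΓ_of (γ : Γ) : ofZΓ (MonoidAlgebra.of ℤ Γ γ) = elΓ γ := by
  simp [ofZΓ, elΓ, el, MonoidAlgebra.of_apply]

theorem SupportedOn.ofZΓ_mul {n : ℕ} {a : R} (x : MonoidAlgebra ℤ Γ) (ha : SupportedOn n a) :
    SupportedOn n (ofZΓ x * a) := by
  induction x using MonoidAlgebra.induction_on with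
  | of γ => rw [ofZΓ_of]; exact ha.elΓ_mul γ
  | add x y hx hy => rw [map_add, add_mul]; exact hx.add hy
  | smul r x hx =>
    rw [map_zsmul, smul_mul_assoc, ← Int.cast_smul_eq_zsmul ℚ]
    exact hx.smul _

theorem geom_sum_mul_one_sub (γ : Γ) :
    (∑ k ∈ Finset.range (orderOf γ), elΓ γ ^ k) * (1 - elΓ γ) = 0 := by
  rw [geom_sum_mul_neg, elΓ_pow, pow_orderOf_eq_one, elΓ_one, sub_self]

theorem idem_mul_one_sub (γ : Γ) : idem γ * (1 - elΓ γ) = 0 := by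
  rw [idem, smul_mul_assoc, geom_sum_mul_one_sub, smul_zero]

theorem idem_of_orderOf_two {γ : Γ} (h : orderOf γ = 2) :
    idem γ = (1 / 2 : ℚ) • (1 + elΓ γ) := by
  rw [idem, h, Finset.sum_range_succ, Finset.sum_range_one, pow_zero, pow_one]
  norm_num

theorem idem_of_orderOf_three {γ : Γ} (h : orderOf γ = 3) :
    idem γ = (1 / 3 : ℚ) • (1 + elΓ γ + elΓ γ ^ 2) := by
  rw [idem, h, Finset.sum_range_succ, Finset.sum_range_succ, Finset.sum_range_one, pow_zero,
    pow_one]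
  norm_num

theorem deg_conjClass_idem_mul (M : PMat) (γ : Γ) (a : R) :
    deg (conjClass M) (idem γ * a) = deg (conjClass M) (a * idem γ) := by
  rw [idem, smul_mul_assoc, mul_smul_comm, deg_smul, deg_smul, Finset.sum_mul, Finset.mul_sum,
    deg_sum, deg_sum]
  simp only [elΓ_pow, deg_conjClass_elΓ_mul]

variable {g : Fin 2 → Γ} {n : ℕ}

theorem Xaux_zero : Xaux g 0 = (1 / 2 : ℚ) • 1 := rfl

theorem Xaux_one : Xaux g 1 = (1 / 3 : ℚ) • (2 + elΓ (g 1)) := rfl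

/-- This dictates the shape of the `X_i`: each inverts `1 - g_i` on the complement of the
invariants. In order three, `(2 + g)(1 - g) = 3 - (1 + g + g²)`. -/
theorem Xaux_mul_one_sub (hg0 : orderOf (g 0) = 2) (hg1 : orderOf (g 1) = 3) (i : Fin 2) :
    Xaux g i * (1 - elΓ (g i)) = 1 - idem (g i) := by
  revert i
  rw [Fin.forall_fin_two]
  constructor
  · rw [Xaux_zero, idem_of_orderOf_two hg0, smul_mul_assoc, one_mul]
    module
  · rw [Xaux_one, idem_of_orderOf_three hg1, smul_mul_assoc, show (2 + elΓ (g 1)) * (1 - elΓ (g 1)) =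
      (2 : ℚ) • (1 : R) - elΓ (g 1) - elΓ (g 1) ^ 2 by
        rw [two_smul, one_add_one_eq_two]; noncomm_ring]
    module

namespace Choices

theorem supported_heckeSum (c : Choices g n) : SupportedOn n c.heckeSum :=
  SupportedOn.sum fun r hr => .el (c.det_reps r hr)

theorem supported_pd (c : Choices g n) (i j : Fin 2) : SupportedOn n (c.pd i j) :=
  SupportedOn.sum fun r hr => .ofZΓ_mul _ (.el (c.det_reps r hr))

theorem supported_Ttilde' (c : Choices g n) : SupportedOn n c.Ttilde' := by
  refine c.supported_heckeSum.sub (SupportedOn.sum fun i _ => ?_)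
  have h := (c.supported_pd i i).one_sub_mul (g i)
  revert i
  rw [Fin.forall_fin_two]
  constructor
  · intro _ h
    rw [Xaux_zero, mul_smul_comm, mul_one]
    exact h.smul _
  · intro _ h
    rw [Xaux_one, mul_smul_comm, mul_add, mul_two]
    exact ((h.add h).add (h.mul_elΓ _)).smul _

theorem eq_of_mem_coset (c : Choices g n) {r r' : PMat} (hr : r ∈ c.reps) (hr' : r' ∈ c.reps)
    {M : PMat} (h : M ∈ coset r) (h' : M ∈ coset r') : r = r' := by
  have hM : det M = n := by
    obtain ⟨γ, rfl⟩ := h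
    rw [det_ofPSL_mul, c.det_reps r hr]
  exact (c.existsUnique_rep M hM).unique ⟨hr, h⟩ ⟨hr', h'⟩

/-- The fundamental relation `T_Σ (1 - g_i) = ∑_j (1 - g_j) (∂_Σ g_i / ∂ g_j)`. -/
theorem heckeSum_mul_one_sub (c : Choices g n) (i : Fin 2) :
    c.heckeSum * (1 - elΓ (g i)) = ∑ j, (1 - elΓ (g j)) * c.pd i j := by
  classical
  have hex : ∀ r ∈ c.reps, ∃ γ : Γ, ofPSL γ * r * ofPSL (g i)⁻¹ ∈ c.reps := by
    intro r hr
    obtain ⟨r', ⟨hr', δ, hδ⟩, -⟩ := c.existsUnique_rep (r * ofPSL (g i)⁻¹)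
      (by rw [det_mul_ofPSL, c.det_reps r hr])
    refine ⟨δ⁻¹, ?_⟩
    rwa [mul_assoc, hδ, ofPSL_inv_mul_cancel_left]
  choose! γ hγ using hex
  -- Right translation by `g_i⁻¹` permutes the cosets, and `σ` is this permutation on
  -- representatives. Reindexing by `σ` turns `T_Σ g_i` into `∑ γ_r r`, to which the Fox identity
  -- applies term by term.
  let σ : PMat → PMat := fun r => ofPSL (γ r) * r * ofPSL (g i)⁻¹
  have hσ : ∀ r, σ r * ofPSL (g i) = ofPSL (γ r) * r := fun r =>
    ofPSL_inv_mul_cancel_right _ _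
  have hinj : Set.InjOn σ c.reps := by
    intro r hr r' hr' h
    refine c.eq_of_mem_coset hr hr' (M := ofPSL (γ r) * r) ⟨γ r, rfl⟩ ⟨γ r', ?_⟩
    rw [← hσ, h, hσ]
  have himage : c.reps.image σ = c.reps :=
    Finset.eq_of_subset_of_card_le (Finset.image_subset_iff.2 hγ)
      (by rw [Finset.card_image_of_injOn hinj])
  have h1 : c.heckeSum * elΓ (g i) = ∑ r ∈ c.reps, elΓ (γ r) * el r := by
    rw [heckeSum]
    conv_lhs => rw [← himage]
    rw [Finset.sum_image hinj, Finset.sum_mul]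
    refine Finset.sum_congr rfl fun r _ => ?_
    rw [elΓ, el_mul_el, hσ, elΓ, el_mul_el]
  rw [mul_sub, mul_one, h1, heckeSum, ← Finset.sum_sub_distrib]
  simp only [pd, Finset.mul_sum]
  rw [Finset.sum_comm]
  refine Finset.sum_congr rfl fun r hr => ?_
  have h := congrArg (fun x => ofZΓ x * el r) (c.fox_spec r hr i (γ r) (hγ r hr))
  simp only [map_sub, map_one, map_sum, map_mul, ofZΓ_of, sub_mul, one_mul, Finset.sum_mul] at h
  rw [h]
  refine Finset.sum_congr rfl fun j _ => ?_
  rw [sub_mul, one_mul, mul_assoc]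

/-- The trace property carries the left factor `1 - g_i` behind `X_i`, where it becomes `1 - π_i`;
once more by the trace property, `π_i` returns to the left. -/
theorem deg_conjClass_Ttilde' (hg0 : orderOf (g 0) = 2) (hg1 : orderOf (g 1) = 3)
    (c : Choices g n) (M : PMat) :
    deg (conjClass M) c.Ttilde' = deg (conjClass M) c.Ttilde := by
  have h : ∀ i, deg (conjClass M) ((1 - elΓ (g i)) * c.pd i i * Xaux g i) =
      deg (conjClass M) (c.pd i i) - deg (conjClass M) (idem (g i) * c.pd i i) := by
    intro i
    rw [mul_assoc, sub_mul, one_mul, deg_sub, deg_conjClass_elΓ_mul, ← deg_sub,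
      show c.pd i i * Xaux g i - c.pd i i * Xaux g i * elΓ (g i) =
        c.pd i i * (Xaux g i * (1 - elΓ (g i))) by noncomm_ring,
      Xaux_mul_one_sub hg0 hg1, mul_sub, mul_one, deg_sub, deg_conjClass_idem_mul]
  rw [Ttilde', Ttilde, deg_sub, deg_add, deg_sub, deg_sum, deg_sum, deg_sum,
    Finset.sum_congr rfl fun i _ => h i, Finset.sum_sub_distrib]
  ring

/-- The correction terms start with `1 - g_i`, so they do not contribute, and exactly one
representative of `T_Σ` lies in the coset. -/
theorem deg_coset_Ttilde' (c : Choices g n) {M : PMat} (hM : det M = n) :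
    deg (coset M) c.Ttilde' = 1 := by
  classical
  have h : ∀ i, deg (coset M) ((1 - elΓ (g i)) * c.pd i i * Xaux g i) = 0 := by
    intro i
    rw [mul_assoc, deg_coset_one_sub_mul]
  rw [Ttilde', deg_sub, deg_sum, Finset.sum_eq_zero fun i _ => h i, sub_zero, heckeSum, deg_sum]
  obtain ⟨r, ⟨hr, hMr⟩, huniq⟩ := c.existsUnique_rep M hM
  rw [Finset.sum_eq_single_of_mem r hr, deg_el, if_pos (mem_coset_comm.1 hMr)]
  intro r' hr' hne
  rw [deg_el, if_neg fun hmem => hne (huniq r' ⟨hr', mem_coset_comm.1 hmem⟩)]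

/-- `π_i` removes the `i`-th correction term. Multiplied by `π_i`, the Fox relation for `g_j` keeps
only its `j`-th term, so the other correction is `π_i T_Σ (1 - g_j) X_j = π_i T_Σ (1 - π_j)`. -/
theorem idem_mul_Ttilde' (hg0 : orderOf (g 0) = 2) (hg1 : orderOf (g 1) = 3)
    (c : Choices g n) {i j : Fin 2} (hij : i ≠ j) :
    idem (g i) * c.Ttilde' = idem (g i) * c.heckeSum * idem (g j) := by
  have hsum : ∀ f : Fin 2 → R, ∑ k, f k = f i + f j := by
    intro f
    rw [Fin.sum_univ_two]
    fin_cases i <;> fin_cases j <;> simp_all [add_comm]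
  have h1 := congrArg (idem (g i) * ·) (c.heckeSum_mul_one_sub j)
  simp only [hsum, mul_add] at h1
  rw [← mul_assoc _ (1 - elΓ (g i)), idem_mul_one_sub, zero_mul, zero_add] at h1
  rw [Ttilde', hsum, mul_sub, mul_add, ← mul_assoc (idem (g i)) (_ * _), ← mul_assoc (idem (g i)),
    idem_mul_one_sub, zero_mul, zero_mul, zero_add, ← mul_assoc (idem (g i)), ← h1,
    mul_assoc (idem (g i)), mul_assoc c.heckeSum]
  have h2 : ∀ j, (1 - elΓ (g j)) * Xaux g j = Xaux g j * (1 - elΓ (g j)) := by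
    rw [Fin.forall_fin_two]
    constructor
    · rw [Xaux_zero, smul_mul_assoc, mul_smul_comm, one_mul, mul_one]
    · rw [Xaux_one, smul_mul_assoc, mul_smul_comm]
      congr 1
      rw [show (2 : R) = 1 + 1 from one_add_one_eq_two.symm]
      noncomm_ring
  rw [h2, Xaux_mul_one_sub hg0 hg1]
  noncomm_ring

end Choices

theorem deg_coset_mul_elΓ (M : PMat) (γ : Γ) (a : R) :
    deg (coset M) (a * elΓ γ) = deg (coset (M * ofPSL γ⁻¹)) a := by
  classical
  have hmem : ∀ N, N * ofPSL γ ∈ coset M ↔ N ∈ coset (M * ofPSL γ⁻¹) := by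
    intro N
    constructor
    · rintro ⟨δ, hδ⟩
      exact ⟨δ, by rw [← mul_assoc, ← hδ, ofPSL_mul_inv_cancel_right]⟩
    · rintro ⟨δ, rfl⟩
      exact ⟨δ, by rw [← mul_assoc, ofPSL_inv_mul_cancel_right]⟩
  induction a using induction_el with
  | hel N => rw [elΓ, el_mul_el, deg_el, deg_el]; simp only [hmem]
  | hadd a b ha hb => rw [add_mul, deg_add, deg_add, ha, hb]
  | hsmul r a ha => rw [smul_mul_assoc, deg_smul, deg_smul, ha]

theorem deg_conjClass_conj (M : PMat) (γ : Γ) (a : R) :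
    deg (conjClass M) (elΓ γ⁻¹ * a * elΓ γ) = deg (conjClass M) a := by
  rw [← deg_conjClass_elΓ_mul, ← mul_assoc, elΓ_mul_inv, one_mul]

/-- A conjugate of `T̃'_Σ` is a lift for the standard generators. -/
theorem Choices.isLift_conj (hg0 : orderOf (g 0) = 2) (hg1 : orderOf (g 1) = 3)
    (c : Choices g n) {h : Γ} (h0 : g 0 = h * S * h⁻¹)
    (h1 : g 1 = h * U * h⁻¹ ∨ g 1 = h * U⁻¹ * h⁻¹) :
    IsLift n (elΓ h⁻¹ * c.Ttilde' * elΓ h) := by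
  have e0 : elΓ (g 0) = elΓ h * elΓ S * elΓ h⁻¹ := by rw [h0, elΓ_mul_elΓ, elΓ_mul_elΓ]
  have hh : elΓ h * elΓ h⁻¹ = 1 := elΓ_mul_inv h
  have key : ∀ x : R, ∀ y : R, x * c.Ttilde' * y = 0 →
      (elΓ h⁻¹ * x * elΓ h) * (elΓ h⁻¹ * c.Ttilde' * elΓ h) * (elΓ h⁻¹ * y * elΓ h) = 0 := by
    intro x y hxy
    calc _ = elΓ h⁻¹ * x * (elΓ h * elΓ h⁻¹) * c.Ttilde' * (elΓ h * elΓ h⁻¹) * y * elΓ h := by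
          noncomm_ring
      _ = elΓ h⁻¹ * (x * c.Ttilde' * y) * elΓ h := by rw [hh]; noncomm_ring
      _ = 0 := by rw [hxy, mul_zero, zero_mul]
  have conj : ∀ V : Γ, elΓ h⁻¹ * elΓ (h * V * h⁻¹) * elΓ h = elΓ V := by
    intro V
    rw [elΓ_mul_elΓ, elΓ_mul_elΓ]
    congr 1
    group
  have hh' : elΓ h⁻¹ * elΓ h = 1 := elΓ_inv_mul h
  have k0 : (1 + elΓ (g 0)) * c.Ttilde' * (1 - elΓ (g 1)) = 0 := by
    have := congrArg (· * (1 - elΓ (g 1)))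
      (c.idem_mul_Ttilde' hg0 hg1 (i := 0) (j := 1) (by decide))
    simp only [mul_assoc, idem_mul_one_sub, mul_zero] at this
    rw [idem_of_orderOf_two hg0, smul_mul_assoc, smul_eq_zero] at this
    rw [mul_assoc]
    exact this.resolve_left (by norm_num)
  have k1 : (1 + elΓ (g 1) + elΓ (g 1) ^ 2) * c.Ttilde' * (1 - elΓ (g 0)) = 0 := by
    have := congrArg (· * (1 - elΓ (g 0)))
      (c.idem_mul_Ttilde' hg0 hg1 (i := 1) (j := 0) (by decide))
    simp only [mul_assoc, idem_mul_one_sub, mul_zero] at this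
    rw [idem_of_orderOf_three hg1, smul_mul_assoc, smul_eq_zero] at this
    rw [mul_assoc]
    exact this.resolve_left (by norm_num)
  have a0 : elΓ h⁻¹ * (1 + elΓ (g 0)) * elΓ h = 1 + elΓ S := by
    rw [mul_add, add_mul, mul_one, hh', h0, conj]
  have s0 : elΓ h⁻¹ * (1 - elΓ (g 0)) * elΓ h = 1 - elΓ S := by
    rw [mul_sub, sub_mul, mul_one, hh', h0, conj]
  have m0 := key _ _ k0
  have m1 := key _ _ k1
  rw [a0] at m0
  rw [s0] at m1
  refine ⟨(c.supported_Ttilde'.elΓ_mul _).mul_elΓ _, ?_, ?_, ?_⟩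
  · intro M hM
    rw [deg_coset_mul_elΓ, deg_coset_elΓ_mul, c.deg_coset_Ttilde']
    rw [det_mul_ofPSL, hM]
  · rcases h1 with h1 | h1
    · rwa [show elΓ h⁻¹ * (1 - elΓ (g 1)) * elΓ h = 1 - elΓ U by
        rw [mul_sub, sub_mul, mul_one, hh', h1, conj]] at m0
    · rw [show elΓ h⁻¹ * (1 - elΓ (g 1)) * elΓ h = 1 - elΓ U⁻¹ by
        rw [mul_sub, sub_mul, mul_one, hh', h1, conj]] at m0
      rw [show 1 - elΓ U = (1 - elΓ U⁻¹) * -elΓ U by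
        rw [mul_neg, sub_mul, elΓ_inv_mul]; noncomm_ring, ← mul_assoc, m0, zero_mul]
  · rcases h1 with h1 | h1
    · rwa [show elΓ h⁻¹ * (1 + elΓ (g 1) + elΓ (g 1) ^ 2) * elΓ h = 1 + elΓ U + elΓ U ^ 2 by
        rw [mul_add, mul_add, add_mul, add_mul, mul_one, hh', elΓ_pow, elΓ_pow, h1, conj_pow, conj,
          conj]] at m1
    · rwa [show elΓ h⁻¹ * (1 + elΓ (g 1) + elΓ (g 1) ^ 2) * elΓ h = 1 + elΓ U + elΓ U ^ 2 by
        rw [mul_add, mul_add, add_mul, add_mul, mul_one, hh', elΓ_pow, elΓ_pow, h1, conj_pow, conj,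
          conj, U_inv_sq, U_sq]; abel] at m1

/-! ### The adjoint -/

theorem adj_mul (M N : PMat) : adj (M * N) = adj N * adj M := by
  obtain ⟨a, b, c, d, rfl⟩ := exists_entries M
  obtain ⟨a', b', c', d', rfl⟩ := exists_entries N
  rw [cls_mul_cls, adj_cls, adj_cls, adj_cls, cls_mul_cls, cls_entries_eq_iff]
  left
  refine ⟨?_, ?_, ?_, ?_⟩ <;> ring

theorem adj_adj (M : PMat) : adj (adj M) = M := by
  obtain ⟨a, b, c, d, rfl⟩ := exists_entries M
  rw [adj_cls, adj_cls, neg_neg, neg_neg]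

theorem det_adj (M : PMat) : det (adj M) = det M := by
  obtain ⟨a, b, c, d, rfl⟩ := exists_entries M
  rw [adj_cls, det_cls, det_cls]
  ring

theorem adj_ofPSL (γ : Γ) : adj (ofPSL γ) = ofPSL γ⁻¹ := by
  obtain ⟨a, b, c, d, -, h⟩ := exists_ofPSL_eq γ
  rw [ofPSL_inv h, h, adj_cls]

theorem adjR_add (a b : R) : adjR (a + b) = adjR a + adjR b := MonoidAlgebra.mapDomain_add _ _ _

theorem adjR_el (M : PMat) : adjR (el M) = el (adj M) := MonoidAlgebra.mapDomain_single

theorem adjR_smul (r : ℚ) (a : R) : adjR (r • a) = r • adjR a := by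
  ext M
  exact congrArg (fun f : PMat →₀ ℚ => f M) (Finsupp.mapDomain_smul r a.coeff)

theorem adjR_neg (a : R) : adjR (-a) = -adjR a := by
  rw [← neg_one_smul ℚ a, adjR_smul, neg_one_smul]

theorem adjR_sub (a b : R) : adjR (a - b) = adjR a - adjR b := by
  rw [sub_eq_add_neg, adjR_add, adjR_neg, sub_eq_add_neg]

theorem adjR_sum {ι : Type*} (s : Finset ι) (f : ι → R) :
    adjR (∑ i ∈ s, f i) = ∑ i ∈ s, adjR (f i) :=
  map_sum (AddMonoidHom.mk' adjR adjR_add) f s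

theorem adjR_mul (a b : R) : adjR (a * b) = adjR b * adjR a := by
  induction a using induction_el with
  | hel M =>
    induction b using induction_el with
    | hel N => rw [el_mul_el, adjR_el, adjR_el, adjR_el, el_mul_el, adj_mul]
    | hadd x y hx hy => rw [mul_add, adjR_add, adjR_add, add_mul, hx, hy]
    | hsmul r x hx => rw [mul_smul_comm, adjR_smul, adjR_smul, smul_mul_assoc, hx]
  | hadd x y hx hy => rw [add_mul, adjR_add, adjR_add, mul_add, hx, hy]
  | hsmul r x hx => rw [smul_mul_assoc, adjR_smul, adjR_smul, mul_smul_comm, hx]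

theorem adjR_adjR (a : R) : adjR (adjR a) = a := by
  induction a using induction_el with
  | hel M => rw [adjR_el, adjR_el, adj_adj]
  | hadd x y hx hy => rw [adjR_add, adjR_add, hx, hy]
  | hsmul r x hx => rw [adjR_smul, adjR_smul, hx]

theorem adjR_elΓ (γ : Γ) : adjR (elΓ γ) = elΓ γ⁻¹ := by rw [elΓ, adjR_el, adj_ofPSL]; rfl

theorem adjR_one : adjR 1 = 1 := by rw [← elΓ_one, adjR_elΓ, inv_one]

theorem SupportedOn.adjR {n : ℕ} {a : R} (ha : SupportedOn n a) : SupportedOn n (adjR a) := by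
  rw [eq_sum_smul_el a, adjR_sum]
  refine SupportedOn.sum fun M hM => ?_
  rw [adjR_smul, adjR_el]
  exact (SupportedOn.el (by rw [det_adj, ha M (Finsupp.mem_support_iff.1 hM)])).smul _

/-! ### Upper triangular representatives -/

theorem mul_upper (p q r s a b d : ℤ) :
    cls !![p, q; r, s] * cls !![a, b; 0, d] = cls !![p * a, p * b + q * d; r * a, r * b + s * d] := by
  rw [cls_mul_cls]
  simp

/-- Hermite normal form: Bézout coefficients of the first column clear its lower entry, and a
translation reduces the upper right entry. -/
theorem exists_upper {n : ℕ} (hn : 1 ≤ n) {M : PMat} (hM : det M = n) :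
    ∃ (γ : Γ) (a b d : ℕ), a * d = n ∧ b < d ∧
      ofPSL γ * M = cls !![(a : ℤ), (b : ℤ); 0, (d : ℤ)] := by
  obtain ⟨a, b, c, d, rfl⟩ := exists_entries M
  rw [det_cls] at hM
  have hn' : (1 : ℤ) ≤ n := by exact_mod_cast hn
  set g : ℕ := Int.gcd a c with hg
  have hg0 : (g : ℤ) ≠ 0 := by
    intro h
    have h0 : Int.gcd a c = 0 := by exact_mod_cast h
    rw [Int.gcd_eq_zero_iff] at h0
    rw [h0.1, h0.2] at hM
    simp at hM
    omega
  have hgpos : (0 : ℤ) < g := by positivity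
  obtain ⟨a', ha'⟩ : (g : ℤ) ∣ a := Int.gcd_dvd_left a c
  obtain ⟨c', hc'⟩ : (g : ℤ) ∣ c := Int.gcd_dvd_right a c
  have hbez : (g : ℤ) = a * Int.gcdA a c + c * Int.gcdB a c := Int.gcd_eq_gcd_ab a c
  set x := Int.gcdA a c
  set y := Int.gcdB a c
  have h1 : x * a' - y * -c' = 1 := by
    apply mul_left_cancel₀ hg0
    linear_combination -x * ha' - y * hc' - hbez
  set e : ℤ := a' * d - c' * b with he
  have hge : (g : ℤ) * e = n := by rw [← hM]; linear_combination -d * ha' + b * hc'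
  have hepos : 0 < e := by
    by_contra hcon
    push Not at hcon
    nlinarith
  -- The quotient by which the translation must act so that the upper right entry becomes the
  -- remainder modulo `e`.
  set k : ℤ := (x * b + y * d) / e
  obtain ⟨γ, hγ⟩ := exists_ofPSL (a := x + k * c') (b := y - k * a') (c := -c') (d := a')
    (by linear_combination h1)
  have hac : a' * c = c' * a := by
    apply mul_left_cancel₀ hg0
    linear_combination -c * ha' + a * hc'
  obtain ⟨e', he'⟩ := Int.eq_ofNat_of_zero_le hepos.le
  obtain ⟨b', hb'⟩ := Int.eq_ofNat_of_zero_le (Int.emod_nonneg (x * b + y * d) hepos.ne')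
  refine ⟨γ, g, b', e', ?_, ?_, ?_⟩
  · rw [he'] at hge
    exact_mod_cast hge
  · have := Int.emod_lt_of_pos (x * b + y * d) hepos
    rw [hb', he'] at this
    exact_mod_cast this
  · have hb2 := Int.emod_add_mul_ediv (x * b + y * d) e
    rw [hγ, cls_mul_cls, ← hb', ← he', cls_entries_eq_iff]
    left
    refine ⟨?_, ?_, ?_, ?_⟩
    · linear_combination -hbez - k * hac
    · linear_combination -hb2 - k * he
    · linear_combination hac
    · linear_combination -he

theorem upper_eq_of_mem_coset {a b d a' b' d' : ℕ} (ha : 0 < a) (hb : b < d) (ha' : 0 < a')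
    (hb' : b' < d') (h : cls !![(a' : ℤ), (b' : ℤ); 0, (d' : ℤ)] ∈
      coset (cls !![(a : ℤ), (b : ℤ); 0, (d : ℤ)])) : a = a' ∧ b = b' ∧ d = d' := by
  obtain ⟨γ, hγ⟩ := h
  obtain ⟨p, q, r, s, hdet, hγ'⟩ := exists_ofPSL_eq γ
  rw [hγ', mul_upper] at hγ
  have key : ∀ p q r s : ℤ, p * s - q * r = 1 → (a' : ℤ) = p * a → (b' : ℤ) = p * b + q * d →
      0 = r * (a : ℤ) → (d' : ℤ) = r * b + s * d → a = a' ∧ b = b' ∧ d = d' := by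
    intro p q r s hdet h1 h2 h3 h4
    obtain rfl : r = 0 := by
      rcases mul_eq_zero.1 h3.symm with h | h
      · exact h
      · omega
    have hp : p = 1 := by
      rcases Int.eq_one_or_neg_one_of_mul_eq_one (show p * s = 1 by linarith) with h | h
      · exact h
      · subst h; omega
    subst hp
    obtain rfl : s = 1 := by linarith
    have hq : q = 0 := by
      have hd : (d : ℤ) = d' := by linarith
      by_contra hq
      rcases lt_or_gt_of_ne hq with hq | hq <;> nlinarith
    subst hq
    refine ⟨?_, ?_, ?_⟩ <;> omega
  rcases cls_entries_eq_iff.1 hγ with ⟨h1, h2, h3, h4⟩ | ⟨h1, h2, h3, h4⟩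
  · exact key p q r s hdet h1 h2 h3 h4
  · exact key (-p) (-q) (-r) (-s) (by linarith) (by linarith) (by linarith) (by linarith)
      (by linarith)

theorem supported_Tinfty (n : ℕ) : SupportedOn n (Tinfty n) := by
  refine SupportedOn.sum fun d hd => SupportedOn.sum fun b _ => .el ?_
  rw [det_cls, mul_zero, sub_zero]
  exact_mod_cast Nat.div_mul_cancel (Nat.dvd_of_mem_divisors hd)

/-- By existence and uniqueness of the Hermite form, the terms of `T_n^∞` are a complete system of
representatives. Hence a lift minus `T_n^∞` has degree zero on all cosets and can be split. -/
theorem deg_coset_Tinfty {n : ℕ} (hn : 1 ≤ n) {M : PMat} (hM : det M = n) :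
    deg (coset M) (Tinfty n) = 1 := by
  classical
  obtain ⟨γ, a, b, d, had, hbd, hγ⟩ := exists_upper hn hM
  have hd : 0 < d := by omega
  have ha : 0 < a := by
    rcases Nat.eq_zero_or_pos a with rfl | h
    · omega
    · exact h
  have hand : n / d = a := by rw [← had, Nat.mul_div_cancel _ hd]
  have hmem : cls !![(a : ℤ), (b : ℤ); 0, (d : ℤ)] ∈ coset M := ⟨γ, hγ.symm⟩
  rw [Tinfty, deg_sum, Finset.sum_eq_single_of_mem d (by rw [Nat.mem_divisors]; exact
    ⟨Dvd.intro_left a had, by omega⟩), deg_sum,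
    Finset.sum_eq_single_of_mem b (Finset.mem_range.2 hbd), deg_el, if_pos (by rwa [hand])]
  · intro b' hb' hne
    rw [deg_el, if_neg]
    intro h
    rw [hand, ← coset_eq_of_mem hmem] at h
    exact hne (upper_eq_of_mem_coset ha hbd ha (Finset.mem_range.1 hb') h).2.1.symm
  · intro d' hd' hne
    rw [deg_sum]
    refine Finset.sum_eq_zero fun b' hb' => ?_
    rw [deg_el, if_neg]
    intro h
    rw [← coset_eq_of_mem hmem] at h
    have hd'' := Nat.dvd_of_mem_divisors hd'
    exact hne (upper_eq_of_mem_coset ha hbd (Nat.div_pos (Nat.le_of_dvd hn hd'')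
      (Nat.pos_of_dvd_of_pos hd'' hn)) (Finset.mem_range.1 hb') h).2.2.symm

/-! ### The relation of `T_n^∞` with translations -/

/-- The variant of `T_n^∞` with reduction of the upper right entry modulo the upper left one. -/
noncomputable def TinftyRight (n : ℕ) : R :=
  ∑ d ∈ n.divisors, ∑ b ∈ Finset.range (n / d), el (cls !![((n / d : ℕ) : ℤ), (b : ℤ); 0, (d : ℤ)])

theorem supported_TinftyRight (n : ℕ) : SupportedOn n (TinftyRight n) := by
  refine SupportedOn.sum fun d hd => SupportedOn.sum fun b _ => .el ?_
  rw [det_cls, mul_zero, sub_zero]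
  exact_mod_cast Nat.div_mul_cancel (Nat.dvd_of_mem_divisors hd)

theorem el_upper_mul_T (a b d : ℤ) :
    el (cls !![a, b; 0, d]) * elΓ T = el (cls !![a, a + b; 0, d]) := by
  rw [elΓ, el_mul_el, ofPSL_T, cls_mul_cls]
  simp

theorem T_mul_el_upper (a b d : ℤ) :
    elΓ T * el (cls !![a, b; 0, d]) = el (cls !![a, d + b; 0, d]) := by
  rw [elΓ, el_mul_el, ofPSL_T, cls_mul_cls]
  simp [add_comm]

/-- For fixed diagonal, right multiplication by `T` adds `a` to the upper right entry and left
multiplication adds `d`. The identity compares the two ways of cutting `0 ≤ b < a + d` into an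
interval of length `a` and one of length `d`. -/
theorem Tinfty_mul_one_sub_T (n : ℕ) :
    Tinfty n * (1 - elΓ T) = (1 - elΓ T) * TinftyRight n := by
  rw [Tinfty, TinftyRight, Finset.sum_mul, Finset.mul_sum]
  refine Finset.sum_congr rfl fun d _ => ?_
  generalize n / d = a
  rw [mul_sub, sub_mul, mul_one, one_mul, Finset.sum_mul, Finset.mul_sum]
  simp only [el_upper_mul_T, T_mul_el_upper]
  have h1 := Finset.sum_range_add (fun b : ℕ => el (cls !![(a : ℤ), (b : ℤ); 0, (d : ℤ)])) a d
  have h2 := Finset.sum_range_add (fun b : ℕ => el (cls !![(a : ℤ), (b : ℤ); 0, (d : ℤ)])) d a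
  rw [add_comm d a, h1] at h2
  push_cast at h2
  rw [sub_eq_sub_iff_add_eq_add, ← h2]

/-- The adjoint exchanges the diagonal entries and replaces `b` by `-b`. The new upper right entries
again represent all residues modulo `a`, and right multiplication by `T` shifts by `a`. -/
theorem exists_adjR_Tinfty (n : ℕ) :
    ∃ Y, SupportedOn n Y ∧ adjR (Tinfty n) = TinftyRight n + Y * (1 - elΓ T) := by
  have hadj : adjR (Tinfty n) = ∑ d ∈ n.divisors, ∑ b ∈ Finset.range (n / d),
      el (cls !![((n / d : ℕ) : ℤ), -(b : ℤ); 0, (d : ℤ)]) := by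
    rw [Tinfty, adjR_sum, ← Nat.sum_div_divisors]
    refine Finset.sum_congr rfl fun d hd => ?_
    rw [adjR_sum]
    refine Finset.sum_congr rfl fun b _ => ?_
    rw [adjR_el, adj_cls, neg_zero, Nat.div_div_self (Nat.dvd_of_mem_divisors hd)
      (Nat.mem_divisors.1 hd).2]
  -- The shifts `a - b` run over `1, …, a` instead of `0, …, a - 1`; the subtracted terms with entry
  -- `0` trade the endpoint `a` for `0`.
  refine ⟨∑ d ∈ n.divisors, (∑ b ∈ Finset.range (n / d),
    el (cls !![((n / d : ℕ) : ℤ), -(b : ℤ); 0, (d : ℤ)]) -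
      el (cls !![((n / d : ℕ) : ℤ), 0; 0, (d : ℤ)])), ?_, ?_⟩
  · refine SupportedOn.sum fun d hd => ?_
    have h : ((n / d : ℕ) : ℤ) * d = n := by
      exact_mod_cast Nat.div_mul_cancel (Nat.dvd_of_mem_divisors hd)
    refine (SupportedOn.sum fun b _ => .el ?_).sub (.el ?_) <;>
    · rw [det_cls, mul_zero, sub_zero, h]
  · rw [hadj, TinftyRight, Finset.sum_mul, ← Finset.sum_add_distrib]
    refine Finset.sum_congr rfl fun d _ => ?_
    generalize n / d = a
    rw [sub_mul, mul_sub, mul_one, Finset.sum_mul, mul_sub, mul_one]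
    simp only [el_upper_mul_T]
    have h1 : ∑ b ∈ Finset.range a, el (cls !![(a : ℤ), a + -(b : ℤ); 0, (d : ℤ)]) =
        ∑ b ∈ Finset.range a, el (cls !![(a : ℤ), ((b + 1 : ℕ) : ℤ); 0, (d : ℤ)]) := by
      rw [← Finset.sum_range_reflect]
      refine Finset.sum_congr rfl fun b hb => ?_
      have : b < a := Finset.mem_range.1 hb
      congr 4
      rw [show ((a - 1 - b : ℕ) : ℤ) = a - 1 - b by omega]
      push_cast
      ring_nf
    have h2 := Finset.sum_range_succ'
      (fun b : ℕ => el (cls !![(a : ℤ), (b : ℤ); 0, (d : ℤ)])) a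
    rw [Finset.sum_range_succ] at h2
    rw [h1]
    simp only [Nat.cast_zero] at h2
    rw [add_zero, ← sub_eq_zero]
    rw [← sub_eq_zero] at h2
    rw [← neg_eq_zero, ← h2]
    abel

/-! ### Lifts are operators of Popa and Zagier -/

/-- This is the adjoint form of the Hecke condition. By the lift relations `a (1 - S)` lies in the
right ideal of `1 - U` and `a (1 - U⁻¹)` in that of `1 - S`. Together they express `a (1 - T)`,
which is also known from the splitting of `a - T_n^∞`; since the sum of the ideals is direct, the
components can be compared. -/
theorem IsLift.exists_mul_one_sub_S {n : ℕ} (hn : 1 ≤ n) {a : R} (ha : IsLift n a) :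
    ∃ Z, SupportedOn n Z ∧
      a * (1 - elΓ S) + (1 - elΓ S) * adjR (Tinfty n) = Z * (1 - elΓ T) := by
  obtain ⟨x, y, hx, hy, hxy⟩ := isSplit_of_deg_coset (ha.supported.sub (supported_Tinfty n))
    (fun M hM => by rw [deg_sub, ha.deg_coset M hM, deg_coset_Tinfty hn hM, sub_self])
  obtain ⟨Y, hY, hadj⟩ := exists_adjR_Tinfty n
  have hT' := Tinfty_mul_one_sub_T n
  have hsT := supported_TinftyRight n
  have hs := ha.supported
  set s := elΓ S with hs_def
  set u := elΓ U with hu_def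
  set v := elΓ U⁻¹ with hv_def
  set t := elΓ T with ht_def
  set T' := TinftyRight n
  have huv : u * v = 1 := elΓ_mul_inv U
  have hvu : v * u = 1 := elΓ_inv_mul U
  have hus : u * s = t := by rw [hu_def, hs_def, elΓ_mul_elΓ, U_mul_S]
  have hvt : v * t = s := by rw [← hus, ← mul_assoc, hvu, one_mul]
  have huu : u * u = v := by rw [hu_def, elΓ_mul_elΓ, ← pow_two, U_sq]
  -- the component of `a (1 - U⁻¹)`
  have hz : (1 + s) * (a * (1 - v)) = 0 := by
    have : a * (1 - v) = -(a * (1 - u) * v) := by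
      rw [mul_assoc, sub_mul, huv]; noncomm_ring
    rw [this, mul_neg, ← mul_assoc, ← mul_assoc, ha.mul_one_sub_U, zero_mul, neg_zero]
  have hB1 : (1 - s) * ((1 / 2 : ℚ) • (a * (1 - v))) = a * (1 - v) := by
    have h2 : (1 - s) * (a * (1 - v)) = (2 : ℚ) • (a * (1 - v)) := by
      rw [show (1 - s) * (a * (1 - v)) = (2 : ℚ) • (a * (1 - v)) - (1 + s) * (a * (1 - v)) by
        rw [two_smul]; noncomm_ring, hz, sub_zero]
    rw [mul_smul_comm, h2, smul_smul]
    norm_num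
  have hsB1 : SupportedOn n ((1 / 2 : ℚ) • (a * (1 - v))) := (hs.mul_one_sub _).smul _
  set B₁ := (1 / 2 : ℚ) • (a * (1 - v))
  -- the component of `a (1 - S)`
  have hw : (1 + u + u ^ 2) * (a * (1 - s)) = 0 := by rw [← mul_assoc]; exact ha.mul_one_sub_S
  have hB2 : ∃ B, a * (1 - s) = (1 - u) * B := by
    refine ⟨(1 / 3 : ℚ) • ((2 + u) * (a * (1 - s))), ?_⟩
    rw [mul_smul_comm, ← mul_assoc (1 - u),
      show (1 - u) * (2 + u) = (3 : ℚ) • (1 : R) - (1 + u + u ^ 2) by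
        rw [show (3 : ℚ) = 1 + 1 + 1 by norm_num, add_smul, add_smul, one_smul,
          show (2 : R) = 1 + 1 from one_add_one_eq_two.symm]
        noncomm_ring,
      sub_mul, hw, sub_zero, smul_mul_assoc, one_mul, smul_smul]
    norm_num
  obtain ⟨B₂, hB2⟩ := hB2
  -- Here `a (1 - T) = a (1 - S) - a (1 - U⁻¹) T`, because `U⁻¹ T = S`.
  have hrel : a * (1 - t) = (1 - u) * B₂ - (1 - s) * B₁ * t := by
    rw [← hB2, hB1, mul_assoc a (1 - v), sub_mul 1 v t, hvt]
    noncomm_ring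
  have hrel' : a * (1 - t) = (1 - t) * T' + ((1 - s) * x + (1 - u) * y) * (1 - t) := by
    rw [← hxy, ← hT']; noncomm_ring
  -- The other expression is split by `1 - T = (1 - S) + (1 - U) S`. Only the vanishing of the `(1 -
  -- S)`-component is needed afterwards.
  have hsplit : (1 - s) * (T' + x * (1 - t) + B₁ * t) + (1 - u) * (s * T' + y * (1 - t) - B₂) = 0 := by
    have h1 : (1 - t) * T' = (1 - s) * T' + (1 - u) * (s * T') := by
      rw [← hus]; noncomm_ring
    rw [h1, hrel] at hrel'
    rw [← sub_eq_zero] at hrel'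
    rw [← neg_eq_zero, ← hrel']
    noncomm_ring
  have h0 := (one_sub_S_mul_eq_zero_of_add hn
    ((hsT.add (hx.mul_one_sub T)).add (hsB1.mul_elΓ T)) hsplit).1
  refine ⟨a * v + (1 - s) * B₁ - (1 - s) * x + (1 - s) * Y,
    (((hs.mul_elΓ _).add (hsB1.one_sub_mul S)).sub (hx.one_sub_mul S)).add (hY.one_sub_mul S), ?_⟩
  have h1 : a * (1 - s) = (1 - s) * B₁ + a * v * (1 - t) := by
    rw [hB1, mul_sub (a * v) 1 t, mul_assoc a v t, hvt]; noncomm_ring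
  rw [h1, hadj, ← sub_eq_zero, ← h0]
  noncomm_ring

/-- The adjoint reverses products and fixes `S` and `1 + U + U²`. An element annihilated on the
right by `1 - U` is multiplied by `3` by the norm of `U`, and similarly by `2` for `S`; dividing by
`3` and `2` gives explicit witnesses for the two norm conditions. -/
theorem IsLift.isPopaZagier {n : ℕ} (hn : 1 ≤ n) {a : R} (ha : IsLift n a) :
    IsPopaZagier n (-adjR a) := by
  have hS : adjR (elΓ S) = elΓ S := by rw [adjR_elΓ, S_inv]
  have hU : adjR (1 + elΓ U + elΓ U ^ 2) = 1 + elΓ U + elΓ U ^ 2 := by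
    rw [elΓ_pow, adjR_add, adjR_add, adjR_one, adjR_elΓ, adjR_elΓ, U_sq, inv_inv]
    abel
  have hS1 : adjR (1 + elΓ S) = 1 + elΓ S := by rw [adjR_add, adjR_one, hS]
  have hs := ha.supported.adjR
  refine ⟨hs.neg, ?_, ?_, ?_⟩
  · obtain ⟨Z, hZ, h⟩ := ha.exists_mul_one_sub_S hn
    have h' := congrArg adjR h
    simp only [adjR_add, adjR_mul, adjR_sub, adjR_one, hS, adjR_elΓ, adjR_adjR] at h'
    refine ⟨elΓ T⁻¹ * adjR Z, hZ.adjR.elΓ_mul _, ?_⟩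
    rw [← mul_assoc, sub_mul 1 (elΓ T), elΓ_mul_inv, mul_neg, ← neg_add', h']
    noncomm_ring
  · refine ⟨(1 / 3 : ℚ) • (-(adjR a * (1 + elΓ S))), ?_, ?_⟩
    · rw [mul_add, mul_one]
      exact (hs.add (hs.mul_elΓ S)).neg.smul _
    · have h := congrArg adjR (show (1 + elΓ S) * a * (1 + elΓ U + elΓ U ^ 2) =
          (3 : ℚ) • ((1 + elΓ S) * a) by
        have h1 := ha.mul_one_sub_U
        have h3 : (1 + elΓ S) * a * (1 + elΓ U + elΓ U ^ 2) = (3 : ℚ) • ((1 + elΓ S) * a) -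
            ((1 + elΓ S) * a * (1 - elΓ U) + (1 + elΓ S) * a * (1 - elΓ U)) -
            (1 + elΓ S) * a * (1 - elΓ U) * elΓ U := by
          rw [show (3 : ℚ) = 1 + 1 + 1 by norm_num, add_smul, add_smul, one_smul]
          noncomm_ring
        rw [h3, h1, zero_mul, add_zero, sub_zero, sub_zero])
      rw [adjR_mul, hU, adjR_smul, adjR_mul, hS1] at h
      rw [mul_smul_comm, mul_neg, h, smul_neg, smul_smul]
      norm_num
  · refine ⟨(1 / 2 : ℚ) • (-(adjR a * (1 + elΓ U + elΓ U ^ 2))), ?_, ?_⟩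
    · rw [mul_add, mul_add, mul_one, elΓ_pow]
      exact ((hs.add (hs.mul_elΓ U)).add (hs.mul_elΓ _)).neg.smul _
    · have h := congrArg adjR (show (1 + elΓ U + elΓ U ^ 2) * a * (1 + elΓ S) =
          (2 : ℚ) • ((1 + elΓ U + elΓ U ^ 2) * a) by
        have h1 := ha.mul_one_sub_S
        rw [two_smul, ← sub_eq_zero, ← neg_eq_zero, ← h1]
        noncomm_ring)
      rw [adjR_mul, hS1, adjR_smul, adjR_mul, hU] at h
      rw [mul_smul_comm, mul_neg, h, smul_neg, smul_smul]
      norm_num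

/-! ### The symmetric Heaviside function -/

/-- The Heaviside function with value `1 / 2` at the origin. -/
def hv (k : ℤ) : ℚ := if 0 < k then 1 else if k = 0 then 1 / 2 else 0

theorem hv_of_pos {k : ℤ} (h : 0 < k) : hv k = 1 := if_pos h

theorem hv_of_neg {k : ℤ} (h : k < 0) : hv k = 0 := by
  rw [hv, if_neg (by omega), if_neg (by omega)]

theorem hv_zero : hv 0 = 1 / 2 := by simp [hv]

/-- The value `1 / 2` at the origin makes this exact also for `k = 0`, so differences of Heaviside
values of two odd functions are odd. -/
theorem hv_neg (k : ℤ) : hv (-k) = 1 - hv k := by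
  rcases lt_trichotomy k 0 with h | rfl | h
  · rw [hv_of_neg h, hv_of_pos (by omega)]; norm_num
  · rw [neg_zero, hv_zero]; norm_num
  · rw [hv_of_pos h, hv_of_neg (by omega)]; norm_num

theorem hv_eq_of_mul_pos {k l : ℤ} (h : 0 < k * l) : hv k = hv l := by
  rcases pos_and_pos_or_neg_and_neg_of_mul_pos h with ⟨hk, hl⟩ | ⟨hk, hl⟩
  · rw [hv_of_pos hk, hv_of_pos hl]
  · rw [hv_of_neg hk, hv_of_neg hl]

theorem mul_nonpos_of_hv_ne {k l : ℤ} (h : hv k ≠ hv l) : k * l ≤ 0 := by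
  by_contra hkl
  exact h (hv_eq_of_mul_pos (by omega))

/-! ### Finiteness -/

theorem finite_bounded (K : ℤ) : {M : PMat | ∃ a b c d : ℤ, |a| ≤ K ∧ |b| ≤ K ∧ |c| ≤ K ∧ |d| ≤ K ∧
    M = cls !![a, b; c, d]}.Finite := by
  let I := Set.Icc (-K) K
  have hI : (I ×ˢ I ×ˢ I ×ˢ I).Finite :=
    (Set.finite_Icc _ _).prod ((Set.finite_Icc _ _).prod
      ((Set.finite_Icc _ _).prod (Set.finite_Icc _ _)))
  refine (hI.image fun p : ℤ × ℤ × ℤ × ℤ => cls !![p.1, p.2.1; p.2.2.1, p.2.2.2]).subset ?_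
  rintro M ⟨a, b, c, d, ha, hb, hc, hd, rfl⟩
  exact ⟨(a, b, c, d), ⟨abs_le.1 ha, abs_le.1 hb, abs_le.1 hc, abs_le.1 hd⟩, rfl⟩

theorem abs_le_of_sq_add_sq_le {a b K : ℤ} (h : a ^ 2 + b ^ 2 ≤ K) : |a| ≤ K ∧ |b| ≤ K := by
  constructor
  · rw [abs_le]; constructor <;> nlinarith [sq_nonneg b, sq_nonneg (a - 1), sq_nonneg (a + 1)]
  · rw [abs_le]; constructor <;> nlinarith [sq_nonneg a, sq_nonneg (b - 1), sq_nonneg (b + 1)]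

theorem form_pos {x y w a b : ℤ} (hx : 0 < x) (hD : 0 < x * w - y ^ 2) (hab : ¬(a = 0 ∧ b = 0)) :
    0 < x * a ^ 2 + 2 * y * (a * b) + w * b ^ 2 := by
  have h : 0 < x * (x * a ^ 2 + 2 * y * (a * b) + w * b ^ 2) := by
    have e : x * (x * a ^ 2 + 2 * y * (a * b) + w * b ^ 2) =
      (x * a + y * b) ^ 2 + (x * w - y ^ 2) * b ^ 2 := by ring
    rw [e]
    rcases eq_or_ne b 0 with rfl | hb
    · have ha : a ≠ 0 := fun h => hab ⟨h, rfl⟩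
      have : x * a + y * 0 ≠ 0 := by simpa using ⟨hx.ne', ha⟩
      positivity
    · have : 0 < b ^ 2 := by positivity
      nlinarith [sq_nonneg (x * a + y * b), mul_pos hD this]
  exact (mul_pos_iff_of_pos_left hx).1 h

theorem rows_ne_zero {a b c d : ℤ} {n : ℕ} (hn : 1 ≤ n) (h : a * d - b * c = n) :
    ¬(a = 0 ∧ b = 0) ∧ ¬(c = 0 ∧ d = 0) := by
  constructor <;> rintro ⟨rfl, rfl⟩ <;> simp at h <;> omega

/-- With rows `r₁`, `r₂` and off-diagonal entries `o_Q`, `o_1`, there is the identity `Q(r₁)|r₂|² +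
Q(r₂)|r₁|² = n² tr Q + 2 o_Q o_1`. If the signs disagree, the right side is at most `n² tr Q`; as
`Q` takes positive integral values on the rows, both rows are bounded. -/
theorem finite_hv_offDiag_ne {n : ℕ} (hn : 1 ≤ n) {x y w : ℤ} (hx : 0 < x)
    (hD : 0 < x * w - y ^ 2) :
    {M : PMat | det M = n ∧ hv (offDiag x y w M) ≠ hv (offDiag 1 0 1 M)}.Finite := by
  refine (finite_bounded (n ^ 2 * (x + w))).subset ?_
  rintro M ⟨hM, hne⟩
  obtain ⟨a, b, c, d, rfl⟩ := exists_entries M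
  rw [det_cls] at hM
  rw [offDiag_cls, offDiag_cls] at hne
  have hle := mul_nonpos_of_hv_ne hne
  obtain ⟨hab, hcd⟩ := rows_ne_zero hn hM
  have h1 := form_pos hx hD hab
  have h2 := form_pos hx hD hcd
  have key : (x * a ^ 2 + 2 * y * (a * b) + w * b ^ 2) * (c ^ 2 + d ^ 2) +
      (x * c ^ 2 + 2 * y * (c * d) + w * d ^ 2) * (a ^ 2 + b ^ 2) =
      n ^ 2 * (x + w) + 2 * ((x * a * c + y * (a * d + b * c) + w * b * d) *
        (1 * a * c + 0 * (a * d + b * c) + 1 * b * d)) := by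
    rw [← hM]; ring
  have h3 : 0 ≤ a ^ 2 + b ^ 2 := by positivity
  have h4 : 0 ≤ c ^ 2 + d ^ 2 := by positivity
  obtain ⟨ha, hb⟩ := abs_le_of_sq_add_sq_le (a := a) (b := b) (K := n ^ 2 * (x + w)) (by nlinarith)
  obtain ⟨hc, hd⟩ := abs_le_of_sq_add_sq_le (a := c) (b := d) (K := n ^ 2 * (x + w)) (by nlinarith)
  exact ⟨a, b, c, d, ha, hb, hc, hd, rfl⟩

/-! ### Counting reduced forms -/

/-- The function on matrices `M` which is `1` if the form `M Q Mᵗ` is in the interior of the domain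
of reduced forms (obtuse superbases) and `0` if it is in the exterior. -/
def chi (x y w : ℤ) (M : PMat) : ℚ :=
  hv (offDiag x y w M) + hv (offDiag x y w (ofPSL U * M)) + hv (offDiag x y w (ofPSL U⁻¹ * M)) - 2

theorem offDiag_U_mul (x y w a b c d : ℤ) :
    offDiag x y w (ofPSL U * cls !![a, b; c, d]) =
      (x * a ^ 2 + 2 * y * (a * b) + w * b ^ 2) - (x * a * c + y * (a * d + b * c) + w * b * d) := by
  rw [ofPSL_U, cls_mul_cls, offDiag_cls]
  ring

theorem offDiag_U_inv_mul (x y w a b c d : ℤ) :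
    offDiag x y w (ofPSL U⁻¹ * cls !![a, b; c, d]) =
      (x * c ^ 2 + 2 * y * (c * d) + w * d ^ 2) - (x * a * c + y * (a * d + b * c) + w * b * d) := by
  rw [ofPSL_U_inv, cls_mul_cls, offDiag_cls]
  ring

theorem offDiag_mul_cls (x y w a b c d : ℤ) (N : PMat) :
    offDiag x y w (N * cls !![a, b; c, d]) =
      offDiag (x * a ^ 2 + 2 * y * (a * b) + w * b ^ 2) (x * a * c + y * (a * d + b * c) + w * b * d)
        (x * c ^ 2 + 2 * y * (c * d) + w * d ^ 2) N := by
  obtain ⟨a', b', c', d', rfl⟩ := exists_entries N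
  rw [cls_mul_cls, offDiag_cls, offDiag_cls]
  ring

theorem chi_mul_cls (x y w a b c d : ℤ) (N : PMat) :
    chi x y w (N * cls !![a, b; c, d]) =
      chi (x * a ^ 2 + 2 * y * (a * b) + w * b ^ 2) (x * a * c + y * (a * d + b * c) + w * b * d)
        (x * c ^ 2 + 2 * y * (c * d) + w * d ^ 2) N := by
  simp only [chi, ← mul_assoc, offDiag_mul_cls]

/-- If the pairwise sums of `p`, `q`, `r` are positive, then at most one of them is not positive. -/
theorem sum_hv {p q r : ℤ} (h1 : 0 < p + q) (h2 : 0 < p + r) (h3 : 0 < q + r) :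
    (hv p + hv q + hv r - 2 = 1 ∧ 0 < p ∧ 0 < q ∧ 0 < r) ∨
    (hv p + hv q + hv r - 2 = 1 / 2 ∧ 0 ≤ p ∧ 0 ≤ q ∧ 0 ≤ r) ∨
    (hv p + hv q + hv r - 2 = 0 ∧ p ≠ 0 ∧ q ≠ 0 ∧ r ≠ 0 ∧ (p < 0 ∨ q < 0 ∨ r < 0)) := by
  rcases lt_trichotomy p 0 with h | rfl | h
  · rw [hv_of_neg h, hv_of_pos (k := q) (by omega), hv_of_pos (k := r) (by omega)]
    norm_num
    omega
  · rw [hv_zero, hv_of_pos (k := q) (by omega), hv_of_pos (k := r) (by omega)]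
    norm_num
    omega
  rw [hv_of_pos h]
  rcases lt_trichotomy q 0 with h' | rfl | h'
  · rw [hv_of_neg h', hv_of_pos (k := r) (by omega)]
    norm_num
    omega
  · rw [hv_zero, hv_of_pos (k := r) (by omega)]
    norm_num
    omega
  rw [hv_of_pos h']
  rcases lt_trichotomy r 0 with h'' | rfl | h''
  · rw [hv_of_neg h'']
    norm_num
    omega
  · rw [hv_zero]
    norm_num
    omega
  · rw [hv_of_pos h'']
    norm_num
    omega

theorem form_sums_pos {n : ℕ} (hn : 1 ≤ n) {x y w a b c d : ℤ} (hx : 0 < x)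
    (hD : 0 < x * w - y ^ 2) (h : a * d - b * c = n) :
    0 < x * a ^ 2 + 2 * y * (a * b) + w * b ^ 2 ∧ 0 < x * c ^ 2 + 2 * y * (c * d) + w * d ^ 2 ∧
    0 < x * a ^ 2 + 2 * y * (a * b) + w * b ^ 2 + (x * c ^ 2 + 2 * y * (c * d) + w * d ^ 2) -
      2 * (x * a * c + y * (a * d + b * c) + w * b * d) := by
  obtain ⟨hab, hcd⟩ := rows_ne_zero hn h
  obtain ⟨hac, -⟩ := rows_ne_zero (a := a - c) (b := b - d) (c := c) (d := d) hn (by rw [← h]; ring)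
  refine ⟨form_pos hx hD hab, form_pos hx hD hcd, ?_⟩
  have := form_pos hx hD hac
  nlinarith

/-- `p`, `q`, `r` are the Selling parameters of `M Q Mᵗ`: minus the products of pairs from the
superbase `r₁`, `-r₂`, `r₂ - r₁` made of the rows. Their pairwise sums are values of the form, hence
positive, and their second symmetric function is the determinant. -/
theorem chi_cases {n : ℕ} (hn : 1 ≤ n) {x y w a b c d : ℤ} (hx : 0 < x)
    (hD : 0 < x * w - y ^ 2) (h : a * d - b * c = n) {p q r : ℤ}
    (hp : p = x * a * c + y * (a * d + b * c) + w * b * d)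
    (hq : q = x * a ^ 2 + 2 * y * (a * b) + w * b ^ 2 - p)
    (hr : r = x * c ^ 2 + 2 * y * (c * d) + w * d ^ 2 - p) :
    p * q + p * r + q * r = (x * w - y ^ 2) * n ^ 2 ∧ 0 < p + q ∧ 0 < p + r ∧ 0 < q + r ∧
    chi x y w (cls !![a, b; c, d]) = hv p + hv q + hv r - 2 := by
  obtain ⟨h1, h2, h3⟩ := form_sums_pos hn hx hD h
  refine ⟨?_, by linarith, by linarith, by linarith, ?_⟩
  · rw [hq, hr, hp, ← h]; ring
  · rw [chi, offDiag_U_mul, offDiag_U_inv_mul, offDiag_cls, hq, hr, hp]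

/-- Half the indicator function of the matrices with orthogonal rows. -/
def orth (M : PMat) : ℚ := if offDiag 1 0 1 M = 0 then 1 / 2 else 0

/-- In determinant one `pq + pr + qr = 1`, which excludes three positive integers. The form never
lies in the interior of the reduced domain, and on the boundary exactly one parameter vanishes. -/
theorem chi_one_eq {M : PMat} (hM : det M = 1) :
    chi 1 0 1 M = orth M + orth (ofPSL U * M) + orth (ofPSL U⁻¹ * M) := by
  obtain ⟨a, b, c, d, rfl⟩ := exists_entries M
  rw [det_cls] at hM
  obtain ⟨h1, h2, h3, h4, h5⟩ := chi_cases (n := 1) (x := 1) (y := 0) (w := 1) le_rfl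
    one_pos (by norm_num) (by rw [hM]; rfl) rfl rfl rfl
  rw [h5, orth, orth, orth, offDiag_U_mul, offDiag_U_inv_mul, offDiag_cls]
  generalize 1 * a * c + 0 * (a * d + b * c) + 1 * b * d = p at *
  generalize 1 * a ^ 2 + 2 * 0 * (a * b) + 1 * b ^ 2 - p = q at *
  generalize 1 * c ^ 2 + 2 * 0 * (c * d) + 1 * d ^ 2 - p = r at *
  norm_num at h1
  rcases sum_hv h2 h3 h4 with ⟨h, hp, hq, hr⟩ | ⟨h, hp, hq, hr⟩ | ⟨h, hp, hq, hr, -⟩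
  · nlinarith [mul_pos hp hq, mul_pos hp hr, mul_pos hq hr]
  · rw [h]
    rcases hp.eq_or_lt with rfl | hp
    · rw [if_pos rfl, if_neg (by omega), if_neg (by omega)]; norm_num
    rcases hq.eq_or_lt with rfl | hq
    · rw [if_neg (by omega), if_pos rfl, if_neg (by omega)]; norm_num
    rcases hr.eq_or_lt with rfl | hr
    · rw [if_neg (by omega), if_neg (by omega), if_pos rfl]; norm_num
    nlinarith [mul_pos hp hq, mul_pos hp hr, mul_pos hq hr]
  · rw [h, if_neg hp, if_neg hq, if_neg hr]; norm_num

theorem S_ne_one : S ≠ 1 := by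
  intro h
  have := congrArg ofPSL h
  rw [ofPSL_S, ofPSL_one, cls_entries_eq_iff] at this
  norm_num at this

theorem orth_ofPSL (γ : Γ) [Decidable (γ = 1 ∨ γ = S)] :
    orth (ofPSL γ) = if γ = 1 ∨ γ = S then 1 / 2 else 0 := by
  rw [orth]
  refine if_congr ?_ rfl rfl
  constructor
  · intro h
    obtain ⟨a, b, c, d, hdet, hγ⟩ := exists_ofPSL_eq γ
    rw [hγ, offDiag_cls] at h
    -- Lagrange's identity: orthogonal rows and determinant one force both rows to have length one.
    have hsq : (a ^ 2 + b ^ 2) * (c ^ 2 + d ^ 2) = 1 := by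
      have e : (a ^ 2 + b ^ 2) * (c ^ 2 + d ^ 2) = (a * d - b * c) ^ 2 +
        (1 * a * c + 0 * (a * d + b * c) + 1 * b * d) ^ 2 := by ring
      rw [e, h, hdet]; norm_num
    have h1 : a ^ 2 + b ^ 2 = 1 := by
      rcases Int.eq_one_or_neg_one_of_mul_eq_one hsq with h | h
      · exact h
      · nlinarith [sq_nonneg a, sq_nonneg b]
    have h2 : c ^ 2 + d ^ 2 = 1 := by rw [h1, one_mul] at hsq; exact hsq
    have e1 : a = d := by nlinarith [sq_nonneg (a - d), sq_nonneg (b + c)]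
    have e2 : c = -b := by nlinarith [sq_nonneg (a - d), sq_nonneg (b + c)]
    subst e1 e2
    have ha : a = 0 ∨ a = 1 ∨ a = -1 := by
      have : -1 ≤ a := by nlinarith [sq_nonneg b]
      have : a ≤ 1 := by nlinarith [sq_nonneg b]
      omega
    rcases ha with rfl | ha
    · right
      apply ofPSL_injective
      rw [hγ, ofPSL_S, cls_entries_eq_iff]
      have : b = 1 ∨ b = -1 := mul_self_eq_one_iff.1 (by linarith)
      omega
    · left
      apply ofPSL_injective
      rw [hγ, ofPSL_one, cls_entries_eq_iff]
      have : b = 0 := by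
        rcases ha with rfl | rfl <;> simpa using h1
      omega
  · rintro (rfl | rfl)
    · rw [ofPSL_one, offDiag_cls]; norm_num
    · rw [ofPSL_S, offDiag_cls]; norm_num

theorem support_orth_finite : (Function.support fun γ : Γ => orth (ofPSL γ)).Finite := by
  classical
  refine (Set.toFinite {1, S}).subset fun γ hγ => ?_
  rw [Function.mem_support, orth_ofPSL] at hγ
  by_contra h
  exact hγ (if_neg h)

theorem finsum_orth : ∑ᶠ γ : Γ, orth (ofPSL γ) = 1 := by
  classical
  rw [finsum_eq_sum_of_support_subset (s := {1, S})]
  · rw [Finset.sum_pair S_ne_one.symm, orth_ofPSL, orth_ofPSL]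
    norm_num
  · intro γ hγ
    rw [Function.mem_support, orth_ofPSL] at hγ
    by_contra h
    exact hγ (if_neg (by simpa using h))

theorem finsum_eq_zero_of_neg {α : Type*} (e : α ≃ α) {f : α → ℚ} (h : ∀ x, f (e x) = -f x) :
    ∑ᶠ x, f x = 0 := by
  have h1 : ∑ᶠ x, f (e x) = ∑ᶠ x, f x := finsum_comp_equiv e
  simp only [h, finsum_neg_distrib] at h1
  linarith

theorem finsum_add_comp_comp {α : Type*} (e₁ e₂ : α ≃ α) {f : α → ℚ} (hf : f.support.Finite) :
    (Function.support fun x => f x + f (e₁ x) + f (e₂ x)).Finite ∧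
    ∑ᶠ x, (f x + f (e₁ x) + f (e₂ x)) = 3 * ∑ᶠ x, f x := by
  have h1 : (Function.support fun x => f (e₁ x)).Finite := hf.preimage e₁.injective.injOn
  have h2 : (Function.support fun x => f (e₂ x)).Finite := hf.preimage e₂.injective.injOn
  have h3 : (Function.support fun x => f x + f (e₁ x)).Finite :=
    (hf.union h1).subset (Function.support_add _ _)
  refine ⟨(h3.union h2).subset (Function.support_add _ _), ?_⟩
  rw [finsum_add_distrib h3 h2, finsum_add_distrib hf h1, finsum_comp_equiv e₁,
    finsum_comp_equiv e₂]
  ring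

/-- The translates of the domain of reduced forms cover the forms exactly three times. -/
theorem finsum_chi {x y w : ℤ} (hx : 0 < x) (hD : 0 < x * w - y ^ 2) :
    (Function.support fun γ : Γ => chi x y w (ofPSL γ)).Finite ∧
      ∑ᶠ γ : Γ, chi x y w (ofPSL γ) = 3 := by
  -- Each Heaviside value is compared with that of the identity form. The difference has finite
  -- support and is odd under `S`, so it sums to zero; the count is independent of the form and is
  -- evaluated through `orth`.
  let f : Γ → ℚ := fun γ => hv (offDiag x y w (ofPSL γ)) - hv (offDiag 1 0 1 (ofPSL γ))
  have hf : f.support.Finite := by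
    refine ((finite_hv_offDiag_ne le_rfl hx hD).preimage ofPSL_injective.injOn).subset ?_
    intro γ hγ
    exact ⟨by rw [det_ofPSL]; rfl, sub_ne_zero.1 hγ⟩
  have hf0 : ∑ᶠ γ, f γ = 0 := by
    refine finsum_eq_zero_of_neg (Equiv.mulLeft S) fun γ => ?_
    simp only [f, Equiv.coe_mulLeft, map_mul, offDiag_S_mul, hv_neg]
    ring
  obtain ⟨h1, h2⟩ := finsum_add_comp_comp (Equiv.mulLeft U) (Equiv.mulLeft U⁻¹) hf
  obtain ⟨h3, h4⟩ := finsum_add_comp_comp (Equiv.mulLeft U) (Equiv.mulLeft U⁻¹) support_orth_finite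
  have heq : (fun γ : Γ => chi x y w (ofPSL γ)) = fun γ =>
      (f γ + f (Equiv.mulLeft U γ) + f (Equiv.mulLeft U⁻¹ γ)) +
      (orth (ofPSL γ) + orth (ofPSL (Equiv.mulLeft U γ)) + orth (ofPSL (Equiv.mulLeft U⁻¹ γ))) := by
    funext γ
    simp only [Equiv.coe_mulLeft, map_mul]
    rw [← chi_one_eq (det_ofPSL γ)]
    simp only [f, chi, map_mul]
    ring
  rw [heq]
  refine ⟨(h1.union h3).subset (Function.support_add _ _), ?_⟩
  rw [finsum_add_distrib h1 h3, h2, h4, hf0, finsum_orth]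
  norm_num

/-! ### An explicit lift -/

theorem chi_comp_finite {x y w : ℤ} (hx : 0 < x) (hD : 0 < x * w - y ^ 2) {n : ℕ} (hn : 1 ≤ n)
    {M : PMat} (hM : det M = n) :
    (Function.support fun γ : Γ => chi x y w (ofPSL γ * M)).Finite ∧
      ∑ᶠ γ : Γ, chi x y w (ofPSL γ * M) = 3 := by
  obtain ⟨a, b, c, d, rfl⟩ := exists_entries M
  rw [det_cls] at hM
  simp only [chi_mul_cls]
  refine finsum_chi (form_sums_pos hn hx hD hM).1 ?_
  have h : 0 < (x * w - y ^ 2) * n ^ 2 := by positivity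
  rw [← hM] at h
  nlinarith

/-- There are finitely many Hermite forms of determinant `n`, and `chi_comp_finite` gives finiteness
on the coset of each. -/
theorem finite_chi_ne_zero {n : ℕ} (hn : 1 ≤ n) {x y w : ℤ} (hx : 0 < x)
    (hD : 0 < x * w - y ^ 2) : {M : PMat | det M = n ∧ chi x y w M ≠ 0}.Finite := by
  let t : ℕ × ℕ × ℕ → PMat := fun p => cls !![(p.1 : ℤ), (p.2.1 : ℤ); 0, (p.2.2 : ℤ)]
  let I : Set (ℕ × ℕ × ℕ) := {p | p.1 ≤ n ∧ p.2.1 ≤ n ∧ p.2.2 ≤ n ∧ p.1 * p.2.2 = n}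
  have hI : I.Finite := by
    refine ((Set.finite_Iic n).prod ((Set.finite_Iic n).prod (Set.finite_Iic n))).subset ?_
    rintro p ⟨h1, h2, h3, -⟩
    exact ⟨h1, h2, h3⟩
  refine (hI.biUnion fun p hp => ((chi_comp_finite hx hD hn (M := t p) ?_).1.image
    fun γ => ofPSL γ * t p)).subset ?_
  · simp only [t, det_cls, mul_zero, sub_zero]
    exact_mod_cast hp.2.2.2
  · rintro M ⟨hM, hne⟩
    obtain ⟨γ, a, b, d, had, hbd, hγ⟩ := exists_upper hn hM
    have ha : 0 < a := by
      rcases Nat.eq_zero_or_pos a with rfl | h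
      · omega
      · exact h
    have hd : d ≤ n := by nlinarith
    have han : a ≤ n := by nlinarith
    have hM' : ofPSL γ⁻¹ * t (a, b, d) = M := by
      simp only [t]
      rw [← hγ, ofPSL_inv_mul_cancel_left]
    refine Set.mem_biUnion (x := (a, b, d)) ⟨han, by simp only; omega, hd, had⟩ ⟨γ⁻¹, ?_, hM'⟩
    rwa [Function.mem_support, hM']

/-- The coefficients of an explicit lift. -/
def liftCoeff (n : ℕ) (M : PMat) : ℚ :=
  if det M = n then
    -- The triples `1 0 1` and `2 1 2` are the forms invariant under `S` and `U`. The single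
    -- Heaviside values do not have finite support, but their difference does.
    1 / 3 * chi 2 1 2 M + (hv (offDiag 1 0 1 M) - hv (offDiag 2 1 2 M)) else 0

theorem support_liftCoeff_finite {n : ℕ} (hn : 1 ≤ n) : (liftCoeff n).support.Finite := by
  refine ((finite_chi_ne_zero hn (x := 2) (y := 1) (w := 2) (by norm_num) (by norm_num)).union
    (finite_hv_offDiag_ne hn (x := 2) (y := 1) (w := 2) (by norm_num) (by norm_num))).subset ?_
  intro M hM
  rw [Function.mem_support, liftCoeff] at hM
  have hdet : det M = n := by
    by_contra h
    exact hM (if_neg h)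
  rw [if_pos hdet] at hM
  by_contra hcon
  simp only [Set.mem_union, Set.mem_ofPred_eq, hdet, true_and, not_or, not_not] at hcon
  exact hM (by rw [hcon.1, hcon.2]; ring)

/-- An explicit lift. -/
noncomputable def liftElt {n : ℕ} (hn : 1 ≤ n) : R :=
  .ofCoeff (Finsupp.ofSupportFinite (liftCoeff n) (support_liftCoeff_finite hn))

theorem coeff_liftElt {n : ℕ} (hn : 1 ≤ n) (M : PMat) : (liftElt hn).coeff M = liftCoeff n M := rfl

theorem offDiag_mul_S (M : PMat) : offDiag 1 0 1 (M * ofPSL S) = offDiag 1 0 1 M := by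
  rw [ofPSL_S, offDiag_mul_cls]
  norm_num

theorem offDiag_mul_U_inv (M : PMat) : offDiag 2 1 2 (M * ofPSL U⁻¹) = offDiag 2 1 2 M := by
  rw [ofPSL_U_inv, offDiag_mul_cls]
  norm_num

theorem U_mul_U_mul (M : PMat) : ofPSL U * (ofPSL U * M) = ofPSL U⁻¹ * M := by
  rw [← mul_assoc, ← map_mul, ← pow_two, U_sq]

theorem U_inv_mul_U_inv_mul (M : PMat) : ofPSL U⁻¹ * (ofPSL U⁻¹ * M) = ofPSL U * M := by
  rw [← mul_assoc, ← map_mul, ← pow_two, U_inv_sq]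

theorem chi_U_mul (x y w : ℤ) (M : PMat) : chi x y w (ofPSL U * M) = chi x y w M := by
  simp only [chi, U_mul_U_mul, ofPSL_inv_mul_cancel_left]
  ring

theorem chi_U_inv_mul (x y w : ℤ) (M : PMat) : chi x y w (ofPSL U⁻¹ * M) = chi x y w M := by
  simp only [chi, U_inv_mul_U_inv_mul, ofPSL_mul_inv_cancel_left]
  ring

/-- The Heaviside difference is odd under `S`: it has degree zero on cosets, where `chi` contributes
`3 / 3`, and left multiplication by `1 + S` leaves only `chi 2 1 2`, which is invariant under `U` on
the right. Summing over a left orbit of `U` cancels `chi 2 1 2` and leaves `chi 1 0 1`, which is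
invariant under `S` on the right. -/
theorem isLift_liftElt {n : ℕ} (hn : 1 ≤ n) : IsLift n (liftElt hn) := by
  refine ⟨?_, ?_, ?_, ?_⟩
  · intro M hM
    rw [coeff_liftElt, liftCoeff] at hM
    by_contra h
    exact hM (if_neg h)
  · intro M hM
    have hinj : Function.Injective fun γ : Γ => ofPSL γ * M := by
      intro γ δ h
      refine ofPSL_injective (mul_right_cancel_of_det (P := M) ?_ h)
      rw [hM]
      exact_mod_cast (by omega : n ≠ 0)
    have hrange : coset M = Set.range fun γ : Γ => ofPSL γ * M := by
      ext N
      exact exists_congr fun γ => eq_comm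
    rw [deg_eq_finsum, ← finsum_mem_def, hrange, finsum_mem_range hinj]
    obtain ⟨h1, h2⟩ := chi_comp_finite (x := 2) (y := 1) (w := 2) (by norm_num) (by norm_num) hn hM
    let f : Γ → ℚ := fun γ =>
      hv (offDiag 1 0 1 (ofPSL γ * M)) - hv (offDiag 2 1 2 (ofPSL γ * M))
    have hf : f.support.Finite := by
      refine ((finite_hv_offDiag_ne hn (x := 2) (y := 1) (w := 2) (by norm_num)
        (by norm_num)).preimage hinj.injOn).subset ?_
      intro γ hγ
      exact ⟨by rw [det_ofPSL_mul, hM], (sub_ne_zero.1 hγ).symm⟩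
    have hf0 : ∑ᶠ γ, f γ = 0 := by
      refine finsum_eq_zero_of_neg (Equiv.mulLeft S) fun γ => ?_
      simp only [f, Equiv.coe_mulLeft, map_mul, mul_assoc, offDiag_S_mul, hv_neg]
      ring
    have heq : (fun γ : Γ => (liftElt hn).coeff (ofPSL γ * M)) =
        fun γ => 1 / 3 * chi 2 1 2 (ofPSL γ * M) + f γ := by
      funext γ
      rw [coeff_liftElt, liftCoeff, if_pos (by rw [det_ofPSL_mul, hM])]
    rw [heq, finsum_add_distrib (h1.subset fun γ hγ h0 => hγ
      (by simp only [show chi 2 1 2 (ofPSL γ * M) = 0 from h0, mul_zero])) hf,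
      ← mul_finsum, h2, hf0]
    norm_num
  · have h : ∀ M, liftCoeff n M + liftCoeff n (ofPSL S * M) =
        if det M = n then 1 / 3 * chi 2 1 2 M + 1 / 3 * chi 2 1 2 (ofPSL S * M) else 0 := by
      intro M
      rw [liftCoeff, liftCoeff, det_ofPSL_mul]
      split_ifs
      · rw [offDiag_S_mul, offDiag_S_mul, hv_neg, hv_neg]; ring
      · norm_num
    have hchi : ∀ M, chi 2 1 2 (M * ofPSL U⁻¹) = chi 2 1 2 M := by
      intro M
      simp only [chi, ← mul_assoc, offDiag_mul_U_inv]
    ext M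
    rw [mul_sub, mul_one, MonoidAlgebra.coeff_sub, Finsupp.sub_apply, coeff_mul_elΓ]
    simp only [add_mul, one_mul, MonoidAlgebra.coeff_add, Finsupp.add_apply, coeff_elΓ_mul, S_inv,
      coeff_liftElt, h, det_mul_ofPSL]
    rw [← mul_assoc, hchi, hchi, sub_self]
    rfl
  · have h : ∀ M, liftCoeff n M + liftCoeff n (ofPSL U⁻¹ * M) + liftCoeff n (ofPSL U * M) =
        if det M = n then chi 1 0 1 M else 0 := by
      intro M
      simp only [liftCoeff, det_ofPSL_mul, chi_U_mul, chi_U_inv_mul]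
      split_ifs
      · simp only [chi]; ring
      · norm_num
    have hchi : ∀ M, chi 1 0 1 (M * ofPSL S) = chi 1 0 1 M := by
      intro M
      simp only [chi, ← mul_assoc, offDiag_mul_S]
    ext M
    rw [mul_sub, mul_one, MonoidAlgebra.coeff_sub, Finsupp.sub_apply, coeff_mul_elΓ]
    simp only [add_mul, one_mul, MonoidAlgebra.coeff_add, Finsupp.add_apply, coeff_elΓ_mul, S_inv,
      elΓ_pow, U_sq, inv_inv, coeff_liftElt, h, det_mul_ofPSL, hchi, sub_self]
    rfl

/-! ### Generators of `Γ` of orders two and three -/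

theorem conj_entries {δ : Γ} {p q r s : ℤ} (hδ : ofPSL δ = cls !![p, q; r, s]) (a b c d : ℤ) :
    conjEquiv δ (cls !![a, b; c, d]) =
      cls !![s * (p * a + q * c) - r * (p * b + q * d), p * (p * b + q * d) - q * (p * a + q * c);
        s * (r * a + s * c) - r * (r * b + s * d), p * (r * b + s * d) - q * (r * a + s * c)] := by
  rw [conjEquiv_apply, ofPSL_inv hδ, hδ, cls_mul_cls, cls_mul_cls]
  congr 1
  ext i j
  fin_cases i <;> fin_cases j <;> simp <;> ring

/-- The count three of `finsum_chi` is nonzero, so some translate is reduced. As `pq + pr + qr = 1`,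
one Selling parameter vanishes there, and the three parameters are the off-diagonal entries at `γ`,
`U γ` and `U⁻¹ γ`. -/
theorem exists_offDiag_eq_zero {x y w : ℤ} (hx : 0 < x) (hD : x * w - y ^ 2 = 1) :
    ∃ γ : Γ, offDiag x y w (ofPSL γ) = 0 := by
  have hD' : 0 < x * w - y ^ 2 := by rw [hD]; exact one_pos
  obtain ⟨γ, hγ⟩ : ∃ γ : Γ, chi x y w (ofPSL γ) ≠ 0 := by
    by_contra hcon
    push Not at hcon
    have h := (finsum_chi hx hD').2
    simp only [hcon, finsum_zero] at h
    norm_num at h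
  obtain ⟨a, b, c, d, hdet, h⟩ := exists_ofPSL_eq γ
  obtain ⟨h1, h2, h3, h4, h5⟩ := chi_cases (n := 1) le_rfl hx hD' (by rw [hdet]; rfl) rfl rfl rfl
  have hU := offDiag_U_mul x y w a b c d
  have hV := offDiag_U_inv_mul x y w a b c d
  have h0 := offDiag_cls x y w a b c d
  rw [h, h5] at hγ
  rw [← h0, ← h] at hU hV
  simp only [← h0, ← h] at h1 h2 h3 h4 hγ
  rw [hD] at h1
  by_contra hcon
  push Not at hcon
  have n1 := hcon γ
  have n2 := hcon (U * γ)
  have n3 := hcon (U⁻¹ * γ)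
  rw [map_mul, hU] at n2
  rw [map_mul, hV] at n3
  norm_num at h1
  rcases sum_hv h2 h3 h4 with ⟨-, hp, hq, hr⟩ | ⟨-, hp, hq, hr⟩ | ⟨h, -⟩
  · nlinarith [mul_pos hp hq, mul_pos hp hr, mul_pos hq hr]
  · have hp := lt_of_le_of_ne hp (Ne.symm n1)
    have hq := lt_of_le_of_ne hq (Ne.symm n2)
    have hr := lt_of_le_of_ne hr (Ne.symm n3)
    nlinarith [mul_pos hp hq, mul_pos hp hr, mul_pos hq hr]
  · exact hγ h

theorem ofPSL_conj (h γ : Γ) : ofPSL (h * γ * h⁻¹) = conjEquiv h (ofPSL γ) := by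
  rw [conjEquiv_apply, map_mul, map_mul]

/-- Elements of order two are conjugate to `S`. -/
theorem exists_conj_S {γ : Γ} (hγ : orderOf γ = 2) : ∃ h : Γ, γ = h * S * h⁻¹ := by
  have hne : γ ≠ 1 := by
    rintro rfl
    simp at hγ
  have hsq : γ * γ = 1 := by
    have h := pow_orderOf_eq_one γ
    rwa [hγ, pow_two] at h
  obtain ⟨a, b, c, d, hdet, h⟩ := exists_ofPSL_eq γ
  have h2 := congrArg ofPSL hsq
  rw [map_mul, h, cls_mul_cls, ofPSL_one, cls_entries_eq_iff] at h2
  have htr : d = -a := by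
    by_contra hcon
    have had : a + d ≠ 0 := fun h' => hcon (by linarith)
    have hb : b = 0 := by
      have : b * (a + d) = 0 := by rcases h2 with h2 | h2 <;> linarith [h2.2.1]
      exact (mul_eq_zero.1 this).resolve_right had
    have hc : c = 0 := by
      have : c * (a + d) = 0 := by rcases h2 with h2 | h2 <;> linarith [h2.2.2.1]
      exact (mul_eq_zero.1 this).resolve_right had
    subst hb hc
    refine hne (ofPSL_injective ?_)
    rw [h, ofPSL_one, cls_entries_eq_iff]
    have had' : a * d = 1 := by linarith
    rcases Int.eq_one_or_neg_one_of_mul_eq_one had' with rfl | rfl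
    · left; refine ⟨rfl, rfl, rfl, by linarith⟩
    · right; refine ⟨rfl, rfl, rfl, by linarith⟩
  subst htr
  -- `(b -a; -a -c)` is the fixed-point form of `γ`, of determinant one. Its diagonalization by `δ`
  -- has diagonal entries `1`, and then `δ` conjugates `γ` to `S`.
  have main : ∀ a b c : ℤ, 0 < b → a * -a - b * c = 1 → ofPSL γ = cls !![a, b; c, -a] →
      ∃ h : Γ, γ = h * S * h⁻¹ := by
    intro a b c hb hdet h
    obtain ⟨δ, hδ⟩ := exists_offDiag_eq_zero (x := b) (y := -a) (w := -c) hb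
      (by linear_combination hdet)
    obtain ⟨p, q, r, s, hdet', h'⟩ := exists_ofPSL_eq δ
    rw [h', offDiag_cls] at hδ
    obtain ⟨h1, h2, h3⟩ := form_sums_pos (n := 1) (x := b) (y := -a) (w := -c) le_rfl hb
      (by rw [show b * -c - (-a) ^ 2 = 1 by linear_combination hdet]; exact one_pos)
      (by rw [hdet']; rfl)
    have hprod : (b * p ^ 2 + 2 * -a * (p * q) + -c * q ^ 2) *
        (b * r ^ 2 + 2 * -a * (r * s) + -c * s ^ 2) = 1 := by
      have e : (b * p ^ 2 + 2 * -a * (p * q) + -c * q ^ 2) *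
        (b * r ^ 2 + 2 * -a * (r * s) + -c * s ^ 2) =
        (a * -a - b * c) * (p * s - q * r) ^ 2 +
          (b * p * r + -a * (p * s + q * r) + -c * q * s) ^ 2 := by ring
      rw [e, hdet, hdet', hδ]; norm_num
    have hX : b * p ^ 2 + 2 * -a * (p * q) + -c * q ^ 2 = 1 := by
      rcases Int.eq_one_or_neg_one_of_mul_eq_one hprod with h | h <;> linarith
    have hW : b * r ^ 2 + 2 * -a * (r * s) + -c * s ^ 2 = 1 := by
      rw [hX, one_mul] at hprod; exact hprod
    refine ⟨δ⁻¹, ?_⟩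
    have hconj : δ * γ * δ⁻¹ = S := by
      apply ofPSL_injective
      rw [ofPSL_conj, h, conj_entries h', ofPSL_S, cls_entries_eq_iff]
      right
      refine ⟨?_, ?_, ?_, ?_⟩
      · linear_combination -hδ
      · linear_combination hX
      · linear_combination -hW
      · linear_combination hδ
    rw [← hconj]
    group
  rcases lt_trichotomy b 0 with hb | rfl | hb
  · refine main (-a) (-b) (-c) (by omega) (by linarith) ?_
    rw [h, ← cls_neg a b c (-a)]
  · nlinarith [sq_nonneg a]
  · exact main a b c hb hdet h

/-- Words in the letters `S A` and `S A⁻¹`. -/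
inductive IsWord (A : Γ) : Γ → Prop
  | one : IsWord A 1
  | mul {m : Γ} : IsWord A m → IsWord A (m * (S * A))
  | mul_inv {m : Γ} : IsWord A m → IsWord A (m * (S * A⁻¹))

/-- Normal form for words in `S` and `A`: by induction on right multiplication by a letter, using
`S² = 1` and `A² = A⁻¹` to absorb the letter into the end of the word. -/
theorem exists_word {A : Γ} (hA : A ^ 3 = 1) {γ : Γ} (hγ : γ ∈ Subgroup.closure {S, A}) :
    ∃ s m e, (s = 1 ∨ s = S) ∧ IsWord A m ∧ (e = 1 ∨ e = S) ∧ γ = s * m * e := by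
  have hA2 : A * A = A⁻¹ := by rw [eq_inv_iff_mul_eq_one, ← pow_two, ← pow_succ, hA]
  have hA2' : A⁻¹ * A⁻¹ = A := by rw [← mul_inv_rev, hA2, inv_inv]
  have hSS : ∀ x, S * (S * x) = x := fun x => by rw [← mul_assoc, S_mul_S, one_mul]
  have stepS : ∀ x : Γ, (∃ s m e, (s = 1 ∨ s = S) ∧ IsWord A m ∧ (e = 1 ∨ e = S) ∧ x = s * m * e) →
      ∃ s m e, (s = 1 ∨ s = S) ∧ IsWord A m ∧ (e = 1 ∨ e = S) ∧ x * S = s * m * e := by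
    rintro x ⟨s, m, e, hs, hm, rfl | rfl, rfl⟩
    · exact ⟨s, m, S, hs, hm, Or.inr rfl, by rw [mul_one]⟩
    · exact ⟨s, m, 1, hs, hm, Or.inl rfl, by rw [mul_assoc, S_mul_S]⟩
  have hS' : ∀ s : Γ, s = 1 ∨ s = S → ∃ s', (s' = 1 ∨ s' = S) ∧ s = s' * S := by
    rintro s (rfl | rfl)
    · exact ⟨S, Or.inr rfl, S_mul_S.symm⟩
    · exact ⟨1, Or.inl rfl, (one_mul S).symm⟩
  have stepA : ∀ x : Γ, (∃ s m e, (s = 1 ∨ s = S) ∧ IsWord A m ∧ (e = 1 ∨ e = S) ∧ x = s * m * e) →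
      ∃ s m e, (s = 1 ∨ s = S) ∧ IsWord A m ∧ (e = 1 ∨ e = S) ∧ x * A = s * m * e := by
    rintro x ⟨s, m, e, hs, hm, rfl | rfl, rfl⟩
    · cases hm with
      | one =>
        obtain ⟨s', hs', rfl⟩ := hS' s hs
        exact ⟨s', _, 1, hs', IsWord.one.mul, Or.inl rfl, by simp [mul_assoc]⟩
      | mul hm' => exact ⟨s, _, 1, hs, hm'.mul_inv, Or.inl rfl, by simp [mul_assoc, hA2]⟩
      | mul_inv hm' => exact ⟨s, _, S, hs, hm', Or.inr rfl, by simp [mul_assoc]⟩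
    · exact ⟨s, _, 1, hs, hm.mul, Or.inl rfl, by simp [mul_assoc]⟩
  have stepA' : ∀ x : Γ, (∃ s m e, (s = 1 ∨ s = S) ∧ IsWord A m ∧ (e = 1 ∨ e = S) ∧ x = s * m * e) →
      ∃ s m e, (s = 1 ∨ s = S) ∧ IsWord A m ∧ (e = 1 ∨ e = S) ∧ x * A⁻¹ = s * m * e := by
    intro x hx
    rw [← hA2, ← mul_assoc]
    exact stepA _ (stepA _ hx)
  induction hγ using Subgroup.closure_induction_right with
  | one => exact ⟨1, 1, 1, Or.inl rfl, .one, Or.inl rfl, by simp⟩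
  | mul_right x hx y hy ih =>
    rcases hy with rfl | rfl
    · exact stepS _ ih
    · exact stepA _ ih
  | mul_inv_cancel x hx y hy ih =>
    rcases hy with rfl | rfl
    · rw [S_inv]; exact stepS _ ih
    · exact stepA' _ ih

/-- Matrices all of whose entries are nonzero, with the signs `(+ σ; σ +)`. -/
def HasSigns (σ : ℤ) (M : PMat) : Prop :=
  ∃ a b c d : ℤ, 0 < a ∧ 0 < b ∧ 0 < c ∧ 0 < d ∧ M = cls !![a, σ * b; σ * c, d]

theorem HasSigns.mul {σ : ℤ} (hσ : σ * σ = 1) {M N : PMat} (hM : HasSigns σ M)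
    (hN : HasSigns σ N) : HasSigns σ (M * N) := by
  obtain ⟨a, b, c, d, ha, hb, hc, hd, rfl⟩ := hM
  obtain ⟨a', b', c', d', ha', hb', hc', hd', rfl⟩ := hN
  refine ⟨a * a' + b * c', a * b' + b * d', c * a' + d * c', c * b' + d * d', by positivity,
    by positivity, by positivity, by positivity, ?_⟩
  rw [cls_mul_cls, cls_entries_eq_iff]
  left
  refine ⟨?_, ?_, ?_, ?_⟩
  · linear_combination b * c' * hσ
  · ring
  · ring
  · linear_combination c * b' * hσ

theorem IsWord.hasSigns {σ : ℤ} (hσ : σ * σ = 1) {A m : Γ} (h1 : HasSigns σ (ofPSL (S * A)))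
    (h2 : HasSigns σ (ofPSL (S * A⁻¹))) (hm : IsWord A m) : m = 1 ∨ HasSigns σ (ofPSL m) := by
  induction hm with
  | one => exact Or.inl rfl
  | mul _ ih =>
    right
    rcases ih with rfl | h
    · rwa [one_mul]
    · rw [map_mul]; exact h.mul hσ h1
  | mul_inv _ ih =>
    right
    rcases ih with rfl | h
    · rwa [one_mul]
    · rw [map_mul]; exact h.mul hσ h2

/-- A ping-pong argument. Nonempty words have four nonzero entries, and multiplying by `S` on either
side only permutes entries up to sign, whereas `T` has an entry zero. The empty word gives only `1`
and `S`. -/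
theorem T_notMem_closure {σ : ℤ} (hσ : σ * σ = 1) {A : Γ} (hA : A ^ 3 = 1)
    (h1 : HasSigns σ (ofPSL (S * A))) (h2 : HasSigns σ (ofPSL (S * A⁻¹))) :
    T ∉ Subgroup.closure {S, A} := by
  intro hT
  obtain ⟨s, m, e, hs, hm, he, h⟩ := exists_word hA hT
  have hσ0 : σ ≠ 0 := by rintro rfl; simp at hσ
  have hs' : s * s = 1 := by
    rcases hs with rfl | rfl
    · rw [one_mul]
    · exact S_mul_S
  have he' : e * e = 1 := by
    rcases he with rfl | rfl
    · rw [one_mul]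
    · exact S_mul_S
  have hme : m = s * T * e := by
    rw [h]
    calc m = 1 * m * 1 := by rw [one_mul, mul_one]
      _ = s * s * m * (e * e) := by rw [hs', he']
      _ = s * (s * m * e) * e := by simp only [mul_assoc]
  have hme' := congrArg ofPSL hme
  rcases hm.hasSigns hσ h1 h2 with rfl | ⟨a, b, c, d, ha, hb, hc, hd, hM⟩
  · rcases hs with rfl | rfl <;> rcases he with rfl | rfl <;>
    · simp only [map_mul, ofPSL_one, ofPSL_S, ofPSL_T, cls_mul_cls, cls_entries_eq_iff] at hme'
      norm_num at hme'
  · rw [hM] at hme'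
    have hb' : σ * b ≠ 0 := mul_ne_zero hσ0 hb.ne'
    have hc' : σ * c ≠ 0 := mul_ne_zero hσ0 hc.ne'
    rcases hs with rfl | rfl <;> rcases he with rfl | rfl <;>
    · simp only [map_mul, ofPSL_one, ofPSL_S, ofPSL_T, cls_mul_cls, cls_entries_eq_iff] at hme'
      norm_num at hme'
      omega

/-- An element of order three which generates `Γ` together with `S` is `U ^ (± 1)`, up to
conjugation by `S`. -/
theorem eq_U_of_closure {A : Γ} (hA : orderOf A = 3) (hcl : Subgroup.closure {S, A} = ⊤) :
    ∃ h : Γ, S = h * S * h⁻¹ ∧ (A = h * U * h⁻¹ ∨ A = h * U⁻¹ * h⁻¹) := by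
  have hA3 : A ^ 3 = 1 := by
    have h := pow_orderOf_eq_one A
    rwa [hA] at h
  have hne : A ≠ 1 := by
    rintro rfl
    simp at hA
  have hS1 : S = 1 * S * 1⁻¹ := by simp
  have hS2 : S = S * S * S⁻¹ := by simp
  have main : ∀ p q r : ℤ, p * (1 - p) - q * r = 1 → ofPSL A = cls !![p, q; r, 1 - p] →
      ∃ h : Γ, S = h * S * h⁻¹ ∧ (A = h * U * h⁻¹ ∨ A = h * U⁻¹ * h⁻¹) := by
    intro p q r hdet h
    have hinv := ofPSL_inv h
    have e1 : ofPSL (S * A) = cls !![-r, -(1 - p); p, q] := by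
      rw [map_mul, h, ofPSL_S, cls_mul_cls]; congr 4 <;> ring_nf
    have e2 : ofPSL (S * A⁻¹) = cls !![r, -p; 1 - p, -q] := by
      rw [map_mul, hinv, ofPSL_S, cls_mul_cls]; congr 4 <;> ring_nf
    have hT : T ∈ Subgroup.closure {S, A} := by rw [hcl]; trivial
    have hqr : q * r < 0 := by nlinarith [sq_nonneg (2 * p - 1)]
    have hsg : (q < 0 ∧ 0 < r) ∨ (0 < q ∧ r < 0) := by
      rcases mul_neg_iff.1 hqr with h | h
      · exact Or.inr h
      · exact Or.inl h
    have hsmall : q * r = -1 → (q = -1 ∧ r = 1) ∨ (q = 1 ∧ r = -1) := by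
      intro h
      rcases Int.eq_one_or_neg_one_of_mul_eq_one (show q * -r = 1 by linarith) with rfl | rfl
      · right; exact ⟨rfl, by linarith⟩
      · left; exact ⟨rfl, by linarith⟩
    -- For `p < 0` or `p > 1` the matrices of `S A` and `S A⁻¹` share a sign pattern, so `S` and `A`
    -- cannot generate `T`. The remaining values `p = 0, 1` have `q r = -1`, leaving four matrices,
    -- all conjugate to `U ^ (± 1)` by `1` or `S`.
    rcases lt_or_ge p 0 with hp | hp
    · exfalso
      rcases hsg with ⟨hq, hr⟩ | ⟨hq, hr⟩
      · refine T_notMem_closure (σ := 1) (by norm_num) hA3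
          ⟨r, 1 - p, -p, -q, hr, by omega, by omega, by omega, ?_⟩
          ⟨r, -p, 1 - p, -q, hr, by omega, by omega, by omega, ?_⟩ hT
        · rw [e1, cls_entries_eq_iff]; omega
        · rw [e2, cls_entries_eq_iff]; omega
      · refine T_notMem_closure (σ := -1) (by norm_num) hA3
          ⟨-r, 1 - p, -p, q, by omega, by omega, by omega, by omega, ?_⟩
          ⟨-r, -p, 1 - p, q, by omega, by omega, by omega, by omega, ?_⟩ hT
        · rw [e1, cls_entries_eq_iff]; omega
        · rw [e2, cls_entries_eq_iff]; omega
    rcases lt_or_ge 1 p with hp' | hp'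
    · exfalso
      rcases hsg with ⟨hq, hr⟩ | ⟨hq, hr⟩
      · refine T_notMem_closure (σ := -1) (by norm_num) hA3
          ⟨r, p - 1, p, -q, hr, by omega, by omega, by omega, ?_⟩
          ⟨r, p, p - 1, -q, hr, by omega, by omega, by omega, ?_⟩ hT
        · rw [e1, cls_entries_eq_iff]; omega
        · rw [e2, cls_entries_eq_iff]; omega
      · refine T_notMem_closure (σ := 1) (by norm_num) hA3
          ⟨-r, p - 1, p, q, by omega, by omega, by omega, by omega, ?_⟩
          ⟨-r, p, p - 1, q, by omega, by omega, by omega, by omega, ?_⟩ hT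
        · rw [e1, cls_entries_eq_iff]; omega
        · rw [e2, cls_entries_eq_iff]; omega
    have hUe := conj_entries ofPSL_S 1 (-1) 1 0
    have hVe := conj_entries ofPSL_S 0 1 (-1) 1
    obtain rfl | rfl : p = 0 ∨ p = 1 := by omega
    · rcases hsmall (by linarith) with ⟨rfl, rfl⟩ | ⟨rfl, rfl⟩
      · refine ⟨S, hS2, Or.inl (ofPSL_injective ?_)⟩
        rw [ofPSL_conj, ofPSL_U, hUe, h, cls_entries_eq_iff]; norm_num
      · refine ⟨1, hS1, Or.inr (ofPSL_injective ?_)⟩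
        rw [one_mul, inv_one, mul_one, ofPSL_U_inv, h]; norm_num
    · rcases hsmall (by linarith) with ⟨rfl, rfl⟩ | ⟨rfl, rfl⟩
      · refine ⟨1, hS1, Or.inl (ofPSL_injective ?_)⟩
        rw [one_mul, inv_one, mul_one, ofPSL_U, h]; norm_num
      · refine ⟨S, hS2, Or.inr (ofPSL_injective ?_)⟩
        rw [ofPSL_conj, ofPSL_U_inv, hVe, h, cls_entries_eq_iff]; norm_num
  obtain ⟨a, b, c, d, hdet, h⟩ := exists_ofPSL_eq A
  have h3 := congrArg ofPSL hA3
  rw [pow_succ, pow_two, map_mul, map_mul, h, cls_mul_cls, cls_mul_cls, ofPSL_one,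
    cls_entries_eq_iff] at h3
  -- By Cayley–Hamilton the off-diagonal entries of the cube are those of the matrix times `(a + d)²
  -- - 1`.
  have htr : (a + d) ^ 2 = 1 := by
    by_contra hcon
    have hcon' : (a + d) ^ 2 - 1 ≠ 0 := sub_ne_zero.2 hcon
    have hb : b = 0 := by
      refine (mul_eq_zero.1 (?_ : b * ((a + d) ^ 2 - 1) = 0)).resolve_right hcon'
      rcases h3 with h3 | h3 <;> linear_combination h3.2.1 + b * hdet
    have hc : c = 0 := by
      refine (mul_eq_zero.1 (?_ : c * ((a + d) ^ 2 - 1) = 0)).resolve_right hcon'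
      rcases h3 with h3 | h3 <;> linear_combination h3.2.2.1 + c * hdet
    subst hb hc
    refine hne (ofPSL_injective ?_)
    rw [h, ofPSL_one, cls_entries_eq_iff]
    have had' : a * d = 1 := by linarith
    rcases Int.eq_one_or_neg_one_of_mul_eq_one had' with rfl | rfl
    · left; refine ⟨rfl, rfl, rfl, by linarith⟩
    · right; refine ⟨rfl, rfl, rfl, by linarith⟩
  rcases mul_self_eq_one_iff.1 ((pow_two (a + d)).symm.trans htr) with h' | h'
  · obtain rfl : d = 1 - a := by linarith
    exact main a b c hdet h
  · obtain rfl : d = -(1 - -a) := by linarith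
    refine main (-a) (-b) (-c) (by linarith) ?_
    rw [h, ← cls_neg, neg_neg]

/-- Any two generators of `Γ` of orders two and three are simultaneously conjugate to `S` and
`U ^ (± 1)`. -/
theorem exists_conj_generators {g : Fin 2 → Γ} (hg0 : orderOf (g 0) = 2) (hg1 : orderOf (g 1) = 3)
    (hg : Subgroup.closure (Set.range g) = ⊤) :
    ∃ h : Γ, g 0 = h * S * h⁻¹ ∧ (g 1 = h * U * h⁻¹ ∨ g 1 = h * U⁻¹ * h⁻¹) := by
  obtain ⟨k, hk⟩ := exists_conj_S hg0
  have hA : orderOf (k⁻¹ * g 1 * k) = 3 := by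
    have h := MulAut.conj k⁻¹ |>.orderOf_eq (g 1)
    simpa [hg1] using h
  have hcl : Subgroup.closure {S, k⁻¹ * g 1 * k} = ⊤ := by
    have h : (Subgroup.closure (Set.range g)).map (MulAut.conj k⁻¹).toMonoidHom = ⊤ := by
      rw [hg, ← MonoidHom.range_eq_map]
      exact MonoidHom.range_eq_top.2 (MulAut.conj k⁻¹).surjective
    rw [MonoidHom.map_closure, ← Set.range_comp] at h
    rw [← h]
    congr 1
    ext γ
    have e0 : k⁻¹ * g 0 * k = S := by rw [hk]; group
    simp [Fin.exists_fin_two, e0, eq_comm]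
  obtain ⟨h, h0, h1⟩ := eq_U_of_closure hA hcl
  refine ⟨k * h, ?_, ?_⟩
  · rw [hk]
    nth_rw 1 [h0]
    group
  · have e1 : g 1 = k * (k⁻¹ * g 1 * k) * k⁻¹ := by group
    rcases h1 with h1 | h1
    · left; rw [e1, h1]; group
    · right; rw [e1, h1]; group

/-! ### Invariants of conjugacy classes -/

theorem isScalar_cls {a b c d : ℤ} : IsScalar (cls !![a, b; c, d]) ↔ b = 0 ∧ c = 0 ∧ a = d := by
  have h : ∀ k : ℤ, cls (Matrix.scalar (Fin 2) k) = cls !![k, 0; 0, k] := by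
    intro k
    congr 1
    ext i j
    fin_cases i <;> fin_cases j <;> rfl
  simp only [IsScalar, h, cls_entries_eq_iff]
  constructor
  · rintro ⟨k, ⟨h1, h2, h3, h4⟩ | ⟨h1, h2, h3, h4⟩⟩ <;> omega
  · rintro ⟨rfl, rfl, rfl⟩
    exact ⟨a, Or.inl ⟨rfl, rfl, rfl, rfl⟩⟩

theorem isScalar_conjEquiv (γ : Γ) {M : PMat} (h : IsScalar M) : conjEquiv γ M = M := by
  obtain ⟨a, b, c, d, rfl⟩ := exists_entries M
  obtain ⟨rfl, rfl, rfl⟩ := isScalar_cls.1 h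
  obtain ⟨p, q, r, s, hdet, hγ⟩ := exists_ofPSL_eq γ
  rw [conj_entries hγ, cls_entries_eq_iff]
  left
  refine ⟨?_, ?_, ?_, ?_⟩
  · linear_combination a * hdet
  · ring
  · ring
  · linear_combination a * hdet

theorem exists_entries_of_mem_conjClass {a b c d : ℤ} (hM : ¬IsScalar (cls !![a, b; c, d]))
    {N : PMat} (hN : N ∈ conjClass (cls !![a, b; c, d])) :
    ∃ a' b' c' d', N = cls !![a', b'; c', d'] ∧ a' + d' = a + d ∧ a' * d' - b' * c' = a * d - b * c ∧
      ¬(b' = 0 ∧ c' = 0 ∧ a' = d') := by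
  obtain ⟨γ, rfl⟩ := hN
  obtain ⟨p, q, r, s, hdet, hγ⟩ := exists_ofPSL_eq γ
  have hconj := conj_entries hγ a b c d
  rw [← conjEquiv_apply]
  refine ⟨_, _, _, _, hconj, ?_, ?_, ?_⟩
  · linear_combination (a + d) * hdet
  · linear_combination (a * d - b * c) * (p * s - q * r + 1) * hdet
  · rw [← isScalar_cls, ← hconj]
    intro hs
    have h2 := isScalar_conjEquiv γ⁻¹ hs
    rw [← conjEquiv_mul, inv_mul_cancel, conjEquiv_one] at h2
    rw [← h2] at hs
    exact hM hs

/-! ### The limit side -/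

/-- An integer whose sign tells on which side of the geodesic from `0` to `∞` the matrix `M` pushes
the points of `ℍ` which are far from its fixed points. -/
def classKey : PMat → ℤ :=
  Quotient.lift (s := signCon.toSetoid)
    (fun A : Matrix (Fin 2) (Fin 2) ℤ =>
      if A 0 1 * A 1 0 < 0 then (A 0 1 - A 1 0) * (A 1 1 - A 0 0)
      else if A 0 1 = 0 ∧ A 1 0 = 0 then (A 0 0 + A 1 1) * (A 0 0 - A 1 1)
      else (A 0 0 + A 1 1) * (A 0 1 + A 1 0)) (by
    rintro A B (rfl | rfl)
    · rfl
    · simp only [Matrix.neg_apply, neg_mul_neg, neg_eq_zero]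
      split_ifs <;> ring)

theorem classKey_cls (a b c d : ℤ) : classKey (cls !![a, b; c, d]) =
    if b * c < 0 then (b - c) * (d - a)
      else if b = 0 ∧ c = 0 then (a + d) * (a - d) else (a + d) * (b + c) := rfl

theorem classKey_conj_S (M : PMat) : classKey (conjEquiv S M) = -classKey M := by
  obtain ⟨a, b, c, d, rfl⟩ := exists_entries M
  have h : conjEquiv S (cls !![a, b; c, d]) = cls !![d, -c; -b, a] := by
    rw [conj_entries ofPSL_S, cls_entries_eq_iff]
    left
    refine ⟨?_, ?_, ?_, ?_⟩ <;> ring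
  rw [h, classKey_cls, classKey_cls, neg_mul_neg, mul_comm c b]
  by_cases h1 : b * c < 0
  · rw [if_pos h1, if_pos h1]; ring
  rw [if_neg h1, if_neg h1]
  by_cases h2 : b = 0 ∧ c = 0
  · rw [if_pos h2, if_pos (by omega)]; ring
  · rw [if_neg h2, if_neg (by omega)]; ring

/-- The contribution of a side of a triangle to the degree of a conjugacy class, in terms of the
values of the quadratic form of fixed points at the vectors of a superbase. -/
def sideVal (x w z : ℤ) : ℚ :=
  if 0 < x * w then hv ((x + w) * (x + w - z)) else if x = 0 ∧ w = 0 then hv z else hv (x - w)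

theorem hv_mul_left {t : ℤ} (ht : 0 < t) (k : ℤ) : hv (t * k) = hv k := by
  rcases lt_trichotomy k 0 with h | rfl | h
  · rw [hv_of_neg h, hv_of_neg (mul_neg_of_pos_of_neg ht h)]
  · rw [mul_zero]
  · rw [hv_of_pos h, hv_of_pos (mul_pos ht h)]

theorem hv_classKey {a b c d : ℤ} (ht : 0 < a + d) :
    hv (classKey (cls !![a, b; c, d])) = sideVal b (-c) (a + b - c - d) := by
  rw [classKey_cls, sideVal]
  simp only [mul_neg, neg_pos, neg_eq_zero]
  by_cases h1 : b * c < 0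
  · rw [if_pos h1, if_pos h1]; congr 1; ring
  rw [if_neg h1, if_neg h1]
  by_cases h2 : b = 0 ∧ c = 0
  · rw [if_pos h2, if_pos h2, hv_mul_left ht, h2.1, h2.2]; congr 1; ring
  · rw [if_neg h2, if_neg h2, hv_mul_left ht]; congr 1; ring

/-- One has `2 · offDiag 1 0 1 = t (b + c) + (d - a)(b - c)` and `(d - a)² = t² - 4n - 4bc`. If `bc
≥ 0` and `b`, `c` are not both zero, the first term dominates and is the key. If `bc < 0`, the
second dominates unless `(d - a)² ≤ t²`, which bounds all entries. Diagonal matrices are bounded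
outright. -/
theorem finite_hv_classKey_ne {n : ℕ} (hn : 1 ≤ n) (t : ℤ) :
    {M : PMat | ∃ a b c d, M = cls !![a, b; c, d] ∧ a + d = t ∧ a * d - b * c = n ∧
      ¬(b = 0 ∧ c = 0 ∧ a = d) ∧ hv (offDiag 1 0 1 M) ≠ hv (classKey M)}.Finite := by
  refine (finite_bounded (2 * t ^ 2 + 2 * n)).subset ?_
  rintro M ⟨a, b, c, d, rfl, ht, hdet, hns, hne⟩
  have hn' : (1 : ℤ) ≤ n := by exact_mod_cast hn
  have hle := mul_nonpos_of_hv_ne hne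
  rw [offDiag_cls, classKey_cls] at hle
  have e : 2 * (1 * a * c + 0 * (a * d + b * c) + 1 * b * d) = t * (b + c) + (d - a) * (b - c) := by
    rw [← ht]; ring
  have e2 : (d - a) ^ 2 = t ^ 2 - 4 * n - 4 * (b * c) := by rw [← ht, ← hdet]; ring
  have habs : ∀ u : ℤ, u ^ 2 ≤ (2 * t ^ 2 + 2 * n) → |u| ≤ 2 * t ^ 2 + 2 * n := fun u hu =>
    (abs_le_of_sq_add_sq_le (a := u) (b := 0) (by simpa using hu)).1
  generalize 1 * a * c + 0 * (a * d + b * c) + 1 * b * d = o at *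
  split_ifs at hle with h1 h2
  · have hda : (d - a) ^ 2 ≤ t ^ 2 := by
      by_contra hcon
      push Not at hcon
      have h3 : (b + c) ^ 2 < (b - c) ^ 2 := by nlinarith
      have h4 : (t * (b + c)) ^ 2 < ((d - a) * (b - c)) ^ 2 := by
        rw [mul_pow, mul_pow]
        have : 0 ≤ t ^ 2 := by positivity
        have : 0 ≤ (b + c) ^ 2 := by positivity
        nlinarith
      have h5 := sq_lt_sq.1 h4
      have h6 : 0 < (t * (b + c) + (d - a) * (b - c)) * ((d - a) * (b - c)) := by
        have h7 := abs_mul_abs_self ((d - a) * (b - c))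
        have h8 := neg_abs_le (t * (b + c) * ((d - a) * (b - c)))
        rw [abs_mul] at h8
        have h9 : 0 < |(d - a) * (b - c)| := lt_of_le_of_lt (abs_nonneg _) h5
        nlinarith
      rw [← e] at h6
      nlinarith
    have hbc : -(t ^ 2 + 2 * n) ≤ 2 * (b * c) := by nlinarith
    refine ⟨a, b, c, d, habs a ?_, ?_, ?_, habs d ?_, rfl⟩
    · have : a * 2 = t - (d - a) := by rw [← ht]; ring
      nlinarith [sq_nonneg (t + (d - a))]
    · rw [abs_le]
      rcases mul_neg_iff.1 h1 with ⟨hb, hc⟩ | ⟨hb, hc⟩ <;> constructor <;> nlinarith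
    · rw [abs_le]
      rcases mul_neg_iff.1 h1 with ⟨hb, hc⟩ | ⟨hb, hc⟩ <;> constructor <;> nlinarith
    · have : d * 2 = t + (d - a) := by rw [← ht]; ring
      nlinarith [sq_nonneg (t - (d - a))]
  · obtain ⟨rfl, rfl⟩ := h2
    have had : a ^ 2 + d ^ 2 ≤ 2 * t ^ 2 + 2 * n := by rw [← ht]; nlinarith [sq_nonneg (a + d)]
    obtain ⟨ha, hd⟩ := abs_le_of_sq_add_sq_le had
    have h0 : |(0 : ℤ)| ≤ 2 * t ^ 2 + 2 * n := by rw [abs_zero]; positivity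
    exact ⟨a, 0, 0, d, ha, h0, h0, hd, rfl⟩
  · exfalso
    push Not at h1
    have hbc0 : b + c ≠ 0 := by
      intro h
      have : c = -b := by linarith
      subst this
      have hb : b = 0 := by nlinarith
      exact h2 ⟨hb, by rw [hb, neg_zero]⟩
    have h3 : (b - c) ^ 2 ≤ (b + c) ^ 2 := by nlinarith
    have h4 : ((d - a) * (b - c)) ^ 2 < (t * (b + c)) ^ 2 := by
      rw [mul_pow, mul_pow]
      have h5 : (d - a) ^ 2 < t ^ 2 := by nlinarith
      have h6 : 0 < (b + c) ^ 2 := by positivity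
      have h7 : 0 ≤ (d - a) ^ 2 := by positivity
      nlinarith
    have h5 := sq_lt_sq.1 h4
    rw [ht] at hle
    have h6 : 0 < (t * (b + c) + (d - a) * (b - c)) * (t * (b + c)) := by
      have h7 := abs_mul_abs_self (t * (b + c))
      have h8 := neg_abs_le ((d - a) * (b - c) * (t * (b + c)))
      rw [abs_mul] at h8
      have h9 : 0 < |t * (b + c)| := lt_of_le_of_lt (abs_nonneg _) h5
      nlinarith
    rw [← e] at h6
    nlinarith

/-- The sum of the side contributions over a triangle. -/
def triVal (M : PMat) : ℚ :=
  hv (classKey M) + hv (classKey (conjEquiv U M)) + hv (classKey (conjEquiv U⁻¹ M)) - 2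

theorem offDiag_conjEquiv_S (M : PMat) :
    offDiag 1 0 1 (conjEquiv S M) = -offDiag 1 0 1 M := by
  rw [conjEquiv_apply, S_inv, offDiag_mul_S, offDiag_S_mul]

theorem offDiag_mul_U (M : PMat) : offDiag 2 1 2 (M * ofPSL U) = offDiag 2 1 2 M := by
  rw [← offDiag_mul_U_inv, ofPSL_mul_inv_cancel_right]

/-- The degree of a lift on a conjugacy class of non-scalar matrices, as a sum over triangles. -/
theorem deg_conjClass_liftElt {n : ℕ} (hn : 1 ≤ n) {M : PMat} (hM : det M = n)
    (hs : ¬IsScalar M) :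
    deg (conjClass M) (liftElt hn) = 1 / 3 * ∑ᶠ N, (conjClass M).indicator triVal N := by
  classical
  set X := conjClass M with hX
  have hXdet : ∀ N ∈ X, det N = n := by
    rintro N ⟨γ, rfl⟩
    rw [← conjEquiv_apply, det_conjEquiv, hM]
  have hmem : ∀ (γ : Γ) N, conjEquiv γ N ∈ X ↔ N ∈ X := fun γ N => conjEquiv_mem_conjClass γ
  -- Subtracting the Heaviside value of `classKey` makes each of the two terms summable over the
  -- class. The sum of `φ` vanishes by oddness under `S`; that of `ψ` cancels against its translates
  -- by `U` and `U⁻¹`.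
  let φ : PMat → ℚ := X.indicator fun N => hv (offDiag 1 0 1 N) - hv (classKey N)
  let ψ : PMat → ℚ := X.indicator fun N => hv (offDiag 2 1 2 N) - hv (classKey N)
  have hφ : φ.support.Finite := by
    obtain ⟨a, b, c, d, rfl⟩ := exists_entries M
    refine (finite_hv_classKey_ne hn (a + d)).subset fun N hN => ?_
    obtain ⟨hN1, hN2⟩ := Set.indicator_apply_ne_zero.1 hN
    obtain ⟨a', b', c', d', rfl, h1, h2, h3⟩ := exists_entries_of_mem_conjClass hs hN1
    refine ⟨a', b', c', d', rfl, h1, ?_, h3, sub_ne_zero.1 hN2⟩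
    rw [h2, ← det_cls, hM]
  have hψ : ψ.support.Finite := by
    refine (hφ.union (finite_hv_offDiag_ne hn (x := 2) (y := 1) (w := 2) (by norm_num)
      (by norm_num))).subset fun N hN => ?_
    obtain ⟨hN1, hN2⟩ := Set.indicator_apply_ne_zero.1 hN
    by_contra hcon
    rw [Set.mem_union, not_or] at hcon
    have h1 : hv (offDiag 1 0 1 N) - hv (classKey N) = 0 := by
      by_contra h
      exact hcon.1 (Set.indicator_apply_ne_zero.2 ⟨hN1, h⟩)
    have h2 : hv (offDiag 2 1 2 N) = hv (offDiag 1 0 1 N) := by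
      by_contra h
      exact hcon.2 ⟨hXdet N hN1, h⟩
    exact hN2 (by simp only [h2, h1])
  have hφ0 : ∑ᶠ N, φ N = 0 := by
    refine finsum_eq_zero_of_neg (conjEquiv S) fun N => ?_
    simp only [φ, Set.indicator_apply, hmem, offDiag_conjEquiv_S, classKey_conj_S, hv_neg]
    split_ifs <;> ring
  obtain ⟨h1, h2⟩ := finsum_add_comp_comp (conjEquiv U) (conjEquiv U⁻¹) hψ
  have hL : (X.indicator (liftElt hn).coeff).support.Finite := by
    refine (support_liftCoeff_finite hn).subset fun N hN => ?_
    exact (Set.indicator_apply_ne_zero.1 hN).2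
  have hpt : ∀ N, X.indicator triVal N = (3 * X.indicator (liftElt hn).coeff N + (-3) * φ N) +
      (3 * ψ N + (-1) * (ψ N + ψ (conjEquiv U N) + ψ (conjEquiv U⁻¹ N))) := by
    intro N
    simp only [φ, ψ, Set.indicator_apply, hmem]
    split_ifs with h
    · rw [coeff_liftElt, liftCoeff, if_pos (hXdet N h), chi, triVal]
      have e1 : offDiag 2 1 2 (conjEquiv U N) = offDiag 2 1 2 (ofPSL U * N) := by
        rw [conjEquiv_apply, offDiag_mul_U_inv]
      have e2 : offDiag 2 1 2 (conjEquiv U⁻¹ N) = offDiag 2 1 2 (ofPSL U⁻¹ * N) := by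
        rw [conjEquiv_apply, inv_inv, offDiag_mul_U]
      rw [e1, e2]
      ring
    · ring
  have hmul : ∀ {f : PMat → ℚ} (r : ℚ), f.support.Finite →
      (Function.support fun N => r * f N).Finite := by
    intro f r hf
    refine hf.subset fun N hN h0 => hN ?_
    simp only [h0, mul_zero]
  have hA : (Function.support fun N => 3 * X.indicator (liftElt hn).coeff N + (-3) * φ N).Finite :=
    ((hmul 3 hL).union (hmul (-3) hφ)).subset (Function.support_add _ _)
  have hB : (Function.support fun N =>
      3 * ψ N + (-1) * (ψ N + ψ (conjEquiv U N) + ψ (conjEquiv U⁻¹ N))).Finite :=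
    ((hmul 3 hψ).union (hmul (-1) h1)).subset (Function.support_add _ _)
  simp only [hpt]
  rw [finsum_add_distrib hA hB, finsum_add_distrib (hmul 3 hL) (hmul (-3) hφ),
    finsum_add_distrib (hmul 3 hψ) (hmul (-1) h1), ← mul_finsum, ← mul_finsum, ← mul_finsum,
    ← mul_finsum, h2, hφ0, deg_eq_finsum]
  ring

/-- The class has one element, whose rows form a reduced superbase for `(2 1; 1 2)` and are
orthogonal for the identity form: `1/3 + 1/2 - 1 = -1/6`. -/
theorem deg_conjClass_liftElt_of_isScalar {n : ℕ} (hn : 1 ≤ n) {M : PMat} (hM : det M = n)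
    (hs : IsScalar M) : deg (conjClass M) (liftElt hn) = -1 / 6 := by
  classical
  have hX : conjClass M = {M} := by
    ext N
    constructor
    · rintro ⟨γ, rfl⟩
      exact isScalar_conjEquiv γ hs
    · rintro rfl
      exact mem_conjClass_self _
  obtain ⟨a, b, c, d, rfl⟩ := exists_entries M
  rw [deg_eq_finsum, hX, finsum_eq_single _ _ (fun N hN =>
    Set.indicator_of_notMem (Set.notMem_singleton_iff.2 hN) _),
    Set.indicator_of_mem (Set.mem_singleton _), coeff_liftElt, liftCoeff, if_pos hM]
  obtain ⟨rfl, rfl, rfl⟩ := isScalar_cls.1 hs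
  rw [det_cls] at hM
  have ha : 0 < a ^ 2 := by
    have hn' : (1 : ℤ) ≤ n := by exact_mod_cast hn
    nlinarith
  rw [chi, offDiag_U_mul, offDiag_U_inv_mul, offDiag_cls, offDiag_cls,
    hv_of_pos (by nlinarith), hv_of_pos (by nlinarith), hv_of_pos (by nlinarith),
    show 1 * a * 0 + 0 * (a * a + 0 * 0) + 1 * 0 * a = 0 by ring, hv_zero]
  norm_num

/-! ### Degrees on classes of real discriminant -/

/-- The numbers `b`, `-c`, `a + b - c - d` are the values of the fixed-point form `b X² + (d - a) X
Y - c Y²` at `(1, 0)`, `(0, 1)`, `(1, -1)`; conjugation by `U` permutes them cyclically. -/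
theorem conjEquiv_U (a b c d : ℤ) :
    conjEquiv U (cls !![a, b; c, d]) = cls !![d - b, a + b - c - d; -b, a + b] := by
  rw [conj_entries ofPSL_U, cls_entries_eq_iff]
  left
  refine ⟨?_, ?_, ?_, ?_⟩ <;> ring

theorem conjEquiv_U_inv (a b c d : ℤ) :
    conjEquiv U⁻¹ (cls !![a, b; c, d]) = cls !![c + d, -c; -(a + b - c - d), a - c] := by
  rw [conj_entries ofPSL_U_inv, cls_entries_eq_iff]
  left
  refine ⟨?_, ?_, ?_, ?_⟩ <;> ring

theorem triVal_cls {a b c d : ℤ} (ht : 0 < a + d) :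
    triVal (cls !![a, b; c, d]) = sideVal b (-c) (a + b - c - d) +
      sideVal (a + b - c - d) b (-c) + sideVal (-c) (a + b - c - d) b - 2 := by
  rw [triVal, conjEquiv_U, conjEquiv_U_inv, hv_classKey ht, hv_classKey (by linarith),
    hv_classKey (by linarith), neg_neg, neg_neg,
    show d - b + (a + b - c - d) - -b - (a + b) = -c by ring,
    show c + d + -c - -(a + b - c - d) - (a - c) = b by ring]

section sideVal

variable {x w : ℤ} (z : ℤ)

theorem sideVal_of_pos (hx : 0 < x) (hw : 0 < w) : sideVal x w z = hv (x + w - z) := by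
  rw [sideVal, if_pos (mul_pos hx hw), hv_mul_left (by omega)]

theorem sideVal_of_neg (hx : x < 0) (hw : w < 0) : sideVal x w z = hv (z - x - w) := by
  rw [sideVal, if_pos (mul_pos_of_neg_of_neg hx hw), ← hv_mul_left (t := -(x + w)) (by omega) (z - x - w)]
  congr 1
  ring

theorem sideVal_of_gt (hx : 0 ≤ x) (hw : w ≤ 0) (h : w < x) : sideVal x w z = 1 := by
  rw [sideVal, if_neg (not_lt.2 (mul_nonpos_of_nonneg_of_nonpos hx hw)), if_neg (by omega),
    hv_of_pos (by omega)]

theorem sideVal_of_lt (hx : x ≤ 0) (hw : 0 ≤ w) (h : x < w) : sideVal x w z = 0 := by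
  rw [sideVal, if_neg (not_lt.2 (mul_nonpos_of_nonpos_of_nonneg hx hw)), if_neg (by omega),
    hv_of_neg (by omega)]

theorem sideVal_zero : sideVal 0 0 z = hv z := by simp [sideVal]

end sideVal

/-- The correction term of `sideVal_add`. -/
def edgeVal (x w z : ℤ) : ℚ := if w = 0 ∧ x < 0 ∧ 0 ≤ z then 1 else 0

theorem sum_hv_eq_zero {p q r : ℤ} (h1 : 0 < p + q) (h2 : 0 < p + r) (h3 : 0 < q + r)
    (h : p * q + p * r + q * r ≤ 0) : hv p + hv q + hv r - 2 = 0 := by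
  rcases sum_hv h1 h2 h3 with ⟨-, hp, hq, hr⟩ | ⟨-, hp, hq, hr⟩ | ⟨h, -⟩
  · nlinarith [mul_pos hp hq, mul_pos hp hr, mul_pos hq hr]
  · exfalso
    have h4 := mul_nonneg hp hq
    have h5 := mul_nonneg hp hr
    have h6 := mul_nonneg hq hr
    have e1 : p * q = 0 := by linarith
    have e2 : p * r = 0 := by linarith
    have e3 : q * r = 0 := by linarith
    rcases mul_eq_zero.1 e1 with rfl | rfl
    · rcases mul_eq_zero.1 e3 with rfl | rfl <;> omega
    · rcases mul_eq_zero.1 e2 with rfl | rfl <;> omega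
  · exact h

/-- If the three values have the same strict sign, the second symmetric function of the Heaviside
arguments is minus the discriminant, hence not positive, and `sum_hv_eq_zero` applies. Otherwise the
side values follow from the signs, and the count fails to balance only when an isotropic vector,
that is, a fixed cusp, is present. -/
theorem sideVal_add {x w z : ℤ} (hD : 0 ≤ (x + w - z) ^ 2 - 4 * (x * w))
    (hne : ¬(x = 0 ∧ w = 0 ∧ z = 0)) :
    sideVal x w z + sideVal z x w + sideVal w z x - 2 =
      -(edgeVal x w z + edgeVal z x w + edgeVal w z x) := by
  rcases lt_trichotomy x 0 with hx | rfl | hx <;> rcases lt_trichotomy w 0 with hw | rfl | hw <;>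
    rcases lt_trichotomy z 0 with hz | rfl | hz
  case inl.inl.inl =>
    rw [sideVal_of_neg z hx hw, sideVal_of_neg w hz hx, sideVal_of_neg x hw hz, edgeVal, edgeVal,
      edgeVal, if_neg (by omega), if_neg (by omega), if_neg (by omega),
      sum_hv_eq_zero (by omega) (by omega) (by omega) (by nlinarith)]
    norm_num
  case inr.inr.inr.inr.inr.inr =>
    rw [sideVal_of_pos z hx hw, sideVal_of_pos w hz hx, sideVal_of_pos x hw hz, edgeVal, edgeVal,
      edgeVal, if_neg (by omega), if_neg (by omega), if_neg (by omega),
      sum_hv_eq_zero (by omega) (by omega) (by omega) (by nlinarith)]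
    norm_num
  all_goals
    first
    | exact (hne ⟨rfl, rfl, rfl⟩).elim
    | (simp (disch := omega) only [sideVal_of_pos, sideVal_of_neg, sideVal_of_gt, sideVal_of_lt,
        sideVal_zero, edgeVal, hv_of_pos, hv_of_neg, if_neg]
       norm_num <;> omega)

/-- Upper triangular matrices with attracting fixed point `∞` whose other fixed point lies in
`(0, 1]`. -/
def edgeSet : Set PMat :=
  {N | ∃ a b d : ℤ, N = cls !![a, b; 0, d] ∧ 0 < a + d ∧ b < 0 ∧ d ≤ a + b}

theorem mem_edgeSet {a b c d : ℤ} (ht : 0 < a + d) :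
    cls !![a, b; c, d] ∈ edgeSet ↔ -c = 0 ∧ b < 0 ∧ 0 ≤ a + b - c - d := by
  constructor
  · rintro ⟨a', b', d', h, h1, h2, h3⟩
    rcases cls_entries_eq_iff.1 h with ⟨rfl, rfl, rfl, rfl⟩ | ⟨rfl, rfl, rfl, rfl⟩ <;> omega
  · rintro ⟨h1, h2, h3⟩
    obtain rfl : c = 0 := by omega
    exact ⟨a, b, d, rfl, ht, h2, by omega⟩

theorem indicator_edgeSet {a b c d : ℤ} (ht : 0 < a + d) :
    edgeSet.indicator 1 (cls !![a, b; c, d]) = edgeVal b (-c) (a + b - c - d) := by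
  classical
  rw [Set.indicator_apply, edgeVal]
  simp only [mem_edgeSet ht, Pi.one_apply]

theorem triVal_of_disc_nonneg {a b c d : ℤ} (ht : 0 < a + d) (hD : 0 ≤ (a - d) ^ 2 + 4 * (b * c))
    (hs : ¬IsScalar (cls !![a, b; c, d])) :
    triVal (cls !![a, b; c, d]) = -(edgeSet.indicator (1 : PMat → ℚ) (cls !![a, b; c, d]) +
      edgeSet.indicator 1 (conjEquiv U (cls !![a, b; c, d])) +
      edgeSet.indicator 1 (conjEquiv U⁻¹ (cls !![a, b; c, d]))) := by
  rw [triVal_cls ht, sideVal_add, indicator_edgeSet ht, conjEquiv_U, conjEquiv_U_inv,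
    indicator_edgeSet (by linarith), indicator_edgeSet (by linarith), neg_neg, neg_neg,
    show d - b + (a + b - c - d) - -b - (a + b) = -c by ring,
    show c + d + -c - -(a + b - c - d) - (a - c) = b by ring]
  · nlinarith
  · rw [isScalar_cls] at hs
    omega

theorem exists_entries_pos {M : PMat} (hM : ∃ a b c d, M = cls !![a, b; c, d] ∧ a + d ≠ 0) :
    ∃ a b c d, M = cls !![a, b; c, d] ∧ 0 < a + d := by
  obtain ⟨a, b, c, d, rfl, h⟩ := hM
  rcases h.lt_or_gt with h | h
  · exact ⟨-a, -b, -c, -d, (cls_neg a b c d).symm, by omega⟩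
  · exact ⟨a, b, c, d, rfl, h⟩

/-- A conjugating element that fixes `∞` is a translation, and the second fixed point is confined to
an interval of length one. One that does not fix `∞` would exchange the eigenvalues `a` and `d`,
although `a > d` on both sides. -/
theorem subsingleton_edgeSet (M : PMat) : (conjClass M ∩ edgeSet).Subsingleton := by
  rintro N₁ ⟨⟨γ₁, rfl⟩, hN₁⟩ N₂ ⟨⟨γ₂, rfl⟩, hN₂⟩
  rw [← conjEquiv_apply] at hN₁ hN₂ ⊢
  rw [← conjEquiv_apply]
  have h : conjEquiv γ₂ M = conjEquiv (γ₂ * γ₁⁻¹) (conjEquiv γ₁ M) := by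
    rw [← conjEquiv_mul, inv_mul_cancel_right]
  rw [h] at hN₂ ⊢
  generalize γ₂ * γ₁⁻¹ = δ at *
  obtain ⟨a, b, d, hN, ht, hb, hd⟩ := hN₁
  obtain ⟨p, q, r, s, hdet, hδ⟩ := exists_ofPSL_eq δ
  rw [hN, conj_entries hδ] at hN₂ ⊢
  obtain ⟨a', b', d', hN', ht', hb', hd'⟩ := hN₂
  rw [hN']
  rcases cls_entries_eq_iff.1 hN' with ⟨h1, h2, h3, h4⟩ | ⟨h1, h2, h3, h4⟩
  · have h5 : r * (s * (a - d) - r * b) = 0 := by linear_combination h3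
    rcases mul_eq_zero.1 h5 with rfl | h6
    · have ha : a' = a := by linear_combination a * hdet - h1
      have hd2 : d' = d := by linear_combination d * hdet - h4
      have hb2 : b' = b - p * q * (a - d) := by
        rw [← h2]
        have hps : p * s = 1 := by linarith
        have hpp : p * p = 1 := by
          rcases Int.mul_eq_one_iff_eq_one_or_neg_one.1 hps with ⟨rfl, rfl⟩ | ⟨rfl, rfl⟩ <;> rfl
        linear_combination b * hpp
      subst ha hd2
      have hpq : p * q = 0 := by
        by_contra hne
        rcases Ne.lt_or_gt hne with h | h <;> nlinarith
      rw [hpq] at hb2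
      rw [hb2, zero_mul, sub_zero]
    · exfalso
      have ha : a' = d := by linear_combination d * hdet - h1 + p * h6
      have hd : d' = a := by linear_combination a * hdet - h4 - p * h6
      omega
  · exfalso
    have : a' + d' = -(a + d) := by linear_combination (-a - d) * hdet + h1 + h4
    omega

theorem deg_eq_neg_finsum_edgeSet {n : ℕ} (hn : 1 ≤ n) {a b c d : ℤ}
    (hM : a * d - b * c = n) (hD : 0 ≤ (a - d) ^ 2 + 4 * (b * c))
    (hs : ¬IsScalar (cls !![a, b; c, d])) :
    deg (conjClass (cls !![a, b; c, d])) (liftElt hn) =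
      -∑ᶠ N, (conjClass (cls !![a, b; c, d]) ∩ edgeSet).indicator (1 : PMat → ℚ) N := by
  classical
  set X := conjClass (cls !![a, b; c, d]) with hX
  have hn' : (1 : ℤ) ≤ n := by exact_mod_cast hn
  have ht : a + d ≠ 0 := by
    intro h
    obtain rfl : d = -a := by linarith
    nlinarith
  let f : PMat → ℚ := (X ∩ edgeSet).indicator 1
  have hf : f.support.Finite := by
    refine (subsingleton_edgeSet (cls !![a, b; c, d])).finite.subset ?_
    exact Set.support_indicator_subset
  obtain ⟨h1, h2⟩ := finsum_add_comp_comp (conjEquiv U) (conjEquiv U⁻¹) hf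
  have hpt : ∀ N, X.indicator triVal N = -1 * (f N + f (conjEquiv U N) + f (conjEquiv U⁻¹ N)) := by
    intro N
    have hmem : ∀ γ : Γ, conjEquiv γ N ∈ X ↔ N ∈ X := fun γ => conjEquiv_mem_conjClass γ
    by_cases hN : N ∈ X
    · obtain ⟨a', b', c', d', rfl, e1, e2, e3⟩ := exists_entries_of_mem_conjClass hs hN
      obtain ⟨a'', b'', c'', d'', h3, ht2⟩ := exists_entries_pos ⟨a', b', c', d', rfl, e1 ▸ ht⟩
      rw [← isScalar_cls] at e3
      have hD2 : 0 ≤ (a'' - d'') ^ 2 + 4 * (b'' * c'') := by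
        rcases cls_entries_eq_iff.1 h3 with ⟨rfl, rfl, rfl, rfl⟩ | ⟨rfl, rfl, rfl, rfl⟩ <;> nlinarith
      rw [h3] at e3 hN hmem ⊢
      rw [Set.indicator_of_mem hN, triVal_of_disc_nonneg ht2 hD2 e3]
      simp only [f, Set.indicator_apply, Set.mem_inter_iff, hmem, hN, true_and]
      ring
    · rw [Set.indicator_of_notMem hN]
      simp only [f, Set.indicator_apply, Set.mem_inter_iff, hmem, hN, false_and, if_false]
      norm_num
  have hM' : det (cls !![a, b; c, d]) = n := by rw [det_cls, hM]
  rw [deg_conjClass_liftElt hn hM' hs, ← hX]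
  simp only [hpt]
  rw [← mul_finsum, h2]
  ring

theorem disc_of_mem_edgeSet {a b c d : ℤ} (hs : ¬IsScalar (cls !![a, b; c, d])) {N : PMat}
    (hN : N ∈ conjClass (cls !![a, b; c, d]) ∩ edgeSet) :
    ∃ k : ℤ, k ≠ 0 ∧ (a - d) ^ 2 + 4 * (b * c) = k ^ 2 := by
  obtain ⟨hN1, a', b', d', rfl, h1, h2, h3⟩ := hN
  obtain ⟨a'', b'', c'', d'', h4, h5, h6, h7⟩ := exists_entries_of_mem_conjClass hs hN1
  refine ⟨a' - d', by omega, ?_⟩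
  have e : (a - d) ^ 2 + 4 * (b * c) = (a + d) ^ 2 - 4 * (a * d - b * c) := by ring
  rw [e, ← h5, ← h6]
  rcases cls_entries_eq_iff.1 h4 with ⟨rfl, rfl, rfl, rfl⟩ | ⟨rfl, h, h', rfl⟩
  · ring
  · obtain rfl : c'' = 0 := by omega
    ring

theorem deg_conjClass_of_not_square {n : ℕ} (hn : 1 ≤ n) {a b c d : ℤ}
    (hM : a * d - b * c = n) (hD : 0 ≤ (a - d) ^ 2 + 4 * (b * c))
    (hs : ¬IsScalar (cls !![a, b; c, d]))
    (hk : ¬∃ k : ℤ, k ≠ 0 ∧ (a - d) ^ 2 + 4 * (b * c) = k ^ 2) :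
    deg (conjClass (cls !![a, b; c, d])) (liftElt hn) = 0 := by
  rw [deg_eq_neg_finsum_edgeSet hn hM hD hs,
    Set.eq_empty_of_forall_notMem fun N hN => hk (disc_of_mem_edgeSet hs hN)]
  simp

/-- When the discriminant is a square the larger eigenvalue `l` is integral. A primitive eigenvector
for `l` is moved to `(1, 0)`, which makes the matrix upper triangular, and a translation normalizes
the remaining entry. -/
theorem exists_mem_edgeSet {a b c d k : ℤ} (ht : 0 < a + d) (hk : 0 < k)
    (hD : (a - d) ^ 2 + 4 * (b * c) = k ^ 2) :
    ∃ N, N ∈ conjClass (cls !![a, b; c, d]) ∩ edgeSet := by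
  obtain ⟨l, hl⟩ : ∃ l, a + d + k = 2 * l := by
    have h : Even ((a + d + k) * (a + d - k)) :=
      ⟨2 * (a * d - b * c), by linear_combination hD⟩
    obtain ⟨l, h⟩ | ⟨l, h⟩ := Int.even_mul.1 h
    · exact ⟨l, by omega⟩
    · exact ⟨l + k, by omega⟩
  have hchar : (l - a) * (l - d) = b * c := by
    have : k = 2 * l - a - d := by linarith
    rw [this] at hD
    linarith
  obtain ⟨u, v, huv, hu, hv⟩ : ∃ u v : ℤ, ¬(u = 0 ∧ v = 0) ∧ a * u + b * v = l * u ∧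
      c * u + d * v = l * v := by
    by_cases h : b = 0 ∧ l - a = 0
    · refine ⟨l - d, c, by omega, ?_, ?_⟩
      · linear_combination -hchar
      · ring
    · refine ⟨b, l - a, h, ?_, ?_⟩
      · ring
      · linear_combination -hchar
  obtain ⟨u', v', hg, hu', hv'⟩ := Int.exists_gcd_one (m := u) (n := v) (by
    rw [Int.gcd_pos_iff]; omega)
  have hg0 : ((Int.gcd u v : ℕ) : ℤ) ≠ 0 := by
    intro h
    rw [h] at hu' hv'
    exact huv ⟨by rw [hu', mul_zero], by rw [hv', mul_zero]⟩
  generalize ((Int.gcd u v : ℕ) : ℤ) = e at *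
  have hu2 : a * u' + b * v' = l * u' := by
    apply mul_right_cancel₀ hg0
    rw [hu', hv'] at hu
    linear_combination hu
  have hv2 : c * u' + d * v' = l * v' := by
    apply mul_right_cancel₀ hg0
    rw [hu', hv'] at hv
    linear_combination hv
  obtain ⟨α, β, hαβ⟩ := Int.isCoprime_iff_gcd_eq_one.2 hg
  obtain ⟨δ, hδ⟩ := exists_ofPSL (a := α) (b := β) (c := -v') (d := u') (by linarith)
  obtain ⟨B, hB⟩ : ∃ B, conjEquiv δ (cls !![a, b; c, d]) = cls !![l, B; 0, l - k] := by
    refine ⟨α * (α * b + β * d) - β * (α * a + β * c), ?_⟩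
    rw [conj_entries hδ, cls_entries_eq_iff]
    left
    refine ⟨?_, rfl, ?_, ?_⟩
    · linear_combination α * hu2 + β * hv2 + l * hαβ
    · linear_combination u' * hv2 - v' * hu2
    · linear_combination (a + d) * hαβ - α * hu2 - β * hv2 - l * hαβ + hl
  -- The `+ 1` places the upper right entry in `[-k, -1]` rather than `[0, k - 1]`, as `edgeSet`
  -- demands.
  obtain ⟨τ, hτ⟩ := exists_ofPSL (a := 1) (b := B / k + 1) (c := 0) (d := 1) (by ring)
  refine ⟨conjEquiv (τ * δ) (cls !![a, b; c, d]), ⟨_, rfl⟩, ?_⟩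
  refine ⟨l, B % k - k, l - k, ?_, by linarith, by linarith [Int.emod_lt_of_pos B hk],
    by linarith [Int.emod_nonneg B hk.ne']⟩
  rw [conjEquiv_mul, hB, conj_entries hτ, cls_entries_eq_iff]
  left
  refine ⟨by ring, ?_, by ring, by ring⟩
  linear_combination -Int.emod_add_mul_ediv B k

theorem deg_conjClass_of_square {n : ℕ} (hn : 1 ≤ n) {a b c d k : ℤ}
    (hM : a * d - b * c = n) (hk : k ≠ 0) (hD : (a - d) ^ 2 + 4 * (b * c) = k ^ 2)
    (hs : ¬IsScalar (cls !![a, b; c, d])) :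
    deg (conjClass (cls !![a, b; c, d])) (liftElt hn) = -1 := by
  obtain ⟨N, hN⟩ : ∃ N, N ∈ conjClass (cls !![a, b; c, d]) ∩ edgeSet := by
    have hn' : (1 : ℤ) ≤ n := by exact_mod_cast hn
    have hk2 : 0 < |k| := abs_pos.2 hk
    have ht : a + d ≠ 0 := by
      intro h
      obtain rfl : d = -a := by linarith
      nlinarith
    obtain ⟨a', b', c', d', h, h2⟩ := exists_entries_pos ⟨a, b, c, d, rfl, ht⟩
    rw [h]
    refine exists_mem_edgeSet h2 hk2 ?_
    rw [sq_abs, ← hD]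
    rcases cls_entries_eq_iff.1 h with ⟨rfl, rfl, rfl, rfl⟩ | ⟨rfl, rfl, rfl, rfl⟩ <;> ring
  rw [deg_eq_neg_finsum_edgeSet hn hM (by rw [hD]; positivity) hs,
    (subsingleton_edgeSet (cls !![a, b; c, d])).eq_singleton_of_mem hN,
    finsum_eq_single _ N fun P hP => Set.indicator_of_notMem (Set.notMem_singleton_iff.2 hP) _,
    Set.indicator_of_mem (Set.mem_singleton N)]
  rfl

/-! ### Degrees on classes of negative discriminant -/

theorem mem_centralizer_iff {γ : Γ} {M : PMat} : γ ∈ centralizer M ↔ conjEquiv γ M = M := by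
  rw [conjEquiv_apply]
  constructor
  · intro h
    have h' : ofPSL γ * M = M * ofPSL γ := h
    rw [h', ofPSL_mul_inv_cancel_right]
  · intro h
    change ofPSL γ * M = M * ofPSL γ
    conv_rhs => rw [← h]
    rw [ofPSL_inv_mul_cancel_right]

theorem conjEquiv_eq_iff {γ δ : Γ} {M : PMat} :
    conjEquiv γ M = conjEquiv δ M ↔ δ⁻¹ * γ ∈ centralizer M := by
  rw [mem_centralizer_iff, conjEquiv_mul]
  constructor
  · intro h
    rw [h, ← conjEquiv_mul, inv_mul_cancel, conjEquiv_one]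
  · intro h
    conv_rhs => rw [← h, ← conjEquiv_mul, mul_inv_cancel, conjEquiv_one]

/-- Summation over a conjugacy class by means of a summation over `Γ`. -/
theorem finsum_conjEquiv {M : PMat} {F : PMat → ℚ}
    (hF : (Function.support fun γ : Γ => F (conjEquiv γ M)).Finite)
    (h0 : ∃ γ : Γ, F (conjEquiv γ M) ≠ 0) :
    Finite (centralizer M) ∧ ∑ᶠ γ : Γ, F (conjEquiv γ M) =
      Nat.card (centralizer M) * ∑ᶠ N, (conjClass M).indicator F N := by
  classical
  obtain ⟨γ₀, h0⟩ := h0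
  have hfin : Finite (centralizer M) := by
    have := hF.to_subtype
    have hmem : ∀ γ : centralizer M, F (conjEquiv (γ₀ * γ) M) ≠ 0 := by
      intro γ
      rw [conjEquiv_mul, mem_centralizer_iff.1 γ.2]
      exact h0
    refine Finite.of_injective (fun γ : centralizer M =>
      (⟨γ₀ * γ, hmem γ⟩ : Function.support fun γ : Γ => F (conjEquiv γ M))) fun γ δ h => ?_
    exact Subtype.ext (mul_left_cancel (congrArg Subtype.val h))
  refine ⟨hfin, ?_⟩
  set s := hF.toFinset with hs
  have h1 : ∑ᶠ γ : Γ, F (conjEquiv γ M) = ∑ γ ∈ s, F (conjEquiv γ M) :=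
    finsum_eq_sum _ hF
  have h2 : ∑ᶠ N, (conjClass M).indicator F N = ∑ N ∈ s.image (conjEquiv · M), F N := by
    rw [finsum_eq_sum_of_support_subset (s := s.image (conjEquiv · M))]
    · refine Finset.sum_congr rfl fun N hN => ?_
      obtain ⟨γ, -, rfl⟩ := Finset.mem_image.1 hN
      exact Set.indicator_of_mem (mem_conjClass.2 ⟨γ, rfl⟩) F
    · intro N hN
      obtain ⟨⟨γ, rfl⟩, h⟩ := Set.indicator_apply_ne_zero.1 hN
      exact Finset.mem_coe.2 (Finset.mem_image.2 ⟨γ, hF.mem_toFinset.2 h, rfl⟩)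
  rw [h1, h2, Finset.sum_comp F (conjEquiv · M), Finset.mul_sum]
  refine Finset.sum_congr rfl fun N hN => ?_
  obtain ⟨δ, hδ, rfl⟩ := Finset.mem_image.1 hN
  rw [nsmul_eq_mul]
  congr 2
  rw [← Nat.card_eq_finsetCard]
  have hFδ : F (conjEquiv δ M) ≠ 0 := hF.mem_toFinset.1 hδ
  -- The fibre over `δ M δ⁻¹` is the coset `δ Γ_M`, and it lies wholly in the support because `F`
  -- depends only on the conjugate.
  refine Nat.card_congr ?_
  exact
    { toFun := fun γ => ⟨δ⁻¹ * γ.1, conjEquiv_eq_iff.1 (Finset.mem_filter.1 γ.2).2⟩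
      invFun := fun γ => ⟨δ * γ.1, by
        have h : conjEquiv (δ * γ.1) M = conjEquiv δ M := by
          rw [conjEquiv_mul, mem_centralizer_iff.1 γ.2]
        refine Finset.mem_filter.2 ⟨hF.mem_toFinset.2 ?_, h⟩
        rw [Function.mem_support, h]
        exact hFδ⟩
      left_inv := fun γ => Subtype.ext (mul_inv_cancel_left _ _)
      right_inv := fun γ => Subtype.ext (inv_mul_cancel_left _ _) }

/-- For negative discriminant and `b > 0` the fixed-point form is positive definite. All three keys
fall under the first case of `classKey`, and each is a positive factor times a Selling parameter of
the doubled form. -/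
theorem triVal_eq_chi {a b c d : ℤ} (hb : 0 < b) (hD : (a - d) ^ 2 + 4 * (b * c) < 0) :
    triVal (cls !![a, b; c, d]) = chi (2 * b) (d - a) (-2 * c) 1 := by
  have hc : c < 0 := by
    by_contra h
    push Not at h
    nlinarith [mul_nonneg hb.le h, sq_nonneg (a - d)]
  have hz : 0 < a + b - c - d := by
    by_contra h
    push Not at h
    nlinarith [sq_nonneg (b + c), sq_nonneg (a - d), mul_nonneg (sub_nonneg.2 h) (sub_nonneg.2 (hc.le.trans hb.le))]
  rw [← ofPSL.map_one, ofPSL_one, chi, offDiag_U_mul, offDiag_U_inv_mul, offDiag_cls, triVal,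
    conjEquiv_U, conjEquiv_U_inv, classKey_cls, classKey_cls, classKey_cls,
    if_pos (by nlinarith), if_pos (by nlinarith), if_pos (by nlinarith), hv_mul_left (by linarith),
    hv_mul_left (by linarith), hv_mul_left (by linarith)]
  ring_nf

theorem triVal_conjEquiv {a b c d : ℤ} (hb : 0 < b) (hD : (a - d) ^ 2 + 4 * (b * c) < 0) (γ : Γ) :
    triVal (conjEquiv γ (cls !![a, b; c, d])) = chi (2 * b) (d - a) (-2 * c) (ofPSL γ) := by
  obtain ⟨p, q, r, s, hdet, hγ⟩ := exists_ofPSL_eq γ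
  rw [conj_entries hγ, hγ, ← one_mul (cls !![p, q; r, s]), chi_mul_cls, triVal_eq_chi]
  · congr 1 <;> ring
  · have h := form_pos (x := 2 * b) (y := d - a) (w := -2 * c) (a := p) (b := q) (by linarith)
      (by nlinarith) (by rintro ⟨rfl, rfl⟩; simp at hdet)
    nlinarith
  · have e : ((a - d) ^ 2 + 4 * (b * c)) * (p * s - q * r) ^ 2 < 0 := by
      rw [hdet]; linarith
    linarith

theorem deg_conjClass_of_disc_neg {n : ℕ} (hn : 1 ≤ n) {a b c d : ℤ} (hM : a * d - b * c = n)
    (hD : (a - d) ^ 2 + 4 * (b * c) < 0) :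
    Finite (centralizer (cls !![a, b; c, d])) ∧
      deg (conjClass (cls !![a, b; c, d])) (liftElt hn) =
        1 / (Nat.card (centralizer (cls !![a, b; c, d])) : ℚ) := by
  -- Replacing the matrix by its negative makes the fixed-point form positive definite.
  wlog hb : 0 < b generalizing a b c d
  · rw [← cls_neg]
    refine this (by linarith) (by linarith) ?_
    have : b ≠ 0 := by
      rintro rfl
      nlinarith [sq_nonneg (a - d)]
    omega
  have hs : ¬IsScalar (cls !![a, b; c, d]) := by
    rw [isScalar_cls]
    omega
  have hx : 0 < 2 * b := by linarith
  have hD' : 0 < 2 * b * (-2 * c) - (d - a) ^ 2 := by nlinarith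
  obtain ⟨h1, h2⟩ := finsum_chi hx hD'
  simp only [← triVal_conjEquiv hb hD] at h1 h2
  have h0 : ∃ γ : Γ, triVal (conjEquiv γ (cls !![a, b; c, d])) ≠ 0 := by
    by_contra hcon
    push Not at hcon
    simp only [hcon, finsum_zero] at h2
    norm_num at h2
  obtain ⟨h3, h4⟩ := finsum_conjEquiv h1 h0
  refine ⟨h3, ?_⟩
  rw [deg_conjClass_liftElt hn (by rw [det_cls, hM]) hs]
  have h5 : (Nat.card (centralizer (cls !![a, b; c, d])) : ℚ) ≠ 0 :=
    Nat.cast_ne_zero.2 Nat.card_pos.ne'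
  rw [h2] at h4
  field_simp
  linarith

/-! ### Centralizers for positive discriminants -/

theorem centralizer_eq_bot {a b c d k : ℤ} (ht : a + d ≠ 0) (hk : k ≠ 0)
    (hD : (a - d) ^ 2 + 4 * (b * c) = k ^ 2) : centralizer (cls !![a, b; c, d]) = ⊥ := by
  rw [eq_bot_iff]
  intro γ hγ
  obtain ⟨p, q, r, s, hdet, h⟩ := exists_ofPSL_eq γ
  have hγ' : ofPSL γ * cls !![a, b; c, d] = cls !![a, b; c, d] * ofPSL γ := hγ
  rw [h, cls_mul_cls, cls_mul_cls, cls_entries_eq_iff] at hγ'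
  rcases hγ' with ⟨h1, h2, h3, h4⟩ | ⟨h1, h2, h3, h4⟩
  · have key : ∀ {x y : ℤ}, x ≠ 0 → x ^ 2 * ((p - s) ^ 2 + 4 * (q * r)) = (y * k) ^ 2 → y = 0 := by
      intro x y hx hxy
      obtain ⟨e, he⟩ : x ∣ y * k := by
        rw [← Int.pow_dvd_pow_iff two_ne_zero]
        exact ⟨_, hxy.symm⟩
      rw [he, mul_pow] at hxy
      have h5 := mul_left_cancel₀ (pow_ne_zero 2 hx) hxy
      have h6 : (p + s) ^ 2 = e ^ 2 + 4 := by linear_combination h5 + 4 * hdet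
      have h7 : e = 0 := by
        have h8 : |e| < |p + s| := sq_lt_sq.1 (by linarith)
        rw [← sq_abs (p + s), ← sq_abs e] at h6
        have h9 : |e| ≤ 1 := by nlinarith [abs_nonneg e]
        have h10 : |e| = 0 ∨ |e| = 1 := by have := abs_nonneg e; omega
        rcases h10 with h10 | h10
        · exact abs_eq_zero.1 h10
        · exfalso
          rw [h10] at h6 h8
          have : |p + s| ≤ 2 := by nlinarith
          have : |p + s| = 2 := by omega
          rw [this] at h6
          norm_num at h6
      rw [h7, mul_zero] at he
      exact (mul_eq_zero.1 he).resolve_right hk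
    have hb : b ≠ 0 → q = 0 := fun hb => key hb (by
      rw [mul_pow, ← hD]
      linear_combination (b * (p - s) + (a - d) * q) * h2 - 4 * b * q * h1)
    have hc : c ≠ 0 → r = 0 := fun hc => key hc (by
      rw [mul_pow, ← hD]
      linear_combination -(c * (p - s) + (a - d) * r) * h3 + 4 * c * r * h1)
    have hqr : q = 0 ∧ r = 0 := by
      by_cases hb0 : b = 0
      · by_cases hc0 : c = 0
        · have had : a - d ≠ 0 := by
            intro h5
            rw [h5, hb0] at hD
            exact hk (pow_eq_zero_iff two_ne_zero |>.1 (by linarith))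
          constructor <;> apply mul_left_cancel₀ had
          · linear_combination -h2 + (p - s) * hb0
          · linear_combination h3 + (p - s) * hc0
        · have hr := hc hc0
          exact ⟨mul_left_cancel₀ hc0 (by linear_combination h1 + b * hr), hr⟩
      · have hq := hb hb0
        exact ⟨hq, mul_left_cancel₀ hb0 (by linear_combination -h1 + c * hq)⟩
    obtain ⟨rfl, rfl⟩ := hqr
    rw [Subgroup.mem_bot]
    apply ofPSL_injective
    rw [h, ofPSL_one, cls_entries_eq_iff]
    have hps : p * s = 1 := by linarith
    rcases Int.mul_eq_one_iff_eq_one_or_neg_one.1 hps with ⟨rfl, rfl⟩ | ⟨rfl, rfl⟩ <;> simp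
  · exfalso
    have h5 : 2 * (a + d) = 0 := by
      linear_combination s * h1 - r * h2 - q * h3 + p * h4 - (2 * a + 2 * d) * hdet
    omega

/-- A matrix with infinitely many units of the order that it generates has infinite centralizer. -/
theorem infinite_centralizer {a b c d : ℤ} (hs : ¬IsScalar (cls !![a, b; c, d])) {u v : ℕ → ℤ}
    (hu : ∀ i, 0 < u i) (hv : Function.Injective v)
    (huv : ∀ i, u i ^ 2 - ((a - d) ^ 2 + 4 * (b * c)) * v i ^ 2 = 1) :
    ¬Finite (centralizer (cls !![a, b; c, d])) := by
  -- These are the matrices `u + v (2M - tr M)`; they commute with `M` and have determinant `u² - D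
  -- v²`.
  have h : ∀ i, ∃ γ : Γ, ofPSL γ =
      cls !![u i + v i * (a - d), v i * (2 * b); v i * (2 * c), u i - v i * (a - d)] := by
    intro i
    exact exists_ofPSL (by linear_combination huv i)
  choose γ hγ using h
  rw [not_finite_iff_infinite]
  refine Infinite.of_injective (fun i => (⟨γ i, ?_⟩ : centralizer (cls !![a, b; c, d]))) ?_
  · change ofPSL (γ i) * _ = _ * ofPSL (γ i)
    rw [hγ, cls_mul_cls, cls_mul_cls, cls_entries_eq_iff]
    left
    refine ⟨?_, ?_, ?_, ?_⟩ <;> ring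
  · intro i j hij
    have h := congrArg (fun x : centralizer (cls !![a, b; c, d]) => ofPSL x.1) hij
    simp only [hγ] at h
    have hi := hu i
    have hj := hu j
    apply hv
    rcases cls_entries_eq_iff.1 h with ⟨h1, h2, h3, h4⟩ | ⟨h1, h2, h3, h4⟩
    · by_contra hne
      have hne' : v i - v j ≠ 0 := sub_ne_zero.2 hne
      apply hs
      rw [isScalar_cls]
      refine ⟨?_, ?_, ?_⟩ <;> apply mul_left_cancel₀ hne'
      · linarith
      · linarith
      · linarith
    · linarith

/-- For discriminant zero `u = 1` works with every `v`; for a positive nonsquare the powers of a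
fundamental solution of Pell's equation supply the units. -/
theorem infinite_centralizer_of_not_square {a b c d : ℤ} (hs : ¬IsScalar (cls !![a, b; c, d]))
    (hD : 0 ≤ (a - d) ^ 2 + 4 * (b * c))
    (hk : ¬∃ k : ℤ, k ≠ 0 ∧ (a - d) ^ 2 + 4 * (b * c) = k ^ 2) :
    ¬Finite (centralizer (cls !![a, b; c, d])) := by
  rcases hD.eq_or_lt with h0 | hpos
  · refine infinite_centralizer hs (u := fun _ => 1) (v := fun i => i) (fun _ => one_pos)
      Nat.cast_injective fun i => ?_
    rw [← h0]
    ring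
  · have hsq : ¬IsSquare ((a - d) ^ 2 + 4 * (b * c)) := by
      rintro ⟨k, h⟩
      refine hk ⟨k, ?_, by rw [h, sq]⟩
      rintro rfl
      linarith
    obtain ⟨e, he⟩ := Pell.IsFundamental.exists_of_not_isSquare hpos hsq
    refine infinite_centralizer hs (u := fun i => (e ^ (i : ℕ)).x) (v := fun i => (e ^ (i : ℤ)).y)
      (fun i => Pell.Solution₁.x_pow_pos he.x_pos i)
      (he.y_strictMono.injective.comp Nat.cast_injective) fun i => ?_
    rw [zpow_natCast]
    exact (e ^ i).prop

/-! ### Fixed points -/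

theorem neg_smul_onePoint (g : GL (Fin 2) ℝ) (x : OnePoint ℝ) : (-g) • x = g • x := by
  induction x with
  | infty => simp [OnePoint.smul_infty_eq_ite]
  | coe k =>
    simp only [OnePoint.smul_some_eq_ite, Units.val_neg, Matrix.neg_apply]
    have e : -(g 1 0) * k + -(g 1 1) = -(g 1 0 * k + g 1 1) := by ring
    have e2 : -(g 0 0) * k + -(g 0 1) = -(g 0 0 * k + g 0 1) := by ring
    simp only [e, e2, neg_eq_zero, neg_div_neg_eq]

theorem exists_isRealLift {n : ℕ} (hn : 1 ≤ n) {a b c d : ℤ} (hM : a * d - b * c = n) :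
    ∃ A : GL (Fin 2) ℝ, A 0 0 = a ∧ A 0 1 = b ∧ A 1 0 = c ∧ A 1 1 = d ∧
      ∀ B, IsRealLift (cls !![a, b; c, d]) B ↔ B = A ∨ B = -A := by
  have hn' : (1 : ℤ) ≤ n := by exact_mod_cast hn
  have hdet : Matrix.det !![(a : ℝ), b; c, d] ≠ 0 := by
    rw [Matrix.det_fin_two_of]
    have : (a * d - b * c : ℤ) ≠ 0 := by omega
    exact_mod_cast this
  have hA : (Matrix.GeneralLinearGroup.mkOfDetNeZero _ hdet).val =
      (!![a, b; c, d]).map (fun x : ℤ => (x : ℝ)) := by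
    ext i j
    fin_cases i <;> fin_cases j <;> rfl
  refine ⟨Matrix.GeneralLinearGroup.mkOfDetNeZero _ hdet, rfl, rfl, rfl, rfl, fun B => ?_⟩
  constructor
  · rintro ⟨C, hC, hB⟩
    rcases cls_eq_iff.1 hC with rfl | rfl
    · left
      ext1
      rw [hB, hA]
    · right
      ext1
      rw [hB, Units.val_neg, hA]
      ext i j
      simp only [Matrix.map_apply, Matrix.neg_apply, Int.cast_neg]
  · rintro (rfl | rfl)
    · exact ⟨_, rfl, hA⟩
    · refine ⟨-!![a, b; c, d], cls_eq_iff.2 (Or.inr rfl), ?_⟩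
      rw [Units.val_neg, hA]
      ext i j
      simp only [Matrix.map_apply, Matrix.neg_apply, Int.cast_neg]

theorem mem_fixedH {A : GL (Fin 2) ℝ} {M : PMat} (hA : ∀ B, IsRealLift M B ↔ B = A ∨ B = -A)
    (z : ℍ) : z ∈ fixedH M ↔ A • z = z := by
  constructor
  · rintro ⟨B, hB, h⟩
    rcases (hA B).1 hB with rfl | rfl
    · exact h
    · rwa [UpperHalfPlane.neg_smul] at h
  · intro h
    exact ⟨A, (hA A).2 (Or.inl rfl), h⟩

theorem smul_fixed_onePoint {A : GL (Fin 2) ℝ} {M : PMat} (hA : ∀ B, IsRealLift M B ↔ B = A ∨ B = -A)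
    (x : OnePoint ℝ) : (∃ B, IsRealLift M B ∧ B • x = x) ↔ A • x = x := by
  simp only [hA]
  constructor
  · rintro ⟨_, rfl | rfl, h⟩
    · exact h
    · rwa [neg_smul_onePoint] at h
  · intro h
    exact ⟨A, Or.inl rfl, h⟩

theorem smul_coe_onePoint_eq_self_iff {A : GL (Fin 2) ℝ} {x : ℝ} :
    A • (x : OnePoint ℝ) = x ↔ A 1 0 * (x * x) + (A 1 1 - A 0 0) * x + -A 0 1 = 0 := by
  rw [← Matrix.GeneralLinearGroup.fixpointPolynomial_aeval_eq_zero_iff,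
    Matrix.GeneralLinearGroup.fixpointPolynomial]
  simp [sub_eq_add_neg, sq]

theorem mem_fixedCusps {A : GL (Fin 2) ℝ} {M : PMat} (hA : ∀ B, IsRealLift M B ↔ B = A ∨ B = -A)
    (x : OnePoint ℝ) :
    x ∈ fixedCusps M ↔ x ∈ Set.range (OnePoint.map (Rat.cast : ℚ → ℝ)) ∧ A • x = x := by
  rw [← smul_fixed_onePoint hA, ← isCusp_SL2Z_iff]
  rfl

theorem discr_lift {A : GL (Fin 2) ℝ} {a b c d : ℤ} (ha : A 0 0 = a) (hb : A 0 1 = b)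
    (hc : A 1 0 = c) (hd : A 1 1 = d) : A.val.discr = ((a - d) ^ 2 + 4 * (b * c) : ℤ) := by
  rw [Matrix.discr_fin_two, Matrix.trace_fin_two, Matrix.det_fin_two, ha, hb, hc, hd]
  push_cast
  ring

theorem numFixed_of_disc_neg {n : ℕ} (hn : 1 ≤ n) {a b c d : ℤ} (hM : a * d - b * c = n)
    (hD : (a - d) ^ 2 + 4 * (b * c) < 0) : numFixed (cls !![a, b; c, d]) = 1 := by
  obtain ⟨A, ha, hb, hc, hd, hA⟩ := exists_isRealLift hn hM
  have hpos : 0 < A.val.det := by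
    rw [Matrix.det_fin_two, ha, hb, hc, hd]
    exact_mod_cast hM.symm ▸ (by exact_mod_cast hn : (0 : ℤ) < n)
  have hell : A.IsElliptic := by
    change A.val.discr < 0
    rw [discr_lift ha hb hc hd]
    exact_mod_cast hD
  have h1 : fixedH (cls !![a, b; c, d]) = {UpperHalfPlane.fixedPt A hell} := by
    ext z
    rw [mem_fixedH hA, UpperHalfPlane.gl_smul_eq_self_iff_eq_fixedPt hpos hell,
      Set.mem_singleton_iff]
  have h2 : fixedCusps (cls !![a, b; c, d]) = ∅ := by
    refine Set.eq_empty_of_forall_notMem fun x hx => ?_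
    rw [mem_fixedCusps hA] at hx
    obtain ⟨-, hx⟩ := hx
    have hDR : ((a : ℝ) - d) ^ 2 + 4 * (b * c) < 0 := by exact_mod_cast hD
    induction x with
    | infty =>
      rw [OnePoint.smul_infty_eq_self_iff, hc] at hx
      rw [hx] at hDR
      nlinarith [sq_nonneg ((a : ℝ) - d)]
    | coe x =>
      rw [smul_coe_onePoint_eq_self_iff, ha, hb, hc, hd] at hx
      have e : (2 * c * x + (d - a)) ^ 2 = ((a : ℝ) - d) ^ 2 + 4 * (b * c) := by
        linear_combination 4 * c * hx
      linarith [sq_nonneg (2 * c * x + (d - a))]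
  rw [numFixed, h1, h2, Set.ncard_singleton, Set.ncard_empty]

theorem numFixed_of_square {n : ℕ} (hn : 1 ≤ n) {a b c d k : ℤ} (hM : a * d - b * c = n)
    (hk : k ≠ 0) (hD : (a - d) ^ 2 + 4 * (b * c) = k ^ 2)
    (hs : ¬IsScalar (cls !![a, b; c, d])) : numFixed (cls !![a, b; c, d]) = 2 := by
  obtain ⟨A, ha, hb, hc, hd, hA⟩ := exists_isRealLift hn hM
  have hpos : 0 < A.val.det := by
    rw [Matrix.det_fin_two, ha, hb, hc, hd]
    exact_mod_cast hM.symm ▸ (by exact_mod_cast hn : (0 : ℤ) < n)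
  have hkR : (k : ℝ) ≠ 0 := by exact_mod_cast hk
  have hDR : ((a : ℝ) - d) ^ 2 + 4 * (b * c) = k ^ 2 := by exact_mod_cast hD
  have h1 : fixedH (cls !![a, b; c, d]) = ∅ := by
    refine Set.eq_empty_of_forall_notMem fun z hz => ?_
    rw [mem_fixedH hA] at hz
    have hell := UpperHalfPlane.isElliptic_of_exists_smul_eq_self hpos (fun hcen => hs ?_) ⟨z, hz⟩
    · change A.val.discr < 0 at hell
      rw [discr_lift ha hb hc hd, hD] at hell
      have : (0 : ℝ) ≤ ((k ^ 2 : ℤ) : ℝ) := by positivity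
      linarith
    · rw [Matrix.GeneralLinearGroup.mem_center_iff_val_mem_range_scalar] at hcen
      obtain ⟨r, hr⟩ := hcen
      have h00 := congrFun (congrFun hr 0) 0
      have h01 := congrFun (congrFun hr 0) 1
      have h10 := congrFun (congrFun hr 1) 0
      have h11 := congrFun (congrFun hr 1) 1
      rw [ha] at h00
      rw [hb] at h01
      rw [hc] at h10
      rw [hd] at h11
      simp at h00 h01 h10 h11
      rw [isScalar_cls]
      refine ⟨?_, ?_, ?_⟩
      · exact_mod_cast h01.symm
      · exact_mod_cast h10.symm
      · exact_mod_cast h00.symm.trans h11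
  have hrat : ∀ q : ℚ, ((q : ℝ) : OnePoint ℝ) ∈ Set.range (OnePoint.map (Rat.cast : ℚ → ℝ)) :=
    fun q => ⟨(q : OnePoint ℚ), rfl⟩
  have h2 : (fixedCusps (cls !![a, b; c, d])).ncard = 2 := by
    rw [Set.ncard_eq_two]
    by_cases hc0 : c = 0
    · subst hc0
      have had : (d : ℝ) - a ≠ 0 := by
        intro h
        apply hkR
        have h' : (a : ℝ) - d = 0 := by linarith
        rw [h'] at hDR
        simpa using hDR.symm
      refine ⟨OnePoint.infty, ((((b : ℚ) / (d - a) : ℚ) : ℝ) : OnePoint ℝ),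
        OnePoint.infty_ne_coe _, ?_⟩
      ext x
      rw [mem_fixedCusps hA, Set.mem_insert_iff, Set.mem_singleton_iff]
      induction x with
      | infty =>
        refine iff_of_true ⟨⟨OnePoint.infty, rfl⟩, ?_⟩ (Or.inl rfl)
        rw [OnePoint.smul_infty_eq_self_iff, hc, Int.cast_zero]
      | coe x =>
        rw [smul_coe_onePoint_eq_self_iff, ha, hb, hc, hd, OnePoint.coe_eq_coe]
        have hx : ((0 : ℤ) : ℝ) * (x * x) + (d - a) * x + -b = 0 ↔
            x = (((b : ℚ) / (d - a) : ℚ) : ℝ) := by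
          push_cast
          rw [eq_div_iff had]
          constructor <;> intro h <;> linarith
        rw [hx]
        constructor
        · exact fun h => Or.inr h.2
        · rintro (h | rfl)
          · exact (OnePoint.coe_ne_infty _ h).elim
          · exact ⟨hrat _, rfl⟩
    · have hcR : (c : ℝ) ≠ 0 := by exact_mod_cast hc0
      refine ⟨((((-(d - a) + k) / (2 * c) : ℚ) : ℝ) : OnePoint ℝ),
        ((((-(d - a) - k) / (2 * c) : ℚ) : ℝ) : OnePoint ℝ), ?_, ?_⟩
      · rw [Ne, OnePoint.coe_eq_coe]
        push_cast
        rw [div_left_inj' (by simpa using hcR)]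
        intro h
        apply hkR
        linarith
      · ext x
        rw [mem_fixedCusps hA, Set.mem_insert_iff, Set.mem_singleton_iff]
        induction x with
        | infty =>
          refine iff_of_false (fun h => ?_) (by simp)
          rw [OnePoint.smul_infty_eq_self_iff, hc] at h
          exact hcR h.2
        | coe x =>
          rw [smul_coe_onePoint_eq_self_iff, ha, hb, hc, hd, OnePoint.coe_eq_coe,
            OnePoint.coe_eq_coe, quadratic_eq_zero_iff hcR (s := k) (by
              rw [discrim]; linear_combination hDR)]
          push_cast
          constructor
          · exact fun h => h.2
          · rintro (rfl | rfl)
            · refine ⟨?_, Or.inl rfl⟩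
              have := hrat ((-(d - a) + k) / (2 * c))
              push_cast at this
              exact this
            · refine ⟨?_, Or.inr rfl⟩
              have := hrat ((-(d - a) - k) / (2 * c))
              push_cast at this
              exact this
  rw [numFixed, h1, h2, Set.ncard_empty]

/-! ### The area of the fundamental domain -/

open MeasureTheory

theorem lintegral_Ici_one_div_sq {s : ℝ} (hs : 0 < s) :
    ∫⁻ y in Set.Ici s, ((1 / ‖y‖₊) ^ 2 : NNReal) = ENNReal.ofReal (1 / s) := by
  rw [← setLIntegral_congr Ioi_ae_eq_Ici]
  have h1 : ∫⁻ y in Set.Ioi s, ((1 / ‖y‖₊) ^ 2 : NNReal) =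
      ∫⁻ y in Set.Ioi s, ENNReal.ofReal (y ^ (-2 : ℝ)) := by
    refine setLIntegral_congr_fun measurableSet_Ioi fun y hy => ?_
    have hy0 : 0 < y := hs.trans hy
    have e : y ^ (-2 : ℝ) = (((1 / ‖y‖₊) ^ 2 : NNReal) : ℝ) := by
      push_cast
      rw [Real.norm_of_nonneg hy0.le, Real.rpow_neg hy0.le, Real.rpow_two, one_div, inv_pow]
    rw [e, ENNReal.ofReal_coe_nnreal]
  rw [h1, ← ofReal_integral_eq_lintegral_ofReal (integrableOn_Ioi_rpow_of_lt (by norm_num) hs),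
    integral_Ioi_rpow_of_lt (by norm_num) hs]
  · congr 1
    rw [show (-2 : ℝ) + 1 = -1 by norm_num, Real.rpow_neg_one]
    field_simp
  · filter_upwards [self_mem_ae_restrict measurableSet_Ioi] with y hy
    exact Real.rpow_nonneg (hs.le.trans (le_of_lt hy)) _

theorem integral_one_div_sqrt :
    ∫ x in (-(1 / 2) : ℝ)..(1 / 2), 1 / √(1 - x ^ 2) = Real.pi / 3 := by
  have hmem : ∀ x ∈ Set.uIcc (-(1 / 2) : ℝ) (1 / 2), 0 < 1 - x ^ 2 := by
    intro x hx
    rw [Set.uIcc_of_le (by norm_num)] at hx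
    nlinarith [hx.1, hx.2]
  rw [intervalIntegral.integral_eq_sub_of_hasDerivAt (f := Real.arcsin)]
  · have h : Real.arcsin (1 / 2) = Real.pi / 6 := by
      rw [← Real.sin_pi_div_six, Real.arcsin_sin] <;> linarith [Real.pi_pos]
    rw [Real.arcsin_neg, h]
    ring
  · intro x hx
    have h := hmem x hx
    exact Real.hasDerivAt_arcsin (by rintro rfl; norm_num at h) (by rintro rfl; norm_num at h)
  · refine ContinuousOn.intervalIntegrable fun x hx => ContinuousAt.continuousWithinAt ?_
    have h := (Real.sqrt_pos.2 (hmem x hx)).ne'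
    fun_prop (disch := assumption)

/-- By Tonelli, the vertical integral of `dy / y²` above the unit circle is `1 / √(1 - x²)`, whose
integral over `|x| ≤ 1 / 2` is a difference of arcsines. -/
theorem volume_fd : volume ModularGroup.fd = ENNReal.ofReal (Real.pi / 3) := by
  let E : Set (ℝ × ℝ) := {p | |p.1| ≤ 1 / 2 ∧ √(1 - p.1 ^ 2) ≤ p.2}
  let f : ℝ × ℝ → ENNReal := fun p => ((1 / ‖p.2‖₊) ^ 2 : NNReal)
  have hEm : MeasurableSet E := by
    apply IsClosed.measurableSet
    exact (isClosed_le (f := fun p : ℝ × ℝ => |p.1|) (g := fun _ => 1 / 2) (by fun_prop)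
      (by fun_prop)).inter (isClosed_le (f := fun p : ℝ × ℝ => √(1 - p.1 ^ 2)) (g := fun p => p.2)
      (by fun_prop) (by fun_prop))
  have hf : Measurable f := by fun_prop
  have hpos : ∀ {x : ℝ}, |x| ≤ 1 / 2 → 0 < 1 - x ^ 2 := by
    intro x hx
    rw [abs_le] at hx
    nlinarith [hx.1, hx.2]
  have hE : UpperHalfPlane.coe '' ModularGroup.fd = Complex.measurableEquivRealProd ⁻¹' E := by
    ext z
    simp only [Set.mem_image, ModularGroup.fd, Set.mem_preimage, E,
      Complex.measurableEquivRealProd_apply]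
    constructor
    · rintro ⟨z, ⟨h1, h2⟩, rfl⟩
      refine ⟨h2, Real.sqrt_le_iff.2 ⟨z.im_pos.le, ?_⟩⟩
      rw [Complex.normSq_apply] at h1
      change 1 ≤ z.re * z.re + z.im * z.im at h1
      change 1 - z.re ^ 2 ≤ z.im ^ 2
      linarith
    · rintro ⟨h1, h2⟩
      have him : 0 < z.im := (Real.sqrt_pos.2 (hpos h1)).trans_le h2
      refine ⟨⟨z, him⟩, ⟨?_, h1⟩, rfl⟩
      have h3 := (Real.sqrt_le_iff.1 h2).2
      change 1 ≤ Complex.normSq z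
      rw [Complex.normSq_apply]
      change 1 - z.re ^ 2 ≤ z.im ^ 2 at h3
      linarith
  rw [UpperHalfPlane.volume_eq_lintegral, hE]
  have h1 := Complex.volume_preserving_equiv_real_prod.setLIntegral_comp_preimage hEm hf
  refine h1.trans ?_
  rw [← lintegral_indicator hEm, Measure.volume_eq_prod,
    lintegral_prod _ (hf.indicator hEm).aemeasurable]
  have h2 : ∀ x : ℝ, ∫⁻ y, E.indicator f (x, y) =
      (Set.Icc (-(1 / 2)) (1 / 2)).indicator (fun x => ENNReal.ofReal (1 / √(1 - x ^ 2))) x := by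
    intro x
    by_cases hx : |x| ≤ 1 / 2
    · rw [Set.indicator_of_mem (Set.mem_Icc.2 (abs_le.1 hx)),
        ← lintegral_Ici_one_div_sq (Real.sqrt_pos.2 (hpos hx)),
        ← lintegral_indicator measurableSet_Ici]
      refine lintegral_congr fun y => ?_
      by_cases hy : √(1 - x ^ 2) ≤ y
      · rw [Set.indicator_of_mem (show (x, y) ∈ E from ⟨hx, hy⟩),
          Set.indicator_of_mem (Set.mem_Ici.2 hy)]
      · rw [Set.indicator_of_notMem (show (x, y) ∉ E from fun h => hy h.2),
          Set.indicator_of_notMem (fun h => hy (Set.mem_Ici.1 h))]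
    · rw [Set.indicator_of_notMem (fun h => hx (abs_le.2 (Set.mem_Icc.1 h)))]
      refine (lintegral_congr fun y => ?_).trans lintegral_zero
      exact Set.indicator_of_notMem (show (x, y) ∉ E from fun h => hx h.1) _
  simp only [h2]
  have hcont : ContinuousOn (fun x : ℝ => 1 / √(1 - x ^ 2)) (Set.Icc (-(1 / 2)) (1 / 2)) := by
    refine fun x hx => ContinuousAt.continuousWithinAt ?_
    have h := (Real.sqrt_pos.2 (hpos (abs_le.2 hx))).ne'
    fun_prop (disch := assumption)
  rw [lintegral_indicator measurableSet_Icc,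
    ← ofReal_integral_eq_lintegral_ofReal (hcont.integrableOn_Icc), integral_Icc_eq_integral_Ioc,
    ← intervalIntegral.integral_of_le (by norm_num), integral_one_div_sqrt]
  exact Filter.Eventually.of_forall fun x => by positivity

theorem area_eq : area = Real.pi / 3 := by
  rw [area, volume_fd, ENNReal.toReal_ofReal (by positivity)]

/-! ### The invariant `w` -/

theorem deg_conjClass_liftElt_eq_w {n : ℕ} (hn : 1 ≤ n) {M : PMat} (hM : det M = n) :
    (deg (conjClass M) (liftElt hn) : ℝ) = w M := by
  by_cases hs : IsScalar M
  · rw [deg_conjClass_liftElt_of_isScalar hn hM hs, w, if_pos hs, area_eq]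
    have := Real.pi_ne_zero
    push_cast
    field_simp
    norm_num
  rw [w, if_neg hs]
  obtain ⟨a, b, c, d, rfl⟩ := exists_entries M
  rw [det_cls] at hM
  rcases lt_or_ge ((a - d) ^ 2 + 4 * (b * c)) 0 with hD | hD
  · obtain ⟨h1, h2⟩ := deg_conjClass_of_disc_neg hn hM hD
    rw [if_pos h1, h2, numFixed_of_disc_neg hn hM hD]
    push_cast
    norm_num
  by_cases hk : ∃ k : ℤ, k ≠ 0 ∧ (a - d) ^ 2 + 4 * (b * c) = k ^ 2
  · obtain ⟨k, hk, hD⟩ := hk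
    have ht : a + d ≠ 0 := by
      intro h
      have hn' : (1 : ℤ) ≤ n := by exact_mod_cast hn
      obtain rfl : d = -a := by linarith
      nlinarith
    have hbot := centralizer_eq_bot (b := b) (c := c) ht hk hD
    have hfin : Finite (centralizer (cls !![a, b; c, d])) := by
      rw [hbot]
      infer_instance
    rw [deg_conjClass_of_square hn hM hk hD hs, if_pos hfin, numFixed_of_square hn hM hk hD hs,
      hbot, Subgroup.card_bot]
    norm_num
  · rw [deg_conjClass_of_not_square hn hM hD hs hk,
      if_neg (infinite_centralizer_of_not_square hs hD hk), Rat.cast_zero]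

end ModularHecke

open ModularHecke in
theorem mainTheorem5 (g : Fin 2 → Γ) (hg0 : orderOf (g 0) = 2) (hg1 : orderOf (g 1) = 3)
    (hg : Subgroup.closure (Set.range g) = ⊤) (n : ℕ) (hn : 1 ≤ n) (c : Choices g n) :
    (∀ M : PMat, det M = n → deg (conjClass M) c.Ttilde' = deg (conjClass M) c.Ttilde) ∧
    (∀ M : PMat, det M = n → deg (coset M) c.Ttilde' = 1) ∧
    (∀ i j : Fin 2, i ≠ j → idem (g i) * c.Ttilde' = idem (g i) * c.heckeSum * idem (g j)) ∧
    (∃ h : Γ, g 0 = h * S * h⁻¹ ∧ (g 1 = h * U * h⁻¹ ∨ g 1 = h * U⁻¹ * h⁻¹) ∧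
      IsPopaZagier n (elΓ h⁻¹ * (-adjR c.Ttilde') * elΓ h)) ∧
    (∀ M : PMat, det M = n → (deg (conjClass M) c.Ttilde : ℝ) = w M) := by
  obtain ⟨h, h0, h1⟩ := exists_conj_generators hg0 hg1 hg
  have hlift := c.isLift_conj hg0 hg1 h0 h1
  refine ⟨fun M _ => c.deg_conjClass_Ttilde' hg0 hg1 M, fun M hM => c.deg_coset_Ttilde' hM,
    fun i j hij => c.idem_mul_Ttilde' hg0 hg1 hij, ⟨h, h0, h1, ?_⟩, fun M hM => ?_⟩
  · have hPZ := hlift.isPopaZagier hn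
    -- The adjoint inverts elements of `Γ` and reverses products, so it commutes with conjugation by
    -- `h`.
    rwa [adjR_mul, adjR_mul, adjR_elΓ, adjR_elΓ, inv_inv, ← mul_assoc, ← neg_mul, ← mul_neg] at hPZ
  · rw [← c.deg_conjClass_Ttilde' hg0 hg1, ← deg_conjClass_conj M h,
      hlift.deg_conjClass_eq hn (isLift_liftElt hn), deg_conjClass_liftElt_eq_w hn hM]
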